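/- **Setting.** Let $\mathbb K=\mathbb R$ or $\mathbb C$, let $M$ be a smooth (Hausdorff) manifold of dimension $d$, let $\mathcal P$ be a smooth Poisson tensor on $M$ with bracket $\{f,g\}=\mathcal P(df,dg)$ on $C^\infty(M)=C^\infty(M,\mathbb K)$, and let $\nabla$ be a smooth torsion-free linear connection on $M$. Write $X_f=i(df)\mathcal P$, i.e. $X_f^j=\mathcal P^{ij}\partial_i f$ (so $X_fg=\{f,g\}$), and for a vector field $X$ let $\mathcal L_X\nabla$ be the tensor $$(\mathcal L_X\nabla)(Y,Z)=[X,\nabla_YZ]-\nabla_{[X,Y]}Z-\nabla_Y[X,Z],\qquad (\mathcal L_X\nabla)^j_{kl}=dx^j\big((\mathcal L_X\nabla)(\partial_k,\partial_l)\big),$$ extended $\mathbb K$-linearly in $X$. (Repeated indices are summed.) Put $$f\,\tilde *_3\,g=f\,g+\nu\{f,g\}+\nu^2\tilde C_2(f,g)+\nu^3\tilde C_3(f,g),$$ $$\tilde C_2(f,g)=\tfrac12\mathcal P^{kr}\mathcal P^{ls}\nabla^2_{kl}f\,\nabla^2_{rs}g+\tfrac13\mathcal P^{kr}\nabla_r\mathcal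 P^{ls}\big(\nabla^2_{kl}f\,\nabla_sg+\nabla_sf\,\nabla^2_{kl}g\big)-\tfrac16\nabla_l\mathcal P^{kr}\,\nabla_k\mathcal P^{ls}\,\nabla_rf\,\nabla_sg,$$ $$\tilde C_3(f,g)=-\tfrac16\mathcal P^{ls}(\mathcal L_{X_f}\nabla)^j_{kl}(\mathcal L_{X_g}\nabla)^k_{js},$$ extended $\mathbb K[[\nu]]$-bilinearly to formal power series in $\nu$; write $\tilde *_3^{\mathcal Q}$ for the product given by the same formulas with $\mathcal P$ replaced by another $2$-tensor $\mathcal Q$ and the same $\nabla$. For a vector field $X$ define, $\mathbb K[[\nu]]$-linearly, $$D_Xg=Xg-\frac{\nu^2}{6}\,\mathcal P^{ls}(\mathcal L_X\nabla)^j_{kl}(\mathcal L_{X_g}\nabla)^k_{js}.$$ **Proposition.** 1. Let $X$ be a smooth real vector field on $M$ and let $\phi_t$ be a smooth local flow of $X$, defined for $|t|<\varepsilon$ on an open set $U\subseteq M$. Then for all $f,g\in C^\infty(M)$, at every point of $U$, $$D_X(f\,\tilde *_3\,g)-(D_Xf)\,\tilde *_3\,g-f\,\tilde *_3\,(D_Xg)=\frac{d}{dt}\Big|_{t=0}\,f\,\tilde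 *_3^{\,(\phi_{-t})_*\mathcal P}\,g+O(\nu^4),$$ that is, for each $n\le 3$ the coefficient of $\nu^n$ in $f\,\tilde *_3^{\,(\phi_{-t})_*\mathcal P}\,g$ is, at each point of $U$, differentiable in $t$ at $t=0$, and its derivative is the coefficient of $\nu^n$ of the left-hand side. 2. For all $f,g\in C^\infty(M)$, $$D_{X_f}g=\frac1{2\nu}\big(f\,\tilde *_3\,g-g\,\tilde *_3\,f\big),$$ exactly, as polynomials in $\nu$ (for $\mathbb K=\mathbb C$ and complex $f$, $X_f=X_{\operatorname{Re}f}+iX_{\operatorname{Im}f}$ and $D_X$ is extended $\mathbb C$-linearly in $X$). -/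

import Mathlib

open scoped Manifold ContDiff

namespace UniversalStar

noncomputable section

/-- The model space of `d`-dimensional manifolds. -/
abbrev Model (d : ℕ) : Type := EuclideanSpace ℝ (Fin d)

variable {d : ℕ} {M : Type*} [TopologicalSpace M] [ChartedSpace (Model d) M]
  {𝕜 : Type*} [RCLike 𝕜]

/-! ### Coordinate frames -/

/-- The tangent vector `∂_i` at `x` of the preferred chart around `x`
(through which Mathlib identifies the tangent space at `x` with the model space). -/
def partialAt (x : M) (i : Fin d) : TangentSpace (𝓡 d) x :=
  (EuclideanSpace.single i (1 : ℝ) : Model d)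

/-- The `i`-th coordinate `v^i` of a tangent vector at `x`, as a covector: this is `dx^i` at `x`. -/
def coordAt (x : M) (i : Fin d) : TangentSpace (𝓡 d) x →L[ℝ] ℝ :=
  (EuclideanSpace.proj i : Model d →L[ℝ] ℝ)

/-- The vector field `∂_i` of the preferred chart around `x` (zero off the domain of that chart). -/
def coordField [IsManifold (𝓡 d) 1 M] (x : M) (i : Fin d) (y : M) : TangentSpace (𝓡 d) y :=
  FiberBundle.extend (Model d) (partialAt x i) y

/-- The covector field `dx^i` of the preferred chart around `x`: the differential
of the `i`-th coordinate function of that chart. -/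
def coordForm (x : M) (i : Fin d) (y : M) : TangentSpace (𝓡 d) y →L[ℝ] ℝ :=
  mvfderiv (𝓡 d) (fun z : M => (EuclideanSpace.proj i : Model d →L[ℝ] ℝ) (extChartAt (𝓡 d) x z)) y

/-- The function `X f`, for a vector field `X` and a function `f` with real or complex values. -/
def dirDeriv (X : (y : M) → TangentSpace (𝓡 d) y) (f : M → 𝕜) (y : M) : 𝕜 :=
  mvfderiv (𝓡 d) f y (X y)

/-! ### Poisson structures -/

variable (d M) in
/-- A field of bilinear forms on the cotangent spaces, i.e. a contravariant `2`-tensor field. -/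
abbrev TwoTensor : Type _ :=
  (x : M) → (TangentSpace (𝓡 d) x →L[ℝ] ℝ) →ₗ[ℝ] (TangentSpace (𝓡 d) x →L[ℝ] ℝ) →ₗ[ℝ] ℝ

/-- The component `P^{ij}` at `x`, in the preferred chart around `x`. -/
def comp (P : TwoTensor d M) (x : M) (i j : Fin d) : ℝ := P x (coordAt x i) (coordAt x j)

/-- The bracket `{f, g} = P(df, dg) = P^{ij} ∂_i f ∂_j g`. -/
def bracket (P : TwoTensor d M) (f g : M → 𝕜) (x : M) : 𝕜 :=
  ∑ i, ∑ j, (comp P x i j : 𝕜) * mvfderiv (𝓡 d) f x (partialAt x i)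
    * mvfderiv (𝓡 d) g x (partialAt x j)

/-- `P` is a (smooth, real) Poisson tensor. -/
structure IsPoisson (P : TwoTensor d M) : Prop where
  skew : ∀ (x : M) (α β : TangentSpace (𝓡 d) x →L[ℝ] ℝ), P x α β = - P x β α
  smooth : ∀ f g : M → ℝ, ContMDiff (𝓡 d) 𝓘(ℝ, ℝ) ∞ f → ContMDiff (𝓡 d) 𝓘(ℝ, ℝ) ∞ g →
    ContMDiff (𝓡 d) 𝓘(ℝ, ℝ) ∞ (bracket P f g)
  jacobi : ∀ f g h : M → ℝ, ContMDiff (𝓡 d) 𝓘(ℝ, ℝ) ∞ f → ContMDiff (𝓡 d) 𝓘(ℝ, ℝ) ∞ g →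
    ContMDiff (𝓡 d) 𝓘(ℝ, ℝ) ∞ h →
    bracket P f (bracket P g h) + bracket P g (bracket P h f) + bracket P h (bracket P f g) = 0

/-- The Hamiltonian vector field `X_f = i(df) P` of a real function, `X_f^j = P^{ij} ∂_i f`. -/
def ham (P : TwoTensor d M) (f : M → ℝ) (x : M) : TangentSpace (𝓡 d) x :=
  ∑ j, P x (mvfderiv (𝓡 d) f x) (coordAt x j) • partialAt x j

/-! ### Flows -/

/-- `φ` is a smooth local flow of the vector field `X`, defined for times in `(-ε, ε)` and
initial points in the open set `U`. -/
structure IsLocalFlow (X : (y : M) → TangentSpace (𝓡 d) y) (U : Set M) (ε : ℝ)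
    (φ : ℝ → M → M) : Prop where
  isOpen : IsOpen U
  pos : 0 < ε
  smooth : ContMDiffOn (𝓘(ℝ, ℝ).prod (𝓡 d)) (𝓡 d) ∞ (fun p : ℝ × M => φ p.1 p.2)
    (Set.Ioo (-ε) ε ×ˢ U)
  zero : ∀ y ∈ U, φ 0 y = y
  integralCurve : ∀ y ∈ U, IsMIntegralCurveOn (I := 𝓡 d) (fun t => φ t y) X (Set.Ioo (-ε) ε)

/-- The push-forward `φ_{s*} P` under the time-`s` map of a flow `φ` (whose inverse is `φ_{-s}`):
`(φ_{s*} P)_y (α, β) = P_{φ_{-s} y} (α ∘ (dφ_{-s})⁻¹, β ∘ (dφ_{-s})⁻¹)`. -/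
def pushforward (φ : ℝ → M → M) (s : ℝ) (P : TwoTensor d M) : TwoTensor d M := fun y =>
  let A : TangentSpace (𝓡 d) (φ (-s) y) →L[ℝ] TangentSpace (𝓡 d) y :=
    (mfderiv (𝓡 d) (𝓡 d) (φ (-s)) y).inverse
  LinearMap.mk₂ ℝ (fun α β => P (φ (-s) y) (α.comp A) (β.comp A))
    (fun α α' β => by simp [ContinuousLinearMap.add_comp])
    (fun c α β => by simp [ContinuousLinearMap.smul_comp])
    (fun α β β' => by simp [ContinuousLinearMap.add_comp])
    (fun c α β => by simp [ContinuousLinearMap.smul_comp])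

/-! ### Covariant derivatives -/

variable [IsManifold (𝓡 d) 1 M]

variable (d M) in
/-- Linear connections on `M`. -/
abbrev Connection : Type _ :=
  CovariantDerivative (𝓡 d) (Model d) (TangentSpace (𝓡 d) : M → Type _)

/-- The Christoffel symbol `Γ^i_{kl} = dx^i (∇_{∂_k} ∂_l)` at `x`. -/
def christoffel (nabla : Connection d M) (x : M) (i k l : Fin d) : ℝ :=
  coordAt x i (nabla (coordField x l) x (partialAt x k))

/-- `∇²_{kl} f` at `x`. -/
def hess (nabla : Connection d M) (f : M → 𝕜) (x : M) (k l : Fin d) : 𝕜 :=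
  mvfderiv (𝓡 d) (dirDeriv (coordField x l) f) x (partialAt x k)
    - ∑ m, (christoffel nabla x m k l : 𝕜) * mvfderiv (𝓡 d) f x (partialAt x m)

/-- `∇_k P^{ij}` at `x`, i.e. `∂_k P^{ij} + Γ^i_{km} P^{mj} + Γ^j_{km} P^{im}`. -/
def nablaP (nabla : Connection d M) (P : TwoTensor d M) (x : M) (k i j : Fin d) : ℝ :=
  mvfderiv (𝓡 d) (fun y => P y (coordForm x i y) (coordForm x j y)) x (partialAt x k)
    + ∑ m, (christoffel nabla x i k m * comp P x m j + christoffel nabla x j k m * comp P x i m)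

/-- The Lie derivative of a connection:
`(L_X ∇)(V, W) = [X, ∇_V W] - ∇_{[X, V]} W - ∇_V [X, W]`, as a function of vector fields. -/
def lieConnection (nabla : Connection d M) (X V W : (y : M) → TangentSpace (𝓡 d) y) (x : M) :
    TangentSpace (𝓡 d) x :=
  VectorField.mlieBracket (𝓡 d) X (fun y => nabla W y (V y)) x
    - nabla W x (VectorField.mlieBracket (𝓡 d) X V x)
    - nabla (fun y => VectorField.mlieBracket (𝓡 d) X W y) x (V x)

/-- The component `(L_X ∇)^j_{kl}` at `x`. -/
def lieComp (nabla : Connection d M) (X : (y : M) → TangentSpace (𝓡 d) y) (x : M)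
    (j k l : Fin d) : ℝ :=
  coordAt x j (lieConnection nabla X (coordField x k) (coordField x l) x)

/-- The component `(L_{X_f} ∇)^j_{kl}` at `x`. For a complex function `f` the Hamiltonian vector
field is `X_f = X_{Re f} + i X_{Im f}`, and `L_X ∇` is complex linear in `X`. -/
def lieHam (nabla : Connection d M) (P : TwoTensor d M) (f : M → 𝕜) (x : M)
    (j k l : Fin d) : 𝕜 :=
  (lieComp nabla (ham P fun y => RCLike.re (f y)) x j k l : 𝕜)
    + RCLike.I * (lieComp nabla (ham P fun y => RCLike.im (f y)) x j k l : 𝕜)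

/-! ### The star product at order three -/

/-- `½ P^{kr} P^{ls} ∇²_{kl} f ∇²_{rs} g + ⅓ P^{kr} ∇_r P^{ls} (∇²_{kl} f ∇_s g + ∇_s f ∇²_{kl} g)
- ⅙ ∇_l P^{kr} ∇_k P^{ls} ∇_r f ∇_s g`. -/
def C₂ (nabla : Connection d M) (P : TwoTensor d M) (f g : M → 𝕜) (x : M) : 𝕜 :=
  let D (f : M → 𝕜) (i : Fin d) : 𝕜 := mvfderiv (𝓡 d) f x (partialAt x i)
  ∑ k, ∑ l, ∑ r, ∑ s,
    ((1 / 2 : 𝕜) * (comp P x k r : 𝕜) * (comp P x l s : 𝕜)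
        * hess nabla f x k l * hess nabla g x r s
      + (1 / 3 : 𝕜) * (comp P x k r : 𝕜) * (nablaP nabla P x r l s : 𝕜)
        * (hess nabla f x k l * D g s + D f s * hess nabla g x k l)
      - (1 / 6 : 𝕜) * (nablaP nabla P x l k r : 𝕜) * (nablaP nabla P x k l s : 𝕜)
        * D f r * D g s)

/-- `-⅙ P^{ls} (L_{X_f} ∇)^j_{kl} (L_{X_g} ∇)^k_{js}`. -/
def C₃ (nabla : Connection d M) (P : TwoTensor d M) (f g : M → 𝕜) (x : M) : 𝕜 :=
  - (1 / 6 : 𝕜) * ∑ l, ∑ s, ∑ j, ∑ k,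
    (comp P x l s : 𝕜) * lieHam nabla P f x j k l * lieHam nabla P g x k j s

/-- The bidifferential operators of the star product: `C_0` is the pointwise product, `C_1` the
Poisson bracket, `C_2` and `C_3` are as above, and the product stops at order three. -/
def starCoeff (nabla : Connection d M) (P : TwoTensor d M) : ℕ → (M → 𝕜) → (M → 𝕜) → M → 𝕜
  | 0, f, g => f * g
  | 1, f, g => bracket P f g
  | 2, f, g => C₂ nabla P f g
  | 3, f, g => C₃ nabla P f g
  | _, _, _ => 0

/-- The product `F *₃ G`, extended bilinearly over `𝕜⟦ν⟧` to formal power series of functions: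
the coefficient of `ν^n` is the sum of the `C_r (F_a, G_b)` with `r + (a + b) = n`. -/
def star (nabla : Connection d M) (P : TwoTensor d M) (F G : PowerSeries (M → 𝕜)) :
    PowerSeries (M → 𝕜) :=
  PowerSeries.mk fun n => ∑ p ∈ Finset.HasAntidiagonal.antidiagonal n, ∑ q ∈ Finset.HasAntidiagonal.antidiagonal p.2,
    starCoeff nabla P p.1 (PowerSeries.coeff q.1 F) (PowerSeries.coeff q.2 G)

/-! ### The operator `D_X` -/

/-- `-⅙ P^{ls} (L_X ∇)^j_{kl} (L_{X_g} ∇)^k_{js}`, for a real vector field `X`. -/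
def derivCorrection (nabla : Connection d M) (P : TwoTensor d M)
    (X : (y : M) → TangentSpace (𝓡 d) y) (g : M → 𝕜) (x : M) : 𝕜 :=
  - (1 / 6 : 𝕜) * ∑ l, ∑ s, ∑ j, ∑ k,
    (comp P x l s : 𝕜) * (lieComp nabla X x j k l : 𝕜) * lieHam nabla P g x k j s

/-- `D_X g = X g - (ν²/6) P^{ls} (L_X ∇)^j_{kl} (L_{X_g} ∇)^k_{js}`, extended linearly over `𝕜⟦ν⟧`
to formal power series of functions. -/
def derivOp (nabla : Connection d M) (P : TwoTensor d M)
    (X : (y : M) → TangentSpace (𝓡 d) y) (G : PowerSeries (M → 𝕜)) : PowerSeries (M → 𝕜) :=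
  PowerSeries.mk (fun n => dirDeriv X (PowerSeries.coeff n G))
    + PowerSeries.X ^ 2
      * PowerSeries.mk (fun n => derivCorrection nabla P X (PowerSeries.coeff n G))

/-- `D_{X_f}` for a real or complex function `f`, where `X_f = X_{Re f} + i X_{Im f}` and `D_X` is
complex linear in `X` (for `𝕜 = ℝ` the second summand vanishes). -/
def derivOpHam (nabla : Connection d M) (P : TwoTensor d M) (f : M → 𝕜)
    (G : PowerSeries (M → 𝕜)) : PowerSeries (M → 𝕜) :=
  derivOp nabla P (ham P fun y => RCLike.re (f y)) G
    + (RCLike.I : 𝕜) • derivOp nabla P (ham P fun y => RCLike.im (f y)) G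

end

end UniversalStar

/-! Write `H_f` for the Hessian of `f`, `Y_f = ∇X_f`, and `⟨S, T⟩ = P^{ls} S^j_{kl} T^k_{js}`
(`Jet.pairing`). This form is skew because `P` is. Skewness of `P` and symmetry of the Hessians
collapse the second coefficient to `-1/6` times `Jet.c₂ = tr(H_f P Y_g) + tr(H_g P Y_f) + tr(Y_f
Y_g)`; the third is `-1/6` times `Jet.c₃ = ⟨L_{X_f}∇, L_{X_g}∇⟩`.

All these expressions are natural in `(P, ∇, f, g)`. Since `φ_{-t*}P` has derivative `L_X P` at `t =
0`, differentiating naturality along `X` shows that the required time derivative of `c_n(f,g)` is `X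
c_n(f,g) - c_n(Xf,g) - c_n(f,Xg)` minus the variation of `c_n` when the connection moves in the
direction `T = L_X∇`. The correction term of `D_X` is there to supply this last contribution. At
order two, `L_{X_{fg}}∇ - f L_{X_g}∇ - g L_{X_f}∇` is explicit (`Jet.lieGamma_ham_mul`), and its
pairing with `T` is minus the variation of `c₂` (`Jet.pairing_lieGamma_ham_mul`). At order three,
the variation of `c₃` is `⟨L_{X_f}T, L_{X_g}∇⟩ + ⟨L_{X_f}∇, L_{X_g}T⟩`. The Jacobi identity gives
`L_{X_f}P = 0` and `[X_f, X_g] = X_{{f,g}}`. Together with `L_{[X,Y]} = [L_X, L_Y]` on connections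
and the Leibniz rule for the pairing, this makes the failure of `g ↦ ⟨T, L_{X_g}∇⟩` to be a
derivation of the bracket equal to minus that variation (`Jet.snd_c₃`). The commutator formula is a
matter of parity: the coefficients of even order are symmetric, those of odd order skew, and both
`{f, g}` and the third coefficient are obtained by inserting `X_f` into the two terms of `D_X g`.

The calculations take place in commutative rings with commuting derivations. Naturality is proved
once, for an abstract `Jet.CoordChange`, and used twice: for changes of charts acting on germs of
smooth functions, and for the infinitesimal change `f ↦ f + ε X f` into the dual numbers, with
Jacobian `1 + ε DX`, whose `ε`-parts are Lie derivatives. Differentiation in time is the ring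
homomorphism `timeDual` from germs on `ℝ × Model d` to dual numbers over germs on `Model d`. It
sends the pushed-forward bivector to `P + ε L_X P` (`IsLocalFlow.timeDual_pushHat`), so the time
derivative of each coefficient is the `ε`-part of the same expression over the dual numbers. -/

namespace UniversalStar

/-! ### Coordinate expressions in a ring with derivations -/

namespace Jet

open Matrix

section Expressions

variable {ι R : Type*} [Fintype ι] [CommRing R]

/-- The Poisson bracket of a bivector `P` with respect to the partial derivatives `D`. -/
def bracket (D : ι → R → R) (P : Matrix ι ι R) (f g : R) : R :=
  ∑ i, ∑ j, P i j * D i f * D j g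

/-- The components of the Hamiltonian vector field of `f`. -/
def ham (D : ι → R → R) (P : Matrix ι ι R) (f : R) (k : ι) : R := ∑ i, P i k * D i f

/-- The Hessian of `f` with respect to the Christoffel symbols `Γ`. -/
def hess (D : ι → R → R) (Γ : ι → ι → ι → R) (f : R) : Matrix ι ι R :=
  .of fun k l => D k (D l f) - ∑ m, Γ m k l * D m f

/-- The covariant derivative of a vector field, with entry `∇_j X^k` at `(j, k)`. -/
def cov (D : ι → R → R) (Γ : ι → ι → ι → R) (X : ι → R) : Matrix ι ι R :=
  .of fun j k => D j (X k) + ∑ m, Γ k j m * X m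

/-- The components `(L_X ∇)^j_{kl}` of the Lie derivative of a connection. -/
def lieGamma (D : ι → R → R) (Γ : ι → ι → ι → R) (X : ι → R) (j k l : ι) : R :=
  D k (D l (X j)) + ∑ m, (X m * D m (Γ j k l) - Γ m k l * D m (X j) + Γ j m l * D k (X m)
    + Γ j k m * D l (X m))

/-- The components `(L_X T)^j_{kl}` of the Lie derivative of a tensor. -/
def lieTensor (D : ι → R → R) (T : ι → ι → ι → R) (X : ι → R) (j k l : ι) : R :=
  ∑ m, (X m * D m (T j k l) - T m k l * D m (X j) + T j m l * D k (X m) + T j k m * D l (X m))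

/-- The components of the Lie derivative of a bivector. -/
def lieBivector (D : ι → R → R) (P : Matrix ι ι R) (X : ι → R) : Matrix ι ι R :=
  .of fun i j => ∑ m, (X m * D m (P i j) - P m j * D m (X i) - P i m * D m (X j))

/-- The derivative along a vector field. -/
def dir (D : ι → R → R) (X : ι → R) (f : R) : R := ∑ m, X m * D m f

/-- The Lie bracket of vector fields. -/
def lie (D : ι → R → R) (X Y : ι → R) (j : ι) : R := ∑ m, (X m * D m (Y j) - Y m * D m (X j))

/-- The full contraction `tr (H P Y)`. -/
def trace₃ (H P Y : Matrix ι ι R) : R := (H * P * Y).trace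

/-- The second order bidifferential operator, up to the factor `-1/6`. -/
def c₂ (D : ι → R → R) (Γ : ι → ι → ι → R) (P : Matrix ι ι R) (f g : R) : R :=
  trace₃ (hess D Γ f) P (cov D Γ (ham D P g)) + trace₃ (hess D Γ g) P (cov D Γ (ham D P f))
    + (cov D Γ (ham D P f) * cov D Γ (ham D P g)).trace

/-- The contraction `P^{ls} S^j_{kl} T^k_{js}`. -/
def pairing (P : Matrix ι ι R) (S T : ι → ι → ι → R) : R :=
  ∑ l, ∑ s, ∑ j, ∑ k, P l s * S j k l * T k j s

/-- The third order bidifferential operator, up to the factor `-1/6`. -/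
def c₃ (D : ι → R → R) (Γ : ι → ι → ι → R) (P : Matrix ι ι R) (f g : R) : R :=
  pairing P (lieGamma D Γ (ham D P f)) (lieGamma D Γ (ham D P g))

theorem bracket_eq_dir (D : ι → R → R) (P : Matrix ι ι R) (f g : R) :
    bracket D P f g = dir D (ham D P f) g := by
  simp only [bracket, dir, ham, Finset.sum_mul]
  exact Finset.sum_comm

end Expressions

/-! ### Compatibility with ring homomorphisms -/

section Map

variable {ι R R' : Type*} [Fintype ι] [CommRing R] [CommRing R'] {D : ι → R → R}
  {D' : ι → R' → R'} (π : R →+* R')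

/-- The expressions are polynomial in the components and their derivatives, so they commute with
every ring homomorphism intertwining the operators. Here `D` is an arbitrary family of maps: on
functions which need not be differentiable, partial differentiation obeys no Leibniz rule. -/
theorem map_bracket (h : ∀ i a, π (D i a) = D' i (π a)) (P : Matrix ι ι R) (f g : R) :
    π (bracket D P f g) = bracket D' (P.map π) (π f) (π g) := by
  simp [bracket, h]

theorem map_ham (h : ∀ i a, π (D i a) = D' i (π a)) (P : Matrix ι ι R) (f : R) (k : ι) :
    π (ham D P f k) = ham D' (P.map π) (π f) k := by
  simp [ham, h]

theorem map_dir (h : ∀ i a, π (D i a) = D' i (π a)) (X : ι → R) (f : R) :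
    π (dir D X f) = dir D' (fun k => π (X k)) (π f) := by
  simp [dir, h]

theorem map_hess (h : ∀ i a, π (D i a) = D' i (π a)) (Γ : ι → ι → ι → R) (f : R) :
    (hess D Γ f).map π = hess D' (fun i k l => π (Γ i k l)) (π f) := by
  ext; simp [hess, h]

theorem map_cov (h : ∀ i a, π (D i a) = D' i (π a)) (Γ : ι → ι → ι → R) (X : ι → R) :
    (cov D Γ X).map π = cov D' (fun i k l => π (Γ i k l)) (fun k => π (X k)) := by
  ext; simp [cov, h]

theorem map_lieGamma (h : ∀ i a, π (D i a) = D' i (π a)) (Γ : ι → ι → ι → R) (X : ι → R)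
    (j k l : ι) :
    π (lieGamma D Γ X j k l)
      = lieGamma D' (fun i k l => π (Γ i k l)) (fun k => π (X k)) j k l := by
  simp [lieGamma, h]

theorem map_pairing (P : Matrix ι ι R) (S T : ι → ι → ι → R) :
    π (pairing P S T)
      = pairing (P.map π) (fun j k l => π (S j k l)) (fun j k l => π (T j k l)) := by
  simp [pairing]

theorem map_trace (A : Matrix ι ι R) : π A.trace = (A.map π).trace := by
  simp [Matrix.trace]

theorem map_trace₃ (A B C : Matrix ι ι R) :
    π (trace₃ A B C) = trace₃ (A.map π) (B.map π) (C.map π) := by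
  rw [trace₃, map_trace, Matrix.map_mul, Matrix.map_mul, trace₃]

theorem map_c₂ (h : ∀ i a, π (D i a) = D' i (π a)) (Γ : ι → ι → ι → R) (P : Matrix ι ι R)
    (f g : R) :
    π (c₂ D Γ P f g) = c₂ D' (fun i k l => π (Γ i k l)) (P.map π) (π f) (π g) := by
  simp only [c₂, map_add, map_trace₃, map_trace, Matrix.map_mul, map_hess π h, map_cov π h,
    map_ham π h]

theorem map_c₃ (h : ∀ i a, π (D i a) = D' i (π a)) (Γ : ι → ι → ι → R) (P : Matrix ι ι R)
    (f g : R) :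
    π (c₃ D Γ P f g) = c₃ D' (fun i k l => π (Γ i k l)) (P.map π) (π f) (π g) := by
  simp only [c₃, map_pairing, map_lieGamma π h, map_ham π h]

end Map

/-! ### Changes of coordinates -/

section Change

variable {ι R R' R'' : Type*} [Fintype ι] [DecidableEq ι] [CommRing R] [CommRing R']
  [CommRing R'']

/-- The pull-back `θ` along a change of coordinates with Jacobian matrix `J`. -/
structure CoordChange (D : ι → Derivation ℤ R R) (D' : ι → Derivation ℤ R' R') (θ : R →+* R')
    (J : Matrix ι ι R') : Prop where
  chain : ∀ i a, D' i (θ a) = ∑ m, J i m * θ (D m a)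
  symm : ∀ i k a, D' i (J k a) = D' k (J i a)
  isUnit : IsUnit J

/-- The transformation law of bivectors. -/
def BivectorRel (θ : R →+* R') (J : Matrix ι ι R') (P : Matrix ι ι R) (P' : Matrix ι ι R') : Prop :=
  ∀ a b, ∑ i, ∑ j, P' i j * J i a * J j b = θ (P a b)

/-- The transformation law of vectors. -/
def VectorRel (θ : R →+* R') (J : Matrix ι ι R') (X : ι → R) (X' : ι → R') : Prop :=
  ∀ a, ∑ i, X' i * J i a = θ (X a)

/-- The transformation law of Christoffel symbols. -/
def ChristoffelRel (D' : ι → Derivation ℤ R' R') (θ : R →+* R') (J : Matrix ι ι R')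
    (Γ : ι → ι → ι → R) (Γ' : ι → ι → ι → R') : Prop :=
  ∀ c k l, ∑ m, J m c * Γ' m k l = ∑ a, ∑ b, J k a * J l b * θ (Γ c a b) + D' k (J l c)

/-- The transformation law of tensors with one upper and two lower indices. -/
def TensorRel (θ : R →+* R') (J : Matrix ι ι R') (T : ι → ι → ι → R) (T' : ι → ι → ι → R') :
    Prop :=
  ∀ c k l, ∑ m, J m c * T' m k l = ∑ a, ∑ b, J k a * J l b * θ (T c a b)

variable {D : ι → Derivation ℤ R R} {D' : ι → Derivation ℤ R' R'} {D'' : ι → Derivation ℤ R'' R''}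
  {θ : R →+* R'} {J : Matrix ι ι R'} {θ' : R' →+* R''} {J' : Matrix ι ι R''}
  {P : Matrix ι ι R} {P' : Matrix ι ι R'} {X : ι → R} {X' : ι → R'}
  {Γ T S : ι → ι → ι → R} {Γ' T' S' : ι → ι → ι → R'} {Γ'' : ι → ι → ι → R''}

omit [DecidableEq ι] in
theorem bivectorRel_iff : BivectorRel θ J P P' ↔ Jᵀ * P' * J = P.map θ := by
  rw [← Matrix.ext_iff]
  refine forall₂_congr fun a b => ?_
  simp only [Matrix.mul_apply, Matrix.transpose_apply, Matrix.map_apply, Finset.sum_mul]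
  rw [Finset.sum_comm]
  refine Eq.congr_left (Finset.sum_congr rfl fun i _ => Finset.sum_congr rfl fun j _ => ?_)
  ring

/-- Identifies a transformed bivector from the equation `Jᵀ P' J = θ P` alone, so that no formula
for the inverse Jacobian is ever needed. Push-forwards along the flow are treated in this way. -/
theorem BivectorRel.unique (hJ : IsUnit J) {P₁ : Matrix ι ι R'} (h : BivectorRel θ J P P')
    (h₁ : BivectorRel θ J P P₁) : P' = P₁ := by
  rw [bivectorRel_iff] at h h₁
  have hT : IsUnit Jᵀ := (Matrix.isUnit_transpose J).2 hJ
  exact hT.mul_left_cancel (hJ.mul_right_cancel (h.trans h₁.symm))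

theorem sum_mul_left_cancel (hJ : IsUnit J) {u v : ι → R'}
    (h : ∀ c, ∑ m, J m c * u m = ∑ m, J m c * v m) : u = v := by
  obtain ⟨K, hK⟩ := hJ.exists_right_inv
  have e : u ᵥ* J = v ᵥ* J := by
    ext c
    simpa [Matrix.vecMul, dotProduct, mul_comm] using h c
  have := congrArg (fun w => w ᵥ* K) e
  simpa [Matrix.vecMul_vecMul, hK] using this

namespace CoordChange

variable (h : CoordChange D D' θ J)
include h

theorem ham_rel (hP : BivectorRel θ J P P') (f : R) :
    VectorRel θ J (ham (fun i => D i) P f) (ham (fun i => D' i) P' (θ f)) := by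
  intro a
  simp only [ham, map_sum, map_mul, ← hP _ a, h.chain, Finset.sum_mul, Finset.mul_sum]
  rw [Finset.sum_comm]
  calc _ = ∑ i, ∑ b, ∑ k, P' i k * (J i b * θ (D b f)) * J k a :=
        Finset.sum_congr rfl fun i _ => Finset.sum_comm
    _ = ∑ b, ∑ i, ∑ k, P' i k * (J i b * θ (D b f)) * J k a := Finset.sum_comm
    _ = _ := by
        refine Finset.sum_congr rfl fun b _ => Finset.sum_congr rfl fun i _ =>
          Finset.sum_congr rfl fun k _ => ?_
        ring

theorem dir_eq (hX : VectorRel θ J X X') (f : R) :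
    dir (fun i => D' i) X' (θ f) = θ (dir (fun i => D i) X f) := by
  simp only [dir, map_sum, map_mul, ← hX _, h.chain, Finset.sum_mul, Finset.mul_sum]
  rw [Finset.sum_comm]
  refine Finset.sum_congr rfl fun b _ => Finset.sum_congr rfl fun i _ => ?_
  ring

theorem bracket_eq (hP : BivectorRel θ J P P') (f g : R) :
    bracket (fun i => D' i) P' (θ f) (θ g) = θ (bracket (fun i => D i) P f g) := by
  rw [bracket_eq_dir, bracket_eq_dir, h.dir_eq (h.ham_rel hP f)]

/-- The inhomogeneous term `D' k (J l c)` of the Christoffel law is what the Leibniz rule produces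
when the chain rule for `D' l (θ f)` is differentiated once more; the two cancel. -/
theorem hess_eq (hΓ : ChristoffelRel D' θ J Γ Γ') (f : R) :
    hess (fun i => D' i) Γ' (θ f) = J * (hess (fun i => D i) Γ f).map θ * Jᵀ := by
  ext k l
  have e₁ : ∑ m, Γ' m k l * D' m (θ f)
      = ∑ c, (∑ a, ∑ b, J k a * J l b * θ (Γ c a b) + D' k (J l c)) * θ (D c f) := by
    simp only [h.chain, ← hΓ _ k l, Finset.mul_sum, Finset.sum_mul]
    rw [Finset.sum_comm]
    refine Finset.sum_congr rfl fun b _ => Finset.sum_congr rfl fun i _ => ?_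
    ring
  have e₂ : D' k (D' l (θ f))
      = ∑ b, (J l b * ∑ a, J k a * θ (D a (D b f)) + θ (D b f) * D' k (J l b)) := by
    simp [h.chain l, Derivation.leibniz, h.chain k]
  have e₃ : (J * (hess (fun i => D i) Γ f).map θ * Jᵀ) k l
      = ∑ b, ∑ a, J k a * J l b * θ (D a (D b f))
        - ∑ b, ∑ a, J k a * J l b * ∑ c, θ (Γ c a b) * θ (D c f) := by
    simp only [Matrix.mul_apply, Matrix.transpose_apply, Matrix.map_apply, hess, Matrix.of_apply,
      map_sub, map_sum, map_mul, Finset.sum_mul, ← Finset.sum_sub_distrib]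
    refine Finset.sum_congr rfl fun b _ => Finset.sum_congr rfl fun i _ => ?_
    ring
  have e₄ : ∑ b, ∑ a, J k a * J l b * ∑ c, θ (Γ c a b) * θ (D c f)
      = ∑ c, (∑ a, ∑ b, J k a * J l b * θ (Γ c a b)) * θ (D c f) := by
    simp only [Finset.mul_sum, Finset.sum_mul]
    rw [Finset.sum_comm]
    calc _ = ∑ a, ∑ c, ∑ b, J k a * J l b * (θ (Γ c a b) * θ (D c f)) :=
          Finset.sum_congr rfl fun a _ => Finset.sum_comm
      _ = ∑ c, ∑ a, ∑ b, J k a * J l b * (θ (Γ c a b) * θ (D c f)) := Finset.sum_comm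
      _ = _ := by simp only [mul_assoc]
  rw [e₃, e₄]
  simp only [hess, Matrix.of_apply]
  rw [e₁, e₂]
  simp only [add_mul, Finset.sum_add_distrib, Finset.mul_sum]
  simp only [mul_comm (θ (D _ f)) (D' k _)]
  have e₅ : ∑ b, ∑ a, J l b * (J k a * θ (D a (D b f)))
      = ∑ b, ∑ a, J k a * J l b * θ (D a (D b f)) :=
    Finset.sum_congr rfl fun b _ => Finset.sum_congr rfl fun i _ => by ring
  rw [e₅]
  ring

/-- Differentiating the vector law leaves the terms `X' m * D' j (J m c)`, which the inhomogeneous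
part of the Christoffel law absorbs. The result says that `∇X` changes by conjugation, so traces of
products are invariant. -/
theorem cov_eq (hΓ : ChristoffelRel D' θ J Γ Γ') (hX : VectorRel θ J X X') :
    cov (fun i => D' i) Γ' X' * J = J * (cov (fun i => D i) Γ X).map θ := by
  ext j c
  have e₁ := congrArg (D' j) (hX c)
  rw [h.chain, map_sum] at e₁
  simp only [Derivation.leibniz, smul_eq_mul, Finset.sum_add_distrib] at e₁
  have e₂ : ∑ k, (∑ m, Γ' k j m * X' m) * J k c
      = ∑ m, X' m * (∑ a, ∑ b, J j a * J m b * θ (Γ c a b) + D' j (J m c)) := by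
    simp only [← hΓ c j _, Finset.mul_sum, Finset.sum_mul]
    rw [Finset.sum_comm]
    refine Finset.sum_congr rfl fun b _ => Finset.sum_congr rfl fun i _ => ?_
    ring
  have e₃ : ∑ m, X' m * ∑ a, ∑ b, J j a * J m b * θ (Γ c a b)
      = ∑ a, J j a * ∑ b, θ (Γ c a b) * θ (X b) := by
    simp only [← hX _, Finset.mul_sum]
    rw [Finset.sum_comm]
    refine Finset.sum_congr rfl fun a _ => ?_
    rw [Finset.sum_comm]
    refine Finset.sum_congr rfl fun b _ => Finset.sum_congr rfl fun i _ => ?_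
    ring
  simp only [Matrix.mul_apply, cov, Matrix.of_apply, Matrix.map_apply, map_add, map_sum, map_mul,
    add_mul, mul_add, Finset.sum_add_distrib]
  rw [e₂, ← e₁]
  simp only [mul_add, Finset.sum_add_distrib]
  rw [e₃]
  simp only [mul_comm (J _ c)]
  ring

end CoordChange

theorem trace₃_eq (hJ : IsUnit J) {H P Y : Matrix ι ι R} {H' P' Y' : Matrix ι ι R'}
    (hH : H' = J * H.map θ * Jᵀ) (hP : BivectorRel θ J P P') (hY : Y' * J = J * Y.map θ) :
    trace₃ H' P' Y' = θ (trace₃ H P Y) := by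
  rw [bivectorRel_iff] at hP
  obtain ⟨K, hK⟩ := hJ.exists_right_inv
  rw [map_trace₃, trace₃, trace₃, ← hP, hH]
  have : Y' = J * Y.map θ * K := by rw [← hY, mul_assoc, hK, mul_one]
  calc (J * H.map θ * Jᵀ * P' * Y').trace = (J * (H.map θ * Jᵀ * P' * Y')).trace := by
        simp only [mul_assoc]
    _ = (H.map θ * Jᵀ * P' * Y' * J).trace := Matrix.trace_mul_comm _ _
    _ = (H.map θ * Jᵀ * P' * (Y' * J)).trace := by simp only [mul_assoc]
    _ = _ := by rw [hY]; simp only [mul_assoc]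

theorem trace_mul_conj (hJ : IsUnit J) {Y Z Y' Z' : Matrix ι ι R'}
    (hY : Y' * J = J * Y) (hZ : Z' * J = J * Z) : (Y' * Z').trace = (Y * Z).trace := by
  obtain ⟨K, hK⟩ := hJ.exists_right_inv
  have hK' : K * J = 1 := mul_eq_one_comm.1 hK
  have e : Y' = J * Y * K := by rw [← hY, mul_assoc, hK, mul_one]
  have e' : Z' = J * Z * K := by rw [← hZ, mul_assoc, hK, mul_one]
  rw [e, e']
  calc (J * Y * K * (J * Z * K)).trace = (J * (Y * (K * J) * Z * K)).trace := by
        simp only [mul_assoc]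
    _ = (Y * Z * (K * J)).trace := by
        rw [Matrix.trace_mul_comm, hK']
        simp only [mul_assoc, hK', mul_one]
    _ = _ := by rw [hK', mul_one]

theorem trace_mul_eq (hJ : IsUnit J) {Y Z : Matrix ι ι R} {Y' Z' : Matrix ι ι R'}
    (hY : Y' * J = J * Y.map θ) (hZ : Z' * J = J * Z.map θ) :
    (Y' * Z').trace = θ (Y * Z).trace := by
  rw [map_trace, Matrix.map_mul, trace_mul_conj hJ hY hZ]

theorem CoordChange.c₂_eq (h : CoordChange D D' θ J) (hP : BivectorRel θ J P P')
    (hΓ : ChristoffelRel D' θ J Γ Γ') (f g : R) :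
    c₂ (fun i => D' i) Γ' P' (θ f) (θ g) = θ (c₂ (fun i => D i) Γ P f g) := by
  rw [c₂, c₂, map_add, map_add,
    trace₃_eq h.isUnit (h.hess_eq hΓ f) hP (h.cov_eq hΓ (h.ham_rel hP g)),
    trace₃_eq h.isUnit (h.hess_eq hΓ g) hP (h.cov_eq hΓ (h.ham_rel hP f)),
    trace_mul_eq h.isUnit (h.cov_eq hΓ (h.ham_rel hP f)) (h.cov_eq hΓ (h.ham_rel hP g))]

end Change

end Jet

/-! ### Composition of Christoffel laws, and invariance of the pairing. -/

namespace Jet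

open Matrix

section Comp

variable {ι R R' R'' : Type*} [Fintype ι] [DecidableEq ι] [CommRing R] [CommRing R']
  [CommRing R'']
  {D : ι → Derivation ℤ R R} {D' : ι → Derivation ℤ R' R'} {D'' : ι → Derivation ℤ R'' R''}
  {θ : R →+* R'} {J : Matrix ι ι R'} {θ' : R' →+* R''} {J' : Matrix ι ι R''}
  {P : Matrix ι ι R} {P' : Matrix ι ι R'}
  {Γ T S : ι → ι → ι → R} {Γ' T' S' : ι → ι → ι → R'} {Γ'' : ι → ι → ι → R''}

/-- The Christoffel law is a cocycle: by Leibniz and the chain rule, the inhomogeneous term of the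
product Jacobian is that of `J'` plus the transport of that of `J`. The law for the composite is the
law for the second change contracted with the invertible matrix `J.map θ'`, hence an equivalence.
Both directions serve in `CoordChange.tensorRel_lieGamma`. -/
theorem CoordChange.christoffelRel_comp (h' : CoordChange D' D'' θ' J') (hJ : IsUnit J)
    (hΓ : ChristoffelRel D' θ J Γ Γ') :
    ChristoffelRel D'' (θ'.comp θ) (J' * J.map θ') Γ Γ'' ↔ ChristoffelRel D'' θ' J' Γ' Γ'' := by
  have hl (c k l) : ∑ m, (J' * J.map θ') m c * Γ'' m k l
      = ∑ n, (J.map θ')ᵀ c n * ∑ m, J' m n * Γ'' m k l := by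
    simp only [Matrix.mul_apply, Finset.sum_mul, Finset.mul_sum, Matrix.transpose_apply]
    rw [Finset.sum_comm]
    exact Finset.sum_congr rfl fun n _ => Finset.sum_congr rfl fun m _ => by ring
  have hr (c k l) : ∑ a, ∑ b, (J' * J.map θ') k a * (J' * J.map θ') l b * (θ'.comp θ) (Γ c a b)
        + D'' k ((J' * J.map θ') l c)
      = ∑ n, (J.map θ')ᵀ c n
        * (∑ a, ∑ b, J' k a * J' l b * θ' (Γ' n a b) + D'' k (J' l n)) := by
    have e₁ : ∑ n, (J.map θ')ᵀ c n * (∑ a, ∑ b, J' k a * J' l b * θ' (Γ' n a b))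
        = ∑ a, ∑ b, J' k a * J' l b
          * θ' (∑ a', ∑ b', J a a' * J b b' * θ (Γ c a' b') + D' a (J b c)) := by
      simp only [← hΓ c _ _, map_sum, map_mul, Finset.mul_sum, Matrix.transpose_apply,
        Matrix.map_apply]
      rw [Finset.sum_comm]
      refine Finset.sum_congr rfl fun a _ => ?_
      rw [Finset.sum_comm]
      exact Finset.sum_congr rfl fun b _ => Finset.sum_congr rfl fun n _ => by ring
    have e₂ : D'' k ((J' * J.map θ') l c)
        = ∑ n, (J.map θ')ᵀ c n * D'' k (J' l n)
          + ∑ a, ∑ b, J' k a * J' l b * θ' (D' a (J b c)) := by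
      simp only [Matrix.mul_apply, map_sum, Derivation.leibniz, Matrix.map_apply, h'.chain,
        smul_eq_mul, Matrix.transpose_apply, Finset.sum_add_distrib, Finset.mul_sum]
      rw [add_comm, Finset.sum_comm]
      congr 1
      exact Finset.sum_congr rfl fun n _ => Finset.sum_congr rfl fun m _ => by ring
    have e₃ : ∑ a, ∑ b, (J' * J.map θ') k a * (J' * J.map θ') l b * (θ'.comp θ) (Γ c a b)
        = ∑ a, ∑ b, J' k a * J' l b * θ' (∑ a', ∑ b', J a a' * J b b' * θ (Γ c a' b')) := by
      have := fun a b => Finset.sum_mul_sum Finset.univ Finset.univ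
        (fun n => J' k n * θ' (J n a)) (fun p => J' l p * θ' (J p b))
      simp only [Matrix.mul_apply, Matrix.map_apply, this, map_sum, map_mul, RingHom.comp_apply,
        Finset.mul_sum, Finset.sum_mul]
      rw [Fintype.sum_prod_type' (f := fun a b => ∑ n, ∑ p,
        J' k n * θ' (J n a) * (J' l p * θ' (J p b)) * θ' (θ (Γ c a b))) |>.symm,
        Fintype.sum_prod_type' (f := fun n p => ∑ a, ∑ b,
        J' k n * J' l p * (θ' (J n a) * θ' (J p b) * θ' (θ (Γ c a b)))) |>.symm]
      have q : ∀ x : ι × ι, ∑ n, ∑ p,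
          J' k n * θ' (J n x.1) * (J' l p * θ' (J p x.2)) * θ' (θ (Γ c x.1 x.2))
          = ∑ y : ι × ι, J' k y.1 * J' l y.2
            * (θ' (J y.1 x.1) * θ' (J y.2 x.2) * θ' (θ (Γ c x.1 x.2))) := fun x => by
        rw [Fintype.sum_prod_type]
        exact Finset.sum_congr rfl fun n _ => Finset.sum_congr rfl fun m _ => by ring
      simp only [q]
      rw [Finset.sum_comm]
      exact Finset.sum_congr rfl fun y _ => Fintype.sum_prod_type _
    simp only [mul_add, Finset.sum_add_distrib, map_add] at e₁ e₂ e₃ ⊢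
    rw [e₁, e₂, e₃]
    ring
  have hK : IsUnit (J.map θ') := by
    simpa using hJ.map (θ'.mapMatrix (m := ι))
  refine ⟨fun H c k l => ?_, fun H c k l => ?_⟩
  · have := sum_mul_left_cancel (J := J.map θ') hK
      (u := fun n => ∑ m, J' m n * Γ'' m k l)
      (v := fun n => ∑ a, ∑ b, J' k a * J' l b * θ' (Γ' n a b) + D'' k (J' l n))
      fun c => (hl c k l).symm.trans ((H c k l).trans (hr c k l))
    exact congrFun this c
  · rw [hl, hr]
    exact Finset.sum_congr rfl fun n _ => by rw [H]

/-- The matrix of the endomorphism `v ↦ S(v, ∂_l)`. -/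
def slice {ι A : Type*} (S : ι → ι → ι → A) (l : ι) : Matrix ι ι A := .of fun k j => S j k l

-- Contracting `j` and `k` is the trace of a product of endomorphisms. Invariance thus splits into
-- invariance of the trace under conjugation and the bivector law in the indices `l`, `s`.
omit [DecidableEq ι] in
theorem pairing_eq_trace (P : Matrix ι ι R) (S T : ι → ι → ι → R) :
    pairing P S T = ∑ l, ∑ s, P l s * (slice S l * slice T s).trace := by
  simp only [pairing, Matrix.trace, Matrix.mul_apply, Matrix.diag, slice, Matrix.of_apply,
    Finset.mul_sum]
  refine Finset.sum_congr rfl fun l _ => Finset.sum_congr rfl fun s _ => ?_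
  rw [Finset.sum_comm]
  simp only [mul_assoc]

omit [DecidableEq ι] in
theorem TensorRel.slice_mul (hS : TensorRel θ J S S') (l : ι) :
    slice S' l * J = J * ∑ b, J l b • (slice S b).map θ := by
  ext k c
  have := hS c k l
  simp only [Matrix.mul_apply, slice, Matrix.of_apply, Matrix.sum_apply, Matrix.smul_apply,
    Matrix.map_apply, smul_eq_mul, Finset.mul_sum]
  rw [← Finset.sum_congr rfl fun m _ => mul_comm (J m c) (S' m k l), this]
  simp only [mul_assoc]

theorem pairing_eq (hJ : IsUnit J) (hP : BivectorRel θ J P P') (hS : TensorRel θ J S S')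
    (hT : TensorRel θ J T T') : pairing P' S' T' = θ (pairing P S T) := by
  rw [pairing_eq_trace, pairing_eq_trace]
  have e (l s) : (slice S' l * slice T' s).trace
      = ∑ b, ∑ d, J l b * J s d * θ (slice S b * slice T d).trace := by
    rw [trace_mul_conj hJ (hS.slice_mul l) (hT.slice_mul s)]
    simp only [Finset.sum_mul_sum, Matrix.trace_sum, Matrix.smul_mul, Matrix.mul_smul,
      Matrix.trace_smul, smul_eq_mul, map_trace, Matrix.map_mul]
    exact Finset.sum_congr rfl fun b _ => Finset.sum_congr rfl fun d _ => by ring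
  simp only [e, map_sum, map_mul, ← hP _ _, Finset.mul_sum, Finset.sum_mul]
  have q (F : ι → ι → ι → ι → R') : ∑ l, ∑ s, ∑ b, ∑ d, F l s b d
      = ∑ b, ∑ d, ∑ l, ∑ s, F l s b d := by
    calc _ = ∑ l, ∑ b, ∑ s, ∑ d, F l s b d := Finset.sum_congr rfl fun l _ => Finset.sum_comm
      _ = ∑ b, ∑ l, ∑ s, ∑ d, F l s b d := Finset.sum_comm
      _ = ∑ b, ∑ l, ∑ d, ∑ s, F l s b d :=
        Finset.sum_congr rfl fun b _ => Finset.sum_congr rfl fun l _ => Finset.sum_comm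
      _ = _ := Finset.sum_congr rfl fun b _ => Finset.sum_comm
  rw [q]
  exact Finset.sum_congr rfl fun b _ => Finset.sum_congr rfl fun d _ =>
    Finset.sum_congr rfl fun l _ => Finset.sum_congr rfl fun s _ => by ring

-- The trace form is symmetric, while exchanging `l` and `s` costs the sign of `P`.
omit [DecidableEq ι] in
theorem pairing_swap (hP : ∀ i j, P i j = - P j i) : pairing P S T = - pairing P T S := by
  rw [pairing_eq_trace, pairing_eq_trace, Finset.sum_comm, ← Finset.sum_neg_distrib]
  refine Finset.sum_congr rfl fun s _ => ?_
  rw [← Finset.sum_neg_distrib]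
  refine Finset.sum_congr rfl fun l _ => ?_
  rw [hP l s, Matrix.trace_mul_comm]
  ring

end Comp

end Jet

/-! ### Dual numbers as a device for first-order variations. -/

namespace Jet

open Matrix

/-- The dual numbers `a + ε b`, with `ε² = 0`. -/
@[ext]
structure Dual (R : Type*) where
  /-- The value of a dual number. -/
  fst : R
  /-- The infinitesimal part of a dual number. -/
  snd : R

namespace Dual

variable {R : Type*} [CommRing R]

instance : Zero (Dual R) := ⟨⟨0, 0⟩⟩
instance : One (Dual R) := ⟨⟨1, 0⟩⟩
instance : Add (Dual R) := ⟨fun z w => ⟨z.fst + w.fst, z.snd + w.snd⟩⟩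
instance : Neg (Dual R) := ⟨fun z => ⟨-z.fst, -z.snd⟩⟩
instance : Mul (Dual R) := ⟨fun z w => ⟨z.fst * w.fst, z.fst * w.snd + z.snd * w.fst⟩⟩

@[simp] theorem fst_zero : (0 : Dual R).fst = 0 := rfl
@[simp] theorem snd_zero : (0 : Dual R).snd = 0 := rfl
@[simp] theorem fst_one : (1 : Dual R).fst = 1 := rfl
@[simp] theorem snd_one : (1 : Dual R).snd = 0 := rfl
@[simp] theorem fst_add (z w : Dual R) : (z + w).fst = z.fst + w.fst := rfl
@[simp] theorem snd_add (z w : Dual R) : (z + w).snd = z.snd + w.snd := rfl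
@[simp] theorem fst_neg (z : Dual R) : (-z).fst = -z.fst := rfl
@[simp] theorem snd_neg (z : Dual R) : (-z).snd = -z.snd := rfl
@[simp] theorem fst_mul (z w : Dual R) : (z * w).fst = z.fst * w.fst := rfl
@[simp] theorem snd_mul (z w : Dual R) : (z * w).snd = z.fst * w.snd + z.snd * w.fst := rfl

instance : CommRing (Dual R) where
  add_assoc a b c := by ext <;> simp [add_assoc]
  zero_add a := by ext <;> simp
  add_zero a := by ext <;> simp
  add_comm a b := by ext <;> simp [add_comm]
  nsmul := nsmulRec
  zsmul := zsmulRec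
  left_distrib a b c := by ext <;> simp <;> ring
  right_distrib a b c := by ext <;> simp <;> ring
  zero_mul a := by ext <;> simp
  mul_zero a := by ext <;> simp
  mul_assoc a b c := by ext <;> simp <;> ring
  one_mul a := by ext <;> simp
  mul_one a := by ext <;> simp
  neg_add_cancel a := by ext <;> simp
  mul_comm a b := by ext <;> simp <;> ring

@[simp] theorem fst_sub (z w : Dual R) : (z - w).fst = z.fst - w.fst := by
  rw [sub_eq_add_neg, sub_eq_add_neg, fst_add, fst_neg]

@[simp] theorem snd_sub (z w : Dual R) : (z - w).snd = z.snd - w.snd := by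
  rw [sub_eq_add_neg, sub_eq_add_neg, snd_add, snd_neg]

@[simp] theorem fst_sum {ι : Type*} (s : Finset ι) (f : ι → Dual R) :
    (∑ i ∈ s, f i).fst = ∑ i ∈ s, (f i).fst :=
  map_sum (⟨⟨Dual.fst, rfl⟩, fun _ _ => rfl⟩ : Dual R →+ R) f s

@[simp] theorem snd_sum {ι : Type*} (s : Finset ι) (f : ι → Dual R) :
    (∑ i ∈ s, f i).snd = ∑ i ∈ s, (f i).snd :=
  map_sum (⟨⟨Dual.snd, rfl⟩, fun _ _ => rfl⟩ : Dual R →+ R) f s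

end Dual

section Dual

variable {ι R R' S : Type*} [Fintype ι] [DecidableEq ι] [CommRing R] [CommRing R'] [CommRing S]

/-- The dual number `a + ε b`. -/
abbrev dual (a b : R) : Dual R := ⟨a, b⟩

omit [CommRing R] in
theorem eq_dual_iff {z : Dual R} {a b : R} : z = dual a b ↔ z.fst = a ∧ z.snd = b := by
  rw [Dual.ext_iff]

/-- The ring homomorphism `a ↦ ρ a + ε δ a` of a `ρ`-derivation `δ`. -/
def toDual (ρ : S →+* R) (δ : S →+ R) (h : ∀ a b, δ (a * b) = ρ a * δ b + ρ b * δ a) :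
    S →+* Dual R where
  toFun a := dual (ρ a) (δ a)
  map_zero' := by ext <;> simp
  map_add' a b := by ext <;> simp
  map_mul' a b := by ext <;> simp [h, mul_comm]
  map_one' := by
    have : δ 1 = 0 := by simpa using h 1 1
    ext <;> simp [this]

@[simp] theorem toDual_apply (ρ : S →+* R) (δ : S →+ R)
    (h : ∀ a b, δ (a * b) = ρ a * δ b + ρ b * δ a) (a : S) :
    toDual ρ δ h a = dual (ρ a) (δ a) := rfl

/-- The extension of a derivation to the dual numbers. -/
def dualD (D : Derivation ℤ R R) : Derivation ℤ (Dual R) (Dual R) :=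
  Derivation.mk' (AddMonoidHom.toIntLinearMap
      { toFun := fun z => dual (D z.fst) (D z.snd)
        map_zero' := by ext <;> simp
        map_add' := fun a b => by ext <;> simp })
    fun a b => by ext <;> simp <;> ring

@[simp] theorem fst_dualD (D : Derivation ℤ R R) (z : Dual R) :
    (dualD D z).fst = D z.fst := rfl

@[simp] theorem snd_dualD (D : Derivation ℤ R R) (z : Dual R) :
    (dualD D z).snd = D z.snd := rfl

/-- The extension of a ring homomorphism to the dual numbers. -/
def dualMap (θ : R →+* R') : Dual R →+* Dual R' where
  toFun z := dual (θ z.fst) (θ z.snd)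
  map_zero' := by ext <;> simp
  map_add' a b := by ext <;> simp
  map_mul' a b := by ext <;> simp
  map_one' := by ext <;> simp

@[simp] theorem fst_dualMap (θ : R →+* R') (z : Dual R) :
    (dualMap θ z).fst = θ z.fst := rfl

@[simp] theorem snd_dualMap (θ : R →+* R') (z : Dual R) :
    (dualMap θ z).snd = θ z.snd := rfl

/-- The matrix `A + ε B`. -/
def dualMatrix (A B : Matrix ι ι R) : Matrix ι ι (Dual R) :=
  .of fun i j => dual (A i j) (B i j)

/-- The vector `X + ε Y`. -/
def dualVec (X Y : ι → R) (i : ι) : Dual R := dual (X i) (Y i)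

/-- The tensor `S + ε T`. -/
def dualTensor (S T : ι → ι → ι → R) (i k l : ι) : Dual R := dual (S i k l) (T i k l)

variable (D : ι → Derivation ℤ R R) (D' : ι → Derivation ℤ R' R')

omit [DecidableEq ι] in
theorem dualMatrix_mul (A B C E : Matrix ι ι R) :
    dualMatrix A B * dualMatrix C E = dualMatrix (A * C) (B * C + A * E) := by
  ext i j <;> simp [dualMatrix, Matrix.mul_apply, Finset.sum_add_distrib, add_comm]

omit [DecidableEq ι] in
theorem trace_dualMatrix (A B : Matrix ι ι R) :
    (dualMatrix A B).trace = dual A.trace B.trace := by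
  ext <;> simp [dualMatrix, Matrix.trace]

omit [DecidableEq ι] in
theorem trace₃_dual (A a B b C c : Matrix ι ι R) :
    trace₃ (dualMatrix A a) (dualMatrix B b) (dualMatrix C c)
      = dual (trace₃ A B C) (trace₃ a B C + trace₃ A b C + trace₃ A B c) := by
  simp only [trace₃, dualMatrix_mul, trace_dualMatrix, Matrix.add_mul, Matrix.trace_add]

omit [DecidableEq ι] in
theorem pairing_dual (P p : Matrix ι ι R) (S s T t : ι → ι → ι → R) :
    pairing (dualMatrix P p) (dualTensor S s) (dualTensor T t)
      = dual (pairing P S T) (pairing p S T + pairing P s T + pairing P S t) := by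
  ext <;> simp [pairing, dualMatrix, dualTensor, ← Finset.sum_add_distrib]
  refine Finset.sum_congr rfl fun l _ => Finset.sum_congr rfl fun s _ =>
    Finset.sum_congr rfl fun j _ => Finset.sum_congr rfl fun k _ => ?_
  ring

omit [DecidableEq ι] in
theorem ham_dual (P p : Matrix ι ι R) (f h : R) :
    ham (fun i => dualD (D i)) (dualMatrix P p) (dual f h)
      = dualVec (ham (fun i => D i) P f) (ham (fun i => D i) P h + ham (fun i => D i) p f) := by
  funext k
  ext <;> simp [ham, dualMatrix, dualVec, Finset.sum_add_distrib]

omit [DecidableEq ι] in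
theorem dir_dual (X Y : ι → R) (f h : R) :
    dir (fun i => dualD (D i)) (dualVec X Y) (dual f h)
      = dual (dir (fun i => D i) X f) (dir (fun i => D i) X h + dir (fun i => D i) Y f) := by
  ext <;> simp [dir, dualVec, Finset.sum_add_distrib]

/-- The change of the Hessian under a variation of the connection. -/
def contractUpper (D : ι → R → R) (T : ι → ι → ι → R) (f : R) : Matrix ι ι R :=
  .of fun k l => ∑ m, T m k l * D m f

/-- The change of the covariant derivative of a vector field under a variation of the
connection. -/
def contractLower (T : ι → ι → ι → R) (X : ι → R) : Matrix ι ι R :=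
  .of fun j k => ∑ m, T k j m * X m

omit [DecidableEq ι] in
theorem hess_dual (Γ T : ι → ι → ι → R) (f h : R) :
    hess (fun i => dualD (D i)) (dualTensor Γ T) (dual f h)
      = dualMatrix (hess (fun i => D i) Γ f)
        (hess (fun i => D i) Γ h - contractUpper (fun i => D i) T f) := by
  ext <;> simp [hess, dualMatrix, dualTensor, contractUpper, Finset.sum_add_distrib,
    sub_sub]

omit [DecidableEq ι] in
theorem cov_dual (Γ T : ι → ι → ι → R) (X Y : ι → R) :
    cov (fun i => dualD (D i)) (dualTensor Γ T) (dualVec X Y)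
      = dualMatrix (cov (fun i => D i) Γ X) (cov (fun i => D i) Γ Y + contractLower T X) := by
  ext <;> simp [cov, dualMatrix, dualTensor, dualVec, contractLower, Finset.sum_add_distrib,
    add_assoc]

omit [DecidableEq ι] in
theorem lieGamma_dual (Γ T : ι → ι → ι → R) (X Y : ι → R) :
    lieGamma (fun i => dualD (D i)) (dualTensor Γ T) (dualVec X Y)
      = dualTensor (lieGamma (fun i => D i) Γ X)
        (lieGamma (fun i => D i) Γ Y + lieTensor (fun i => D i) T X) := by
  funext j k l
  ext <;> simp [lieGamma, lieTensor, dualTensor, dualVec]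
  rw [add_assoc, ← Finset.sum_add_distrib]
  congr 1
  refine Finset.sum_congr rfl fun m _ => ?_
  ring

-- Evaluating a polynomial expression on dual numbers differentiates it. This is the total variation
-- of `c₂` when the connection, the bivector and the two functions move in the directions `T`, `p`,
-- `h`, `k`.
omit [DecidableEq ι] in
theorem c₂_dual (Γ T : ι → ι → ι → R) (P p : Matrix ι ι R) (f h g k : R) :
    (c₂ (fun i => dualD (D i)) (dualTensor Γ T) (dualMatrix P p) (dual f h) (dual g k)).snd
      = (trace₃ (hess (fun i => D i) Γ h - contractUpper (fun i => D i) T f) P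
            (cov (fun i => D i) Γ (ham (fun i => D i) P g))
          + trace₃ (hess (fun i => D i) Γ f) p (cov (fun i => D i) Γ (ham (fun i => D i) P g))
          + trace₃ (hess (fun i => D i) Γ f) P (cov (fun i => D i) Γ
            (ham (fun i => D i) P k + ham (fun i => D i) p g)
            + contractLower T (ham (fun i => D i) P g)))
        + (trace₃ (hess (fun i => D i) Γ k - contractUpper (fun i => D i) T g) P
            (cov (fun i => D i) Γ (ham (fun i => D i) P f))
          + trace₃ (hess (fun i => D i) Γ g) p (cov (fun i => D i) Γ (ham (fun i => D i) P f))
          + trace₃ (hess (fun i => D i) Γ g) P (cov (fun i => D i) Γ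
            (ham (fun i => D i) P h + ham (fun i => D i) p f)
            + contractLower T (ham (fun i => D i) P f)))
        + (((cov (fun i => D i) Γ (ham (fun i => D i) P h + ham (fun i => D i) p f)
            + contractLower T (ham (fun i => D i) P f))
            * cov (fun i => D i) Γ (ham (fun i => D i) P g)).trace
          + (cov (fun i => D i) Γ (ham (fun i => D i) P f)
            * (cov (fun i => D i) Γ (ham (fun i => D i) P k + ham (fun i => D i) p g)
            + contractLower T (ham (fun i => D i) P g))).trace) := by
  simp only [c₂, ham_dual, hess_dual, cov_dual, trace₃_dual, dualMatrix_mul, trace_dualMatrix,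
    Matrix.trace_add, Dual.snd_add]

omit [DecidableEq ι] in
theorem c₃_dual (Γ T : ι → ι → ι → R) (P p : Matrix ι ι R) (f h g k : R) :
    (c₃ (fun i => dualD (D i)) (dualTensor Γ T) (dualMatrix P p) (dual f h) (dual g k)).snd
      = pairing p (lieGamma (fun i => D i) Γ (ham (fun i => D i) P f))
          (lieGamma (fun i => D i) Γ (ham (fun i => D i) P g))
        + pairing P (lieGamma (fun i => D i) Γ (ham (fun i => D i) P h + ham (fun i => D i) p f)
            + lieTensor (fun i => D i) T (ham (fun i => D i) P f))
          (lieGamma (fun i => D i) Γ (ham (fun i => D i) P g))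
        + pairing P (lieGamma (fun i => D i) Γ (ham (fun i => D i) P f))
          (lieGamma (fun i => D i) Γ (ham (fun i => D i) P k + ham (fun i => D i) p g)
            + lieTensor (fun i => D i) T (ham (fun i => D i) P g)) := by
  simp only [c₃, ham_dual, lieGamma_dual, pairing_dual]

/-! ### Infinitesimal changes of coordinates -/

/-- The homomorphism `f ↦ f + ε X f`. -/
def expand (X : ι → R) : R →+* Dual R :=
  toDual (RingHom.id R) (∑ m, X m • (D m : R →+ R)) fun a b => by
    simp [Finset.mul_sum, ← Finset.sum_add_distrib]
    refine Finset.sum_congr rfl fun m _ => ?_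
    ring

omit [DecidableEq ι] in
@[simp] theorem expand_apply (X : ι → R) (f : R) :
    expand D X f = dual f (dir (fun i => D i) X f) := by
  simp [expand, dir]

/-- The Jacobian matrix `1 + ε DX`. -/
def jacobian (X : ι → R) : Matrix ι ι (Dual R) := dualMatrix 1 (.of fun i a => D i (X a))

theorem isUnit_jacobian (X : ι → R) : IsUnit (jacobian D X) := by
  refine IsUnit.of_mul_eq_one (dualMatrix 1 (- .of fun i a => D i (X a))) ?_
  rw [jacobian, dualMatrix_mul]
  ext i j <;> simp [dualMatrix, Matrix.one_apply] <;> split_ifs <;> simp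

variable {D}

/-- To first order in `ε` this is the flow of `X`. The chain rule amounts to `D_i (X f) = X (D_i f)
+ ∑ (D_i X^m) D_m f`, which is where the partial derivatives have to commute. -/
theorem coordChange_jacobian (hD : ∀ i j a, D i (D j a) = D j (D i a)) (X : ι → R) :
    CoordChange D (fun i => dualD (D i)) (expand D X) (jacobian D X) where
  chain i a := by
    ext
    · simp [jacobian, dualMatrix, Matrix.one_apply]
    · simp [jacobian, dualMatrix, Matrix.one_apply, dir, Finset.sum_add_distrib]
      simp [hD i, mul_comm]
  symm i k a := by
    ext
    · simp [jacobian, dualMatrix, Matrix.one_apply]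
      split_ifs <;> simp
    · simp [jacobian, dualMatrix, hD i]
  isUnit := isUnit_jacobian D X

variable (D)

/-- Lie derivatives are the `ε`-parts of the transformation laws for `1 + ε DX`. The equivalences
that follow allow any transformation law over the dual numbers to be read back as an identity
between Lie derivatives. -/
theorem bivectorRel_jacobian (P : Matrix ι ι R) (X : ι → R) :
    BivectorRel (expand D X) (jacobian D X) P (dualMatrix P (lieBivector (fun i => D i) P X)) := by
  intro a b
  ext
  · simp [jacobian, dualMatrix, Matrix.one_apply]
  · simp [jacobian, dualMatrix, Matrix.one_apply, lieBivector, dir, Finset.sum_add_distrib]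
    ring

theorem vectorRel_jacobian_iff {X Y Z : ι → R} :
    VectorRel (expand D X) (jacobian D X) Y (dualVec Y Z) ↔ Z = lie (fun i => D i) X Y := by
  rw [VectorRel, funext_iff]
  refine forall_congr' fun a => ?_
  rw [expand_apply, eq_dual_iff]
  simp [jacobian, dualMatrix, dualVec, Matrix.one_apply, lie, dir, Finset.sum_add_distrib]
  constructor <;> intro h <;> linear_combination h

/-- The `ε`-part of `J k a * J l b` for `J = 1 + ε DX`: one of the two lower indices is transported
by `DX`, the other is left alone. -/
theorem sum_sum_ite (k l : ι) (u v : ι → R) (F : ι → ι → R) :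
    ∑ x, ∑ y, ((if k = x then v y else 0) + if l = y then u x else 0) * F x y
      = ∑ y, v y * F k y + ∑ x, u x * F x l := by
  simp [add_mul, Finset.sum_add_distrib, ite_mul]

theorem christoffelRel_jacobian_iff {X : ι → R} {Γ T : ι → ι → ι → R} :
    ChristoffelRel (fun i => dualD (D i)) (expand D X) (jacobian D X) Γ (dualTensor Γ T)
      ↔ T = lieGamma (fun i => D i) Γ X := by
  simp only [ChristoffelRel, funext_iff]
  refine forall_congr' fun c => forall_congr' fun k => forall_congr' fun l => ?_
  rw [Dual.ext_iff]
  simp [jacobian, dualMatrix, dualTensor, Matrix.one_apply, lieGamma, dir, Finset.sum_add_distrib]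
  rw [sum_sum_ite k l (fun m => D k (X m)) (fun m => D l (X m)) (Γ c)]
  simp only [mul_comm (D _ (X _))]
  -- The inhomogeneous term is the derivative of `1 + ε DX`: its constant part vanishes, and its
  -- `ε`-part is the second derivative of `X` occurring in `L_X Γ`.
  have : D k (if l = c then 1 else 0) = 0 := by split_ifs <;> simp
  simp only [this, true_and]
  constructor <;> intro h <;> linear_combination h

theorem tensorRel_jacobian_iff {X : ι → R} {S T : ι → ι → ι → R} :
    TensorRel (expand D X) (jacobian D X) S (dualTensor S T)
      ↔ T = lieTensor (fun i => D i) S X := by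
  simp only [TensorRel, funext_iff]
  refine forall_congr' fun c => forall_congr' fun k => forall_congr' fun l => ?_
  rw [Dual.ext_iff]
  simp [jacobian, dualMatrix, dualTensor, Matrix.one_apply, lieTensor, dir, Finset.sum_add_distrib]
  rw [sum_sum_ite k l (fun m => D k (X m)) (fun m => D l (X m)) (S c)]
  simp only [mul_comm (D _ (X _))]
  constructor <;> intro h <;> linear_combination h

end Dual

end Jet

/-! ### Naturality of the Lie derivative of a connection. -/

namespace Jet

open Matrix

section Naturality

variable {ι R R' : Type*} [Fintype ι] [DecidableEq ι] [CommRing R] [CommRing R']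
  {D : ι → Derivation ℤ R R} {D' : ι → Derivation ℤ R' R'}
  {θ : R →+* R'} {J : Matrix ι ι R'} {P : Matrix ι ι R} {P' : Matrix ι ι R'}
  {X Y : ι → R} {X' : ι → R'} {Γ : ι → ι → ι → R} {Γ' : ι → ι → ι → R'}

theorem CoordChange.dual (h : CoordChange D D' θ J) :
    CoordChange (fun i => dualD (D i)) (fun i => dualD (D' i)) (dualMap θ) (dualMatrix J 0) where
  chain i a := by ext <;> simp [dualMatrix, h.chain]
  symm i k a := by
    ext
    · simp [dualMatrix, h.symm i]
    · simp [dualMatrix]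
  isUnit := by
    obtain ⟨K, hK⟩ := h.isUnit.exists_right_inv
    refine IsUnit.of_mul_eq_one (dualMatrix K 0) ?_
    rw [dualMatrix_mul, hK]
    ext i j <;> simp [dualMatrix, Matrix.one_apply] <;> split_ifs <;> simp

/-- Moving infinitesimally along `X'` after the change of coordinates is the same as changing
coordinates after moving along `X`. Both ways around this square carry `Γ` to `Γ' + ε L_{X'}Γ'`, so
the cocycle property gives the Christoffel law between `Γ + ε L_XΓ` and `Γ' + ε L_{X'}Γ'`. Its
Jacobian has no `ε`-part; therefore the inhomogeneous term disappears from the `ε`-part, and the law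
of a tensor is left. -/
theorem CoordChange.tensorRel_lieGamma (h : CoordChange D D' θ J)
    (hD' : ∀ i j a, D' i (D' j a) = D' j (D' i a))
    (hΓ : ChristoffelRel D' θ J Γ Γ') (hX : VectorRel θ J X X') :
    TensorRel θ J (lieGamma (fun i => D i) Γ X) (lieGamma (fun i => D' i) Γ' X') := by
  have h₁ := (christoffelRel_jacobian_iff D' (X := X') (Γ := Γ')).2 rfl
  have h₂ := (christoffelRel_jacobian_iff D (X := X) (Γ := Γ)).2 rfl
  rw [← (coordChange_jacobian hD' X').christoffelRel_comp h.isUnit hΓ] at h₁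
  have e : (expand D' X').comp θ = (dualMap θ).comp (expand D X) := by
    ext a <;> simp [dualMap, h.dir_eq hX]
  have eJ : jacobian D' X' * J.map (expand D' X')
      = dualMatrix J 0 * (jacobian D X).map (dualMap θ) := by
    have e₁ : J.map (expand D' X') = dualMatrix J (.of fun i a => dir (fun i => D' i) X' (J i a)) := by
      ext <;> simp [dualMatrix]
    have e₂ : (jacobian D X).map (dualMap θ) = dualMatrix 1 (.of fun i a => θ (D i (X a))) := by
      ext i j <;> simp [dualMatrix, jacobian, dualMap, Matrix.one_apply]
    rw [e₁, e₂, jacobian, dualMatrix_mul, dualMatrix_mul, zero_mul, zero_add, one_mul, one_mul,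
      mul_one]
    congr 1
    ext i a
    -- The `ε`-parts of the two Jacobians agree by the differentiated vector law; `symm` turns `D'
    -- i` acting on row `m` of `J` into `D' m` acting on row `i`, that is, into `X'` acting on `J`.
    have := congrArg (D' i) (hX a)
    rw [h.chain, map_sum] at this
    simp only [Derivation.leibniz, smul_eq_mul, Finset.sum_add_distrib, h.symm i] at this
    simp only [Matrix.add_apply, Matrix.mul_apply, Matrix.of_apply, dir]
    rw [← this, add_comm]
    simp only [mul_comm (J _ _)]
  rw [e, eJ, h.dual.christoffelRel_comp (isUnit_jacobian D X) h₂] at h₁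
  intro c k l
  simpa [dualMatrix, dualTensor] using congrArg Dual.snd (h₁ c k l)

theorem CoordChange.c₃_eq (h : CoordChange D D' θ J)
    (hD' : ∀ i j a, D' i (D' j a) = D' j (D' i a))
    (hP : BivectorRel θ J P P') (hΓ : ChristoffelRel D' θ J Γ Γ') (f g : R) :
    c₃ (fun i => D' i) Γ' P' (θ f) (θ g) = θ (c₃ (fun i => D i) Γ P f g) :=
  pairing_eq h.isUnit hP (h.tensorRel_lieGamma hD' hΓ (h.ham_rel hP f))
    (h.tensorRel_lieGamma hD' hΓ (h.ham_rel hP g))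

theorem CoordChange.pairing_lieGamma_eq (h : CoordChange D D' θ J)
    (hD' : ∀ i j a, D' i (D' j a) = D' j (D' i a))
    (hP : BivectorRel θ J P P') (hΓ : ChristoffelRel D' θ J Γ Γ') (hX : VectorRel θ J X X')
    (g : R) :
    pairing P' (lieGamma (fun i => D' i) Γ' X')
        (lieGamma (fun i => D' i) Γ' (ham (fun i => D' i) P' (θ g)))
      = θ (pairing P (lieGamma (fun i => D i) Γ X)
        (lieGamma (fun i => D i) Γ (ham (fun i => D i) P g))) :=
  pairing_eq h.isUnit hP (h.tensorRel_lieGamma hD' hΓ hX)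
    (h.tensorRel_lieGamma hD' hΓ (h.ham_rel hP g))

end Naturality

/-! ### The algebraic derivation identities of orders one, two and three. -/

section Derivation

variable {ι R : Type*} [Fintype ι] [DecidableEq ι] [CommRing R] {D : ι → Derivation ℤ R R}
  {P : Matrix ι ι R} {X Y : ι → R}
  {Γ S T S' T' : ι → ι → ι → R}

/-- The Lie derivative of a connection satisfies `L_{[X,Y]} = [L_X, L_Y]`. -/
theorem lieGamma_lie (hD : ∀ i j a, D i (D j a) = D j (D i a)) :
    lieGamma (fun i => D i) Γ (lie (fun i => D i) X Y)
        + lieTensor (fun i => D i) (lieGamma (fun i => D i) Γ X) Y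
      = lieTensor (fun i => D i) (lieGamma (fun i => D i) Γ Y) X := by
  -- Naturality of `L_YΓ` under `1 + ε DX`: there `Y` becomes `Y + ε [X, Y]` and `Γ` becomes `Γ + ε
  -- L_XΓ`, while the tensor law says that the `ε`-part of the result is `L_X (L_YΓ)`.
  have h := (coordChange_jacobian hD X).tensorRel_lieGamma
    (fun i j a => by ext <;> simp [hD i])
    ((christoffelRel_jacobian_iff D (Γ := Γ)).2 rfl) ((vectorRel_jacobian_iff D (Y := Y)).2 rfl)
  rw [lieGamma_dual, tensorRel_jacobian_iff] at h
  exact h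

omit [DecidableEq ι] in
theorem hess_zero : hess (fun i => D i) Γ 0 = 0 := by
  ext; simp [hess]

omit [DecidableEq ι] in
theorem ham_zero : ham (fun i => D i) P 0 = 0 := by
  ext; simp [ham]

omit [DecidableEq ι] in
theorem ham_add (f g : R) :
    ham (fun i => D i) P (f + g) = ham (fun i => D i) P f + ham (fun i => D i) P g := by
  ext; simp [ham, mul_add, Finset.sum_add_distrib]

omit [DecidableEq ι] in
theorem cov_add : cov (fun i => D i) Γ (X + Y) = cov (fun i => D i) Γ X + cov (fun i => D i) Γ Y := by
  ext; simp [cov, mul_add, Finset.sum_add_distrib]; ring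

omit [DecidableEq ι] in
theorem lieGamma_add : lieGamma (fun i => D i) Γ (X + Y)
    = lieGamma (fun i => D i) Γ X + lieGamma (fun i => D i) Γ Y := by
  funext j k l
  simp only [lieGamma, Pi.add_apply, map_add]
  rw [add_add_add_comm, ← Finset.sum_add_distrib]
  congr 1
  exact Finset.sum_congr rfl fun m _ => by ring

omit [DecidableEq ι] in
theorem trace₃_sub_left (A A' B C : Matrix ι ι R) :
    trace₃ (A - A') B C = trace₃ A B C - trace₃ A' B C := by
  simp [trace₃, sub_mul]

omit [DecidableEq ι] in
theorem trace₃_add_right (A B C C' : Matrix ι ι R) :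
    trace₃ A B (C + C') = trace₃ A B C + trace₃ A B C' := by
  simp [trace₃, mul_add]

omit [DecidableEq ι] in
theorem pairing_add_left : pairing P (S + S') T = pairing P S T + pairing P S' T := by
  simp [pairing, mul_add, add_mul, Finset.sum_add_distrib]

omit [DecidableEq ι] in
theorem pairing_add_right : pairing P S (T + T') = pairing P S T + pairing P S T' := by
  simp [pairing, mul_add, Finset.sum_add_distrib]

omit [DecidableEq ι] in
/-- The failure of `f ↦ L_{X_f} ∇` to be a derivation. -/
theorem lieGamma_ham_mul (hΓ : ∀ i k l, Γ i k l = Γ i l k) (f g : R) (j k l : ι) :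
    lieGamma (fun i => D i) Γ (ham (fun i => D i) P (f * g)) j k l
      = f * lieGamma (fun i => D i) Γ (ham (fun i => D i) P g) j k l
        + g * lieGamma (fun i => D i) Γ (ham (fun i => D i) P f) j k l
        + (hess (fun i => D i) Γ f k l * ham (fun i => D i) P g j
          + D k f * cov (fun i => D i) Γ (ham (fun i => D i) P g) l j
          + D l f * cov (fun i => D i) Γ (ham (fun i => D i) P g) k j)
        + (hess (fun i => D i) Γ g k l * ham (fun i => D i) P f j
          + D k g * cov (fun i => D i) Γ (ham (fun i => D i) P f) l j
          + D l g * cov (fun i => D i) Γ (ham (fun i => D i) P f) k j) := by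
  -- Leibniz formula for the second-order operator `X ↦ L_XΓ`. Symmetry of `Γ` is needed to
  -- recognise `X^m Γ^j_{ml}` as the Christoffel part of `∇_l X^j`.
  have e₁ (f : R) (X : ι → R) : lieGamma (fun i => D i) Γ (fun i => f * X i) j k l
      = f * lieGamma (fun i => D i) Γ X j k l + hess (fun i => D i) Γ f k l * X j
        + D k f * cov (fun i => D i) Γ X l j + D l f * cov (fun i => D i) Γ X k j := by
    simp only [lieGamma, hess, cov, Matrix.of_apply, Derivation.leibniz, smul_eq_mul, map_add, hΓ j l]
    simp only [mul_add, mul_sub, sub_mul, Finset.sum_add_distrib, Finset.sum_sub_distrib,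
      Finset.mul_sum, Finset.sum_mul]
    ring_nf
  have e₂ : ham (fun i => D i) P (f * g) = (fun i => f * ham (fun i => D i) P g i)
      + fun i => g * ham (fun i => D i) P f i := by
    funext k
    simp only [ham, Derivation.leibniz, smul_eq_mul, Finset.mul_sum, Pi.add_apply,
      ← Finset.sum_add_distrib]
    exact Finset.sum_congr rfl fun i _ => by ring
  rw [e₂, lieGamma_add, Pi.add_apply, Pi.add_apply, Pi.add_apply, e₁, e₁]
  ring

-- This and the next two contractions treat the three kinds of terms in `lieGamma_ham_mul`: Hessian
-- times Hamiltonian field, and differential times covariant derivative in the two possible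
-- positions. Each gives, up to sign, one of the terms by which `c₂` varies with the connection.
omit [DecidableEq ι] in
theorem pairing_hess (hP : ∀ i j, P i j = - P j i) (hT : ∀ i k l, T i k l = T i l k)
    (H : Matrix ι ι R) (V : ι → R) :
    pairing P T (fun k j s => H j s * V k) = - trace₃ H P (contractLower T V) := by
  simp only [pairing, trace₃, Matrix.trace, Matrix.mul_apply, Matrix.diag, contractLower,
    Matrix.of_apply, Finset.mul_sum, Finset.sum_mul, ← Finset.sum_neg_distrib]
  calc _ = ∑ l, ∑ j, ∑ s, ∑ k, P l s * T j k l * (H j s * V k) :=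
        Finset.sum_congr rfl fun l _ => Finset.sum_comm
    _ = ∑ j, ∑ l, ∑ s, ∑ k, P l s * T j k l * (H j s * V k) := Finset.sum_comm
    _ = ∑ j, ∑ l, ∑ k, ∑ s, P l s * T j k l * (H j s * V k) :=
        Finset.sum_congr rfl fun j _ => Finset.sum_congr rfl fun l _ => Finset.sum_comm
    _ = _ := Finset.sum_congr rfl fun j _ => Finset.sum_congr rfl fun l _ =>
        Finset.sum_congr rfl fun k _ => Finset.sum_congr rfl fun s _ => by
          rw [hP l s, hT j k l]; ring

omit [DecidableEq ι] in
theorem pairing_contractUpper (f : R) (Y : Matrix ι ι R) :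
    pairing P T (fun k j s => D j f * Y s k)
      = trace₃ (contractUpper (fun i => D i) T f) P Y := by
  simp only [pairing, trace₃, Matrix.trace, Matrix.mul_apply, Matrix.diag, contractUpper,
    Matrix.of_apply, Finset.sum_mul]
  calc _ = ∑ l, ∑ s, ∑ k, ∑ j, P l s * T j k l * (D j f * Y s k) :=
        Finset.sum_congr rfl fun l _ => Finset.sum_congr rfl fun s _ => Finset.sum_comm
    _ = ∑ l, ∑ k, ∑ s, ∑ j, P l s * T j k l * (D j f * Y s k) :=
        Finset.sum_congr rfl fun l _ => Finset.sum_comm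
    _ = ∑ k, ∑ l, ∑ s, ∑ j, P l s * T j k l * (D j f * Y s k) := Finset.sum_comm
    _ = ∑ k, ∑ s, ∑ l, ∑ j, P l s * T j k l * (D j f * Y s k) :=
        Finset.sum_congr rfl fun k _ => Finset.sum_comm
    _ = _ := Finset.sum_congr rfl fun j _ => Finset.sum_congr rfl fun l _ =>
        Finset.sum_congr rfl fun k _ => Finset.sum_congr rfl fun s _ => by ring

omit [DecidableEq ι] in
theorem pairing_ham (hP : ∀ i j, P i j = - P j i) (f : R) (Y : Matrix ι ι R) :
    pairing P T (fun k j s => D s f * Y j k)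
      = - (contractLower T (ham (fun i => D i) P f) * Y).trace := by
  simp only [pairing, Matrix.trace, Matrix.mul_apply, Matrix.diag, contractLower, ham,
    Matrix.of_apply, Finset.sum_mul, Finset.mul_sum, ← Finset.sum_neg_distrib]
  calc _ = ∑ l, ∑ j, ∑ k, ∑ s, P l s * T j k l * (D s f * Y j k) := by
        refine Finset.sum_congr rfl fun l _ => ?_
        rw [Finset.sum_comm]
        exact Finset.sum_congr rfl fun s _ => Finset.sum_comm
    _ = ∑ l, ∑ k, ∑ j, ∑ s, P l s * T j k l * (D s f * Y j k) :=
        Finset.sum_congr rfl fun l _ => Finset.sum_comm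
    _ = ∑ k, ∑ l, ∑ j, ∑ s, P l s * T j k l * (D s f * Y j k) := Finset.sum_comm
    _ = ∑ k, ∑ j, ∑ l, ∑ s, P l s * T j k l * (D s f * Y j k) :=
        Finset.sum_congr rfl fun k _ => Finset.sum_comm
    _ = _ := Finset.sum_congr rfl fun j _ => Finset.sum_congr rfl fun l _ =>
        Finset.sum_congr rfl fun k _ => Finset.sum_congr rfl fun s _ => by
          rw [hP k s]; ring

omit [DecidableEq ι] in
/-- The effect on `c₂` of a variation `T` of the connection. -/
theorem pairing_lieGamma_ham_mul (hP : ∀ i j, P i j = - P j i)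
    (hΓ : ∀ i k l, Γ i k l = Γ i l k) (hT : ∀ i k l, T i k l = T i l k) (f g : R) :
    pairing P T (lieGamma (fun i => D i) Γ (ham (fun i => D i) P (f * g)))
      = f * pairing P T (lieGamma (fun i => D i) Γ (ham (fun i => D i) P g))
        + g * pairing P T (lieGamma (fun i => D i) Γ (ham (fun i => D i) P f))
        + (trace₃ (contractUpper (fun i => D i) T f) P
            (cov (fun i => D i) Γ (ham (fun i => D i) P g))
          - trace₃ (hess (fun i => D i) Γ f) P (contractLower T (ham (fun i => D i) P g))
          - (contractLower T (ham (fun i => D i) P f)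
            * cov (fun i => D i) Γ (ham (fun i => D i) P g)).trace)
        + (trace₃ (contractUpper (fun i => D i) T g) P
            (cov (fun i => D i) Γ (ham (fun i => D i) P f))
          - trace₃ (hess (fun i => D i) Γ g) P (contractLower T (ham (fun i => D i) P f))
          - (contractLower T (ham (fun i => D i) P g)
            * cov (fun i => D i) Γ (ham (fun i => D i) P f)).trace) := by
  have key (Hf Hg Yf Yg : Matrix ι ι R) (Xf Xg : ι → R)
      (h : ∀ j k l, lieGamma (fun i => D i) Γ (ham (fun i => D i) P (f * g)) j k l
        = f * lieGamma (fun i => D i) Γ (ham (fun i => D i) P g) j k l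
          + g * lieGamma (fun i => D i) Γ (ham (fun i => D i) P f) j k l
          + (Hf k l * Xg j + D k f * Yg l j + D l f * Yg k j)
          + (Hg k l * Xf j + D k g * Yf l j + D l g * Yf k j)) :
      pairing P T (lieGamma (fun i => D i) Γ (ham (fun i => D i) P (f * g)))
        = f * pairing P T (lieGamma (fun i => D i) Γ (ham (fun i => D i) P g))
          + g * pairing P T (lieGamma (fun i => D i) Γ (ham (fun i => D i) P f))
          + (pairing P T (fun k j s => Hf j s * Xg k) + pairing P T (fun k j s => D j f * Yg s k)
            + pairing P T (fun k j s => D s f * Yg j k))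
          + (pairing P T (fun k j s => Hg j s * Xf k) + pairing P T (fun k j s => D j g * Yf s k)
            + pairing P T (fun k j s => D s g * Yf j k)) := by
    simp only [pairing, Finset.mul_sum, ← Finset.sum_add_distrib]
    refine Finset.sum_congr rfl fun l _ => Finset.sum_congr rfl fun s _ =>
      Finset.sum_congr rfl fun j _ => Finset.sum_congr rfl fun k _ => ?_
    rw [h]
    ring
  rw [key _ _ _ _ _ _ (lieGamma_ham_mul hΓ f g), pairing_hess hP hT, pairing_hess hP hT,
    pairing_contractUpper, pairing_contractUpper, pairing_ham hP, pairing_ham hP]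
  ring

omit [DecidableEq ι] in
theorem lieGamma_symm (hD : ∀ i j a, D i (D j a) = D j (D i a))
    (hΓ : ∀ i k l, Γ i k l = Γ i l k) (j k l : ι) :
    lieGamma (fun i => D i) Γ X j k l = lieGamma (fun i => D i) Γ X j l k := by
  simp only [lieGamma, hD k l, hΓ j k l, hΓ _ k l]
  congr 1
  refine Finset.sum_congr rfl fun m _ => ?_
  rw [hΓ j m l, hΓ j k m]
  ring

/-- The derivative of the bracket under a variation of the bivector by its Lie derivative. -/
theorem snd_bracket (hD : ∀ i j a, D i (D j a) = D j (D i a)) (f g : R) :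
    (bracket (fun i => dualD (D i)) (dualMatrix P (lieBivector (fun i => D i) P X))
        (dual f 0) (dual g 0)).snd
      = dir (fun i => D i) X (bracket (fun i => D i) P f g)
        - bracket (fun i => D i) P (dir (fun i => D i) X f) g
        - bracket (fun i => D i) P f (dir (fun i => D i) X g) := by
  -- The `ε`-part of naturality contains the variation of `P` together with those of `f` and `g`;
  -- the last two are subtracted.
  have h := (coordChange_jacobian hD X).bracket_eq (bivectorRel_jacobian D P X) f g
  have h := congrArg Dual.snd h
  simp only [expand_apply] at h
  rw [bracket_eq_dir, ham_dual, dir_dual] at h ⊢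
  rw [← h, bracket_eq_dir, bracket_eq_dir]
  simp only [ham_zero, zero_add]
  simp only [dir, Pi.add_apply, add_mul, Finset.sum_add_distrib, map_zero, mul_zero,
    Finset.sum_const_zero]
  ring

/-- The derivative of `c₂` under a variation of the bivector by its Lie derivative. -/
theorem snd_c₂ (hD : ∀ i j a, D i (D j a) = D j (D i a)) (hP : ∀ i j, P i j = - P j i)
    (hΓ : ∀ i k l, Γ i k l = Γ i l k) (f g : R) :
    (c₂ (fun i => dualD (D i)) (dualTensor Γ 0)
        (dualMatrix P (lieBivector (fun i => D i) P X)) (dual f 0) (dual g 0)).snd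
      = dir (fun i => D i) X (c₂ (fun i => D i) Γ P f g)
        + pairing P (lieGamma (fun i => D i) Γ X)
          (lieGamma (fun i => D i) Γ (ham (fun i => D i) P (f * g)))
        - (c₂ (fun i => D i) Γ P (dir (fun i => D i) X f) g
          + g * pairing P (lieGamma (fun i => D i) Γ X)
            (lieGamma (fun i => D i) Γ (ham (fun i => D i) P f)))
        - (c₂ (fun i => D i) Γ P f (dir (fun i => D i) X g)
          + f * pairing P (lieGamma (fun i => D i) Γ X)
            (lieGamma (fun i => D i) Γ (ham (fun i => D i) P g))) := by
  -- Under `1 + ε DX` the connection moves as well, by `L_XΓ`. Its contribution to the `ε`-part is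
  -- absent from the claim, and `pairing_lieGamma_ham_mul` trades it for the three pairings.
  have h := (coordChange_jacobian hD X).c₂_eq (bivectorRel_jacobian D P X)
    ((christoffelRel_jacobian_iff D (Γ := Γ)).2 rfl) f g
  have h := congrArg Dual.snd h
  simp only [expand_apply, c₂_dual] at h
  rw [c₂_dual, ← h, pairing_lieGamma_ham_mul hP hΓ (lieGamma_symm hD hΓ)]
  have e₁ : contractUpper (fun i => D i) (0 : ι → ι → ι → R) = 0 := by
    funext f; ext; simp [contractUpper]
  have e₂ : contractLower (0 : ι → ι → ι → R) = 0 := by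
    funext f; ext; simp [contractLower]
  simp only [e₁, e₂, Pi.zero_apply, sub_zero, add_zero, hess_zero, ham_zero, zero_add, cov_add,
    trace₃_add_right, trace₃_sub_left, add_mul, mul_add, Matrix.trace_add, c₂]
  have e₃ (B C : Matrix ι ι R) : trace₃ 0 B C = 0 := by simp [trace₃]
  -- The only discrepancy between the two sides which is not termwise: the order of the factors in
  -- the last trace.
  have e₄ := Matrix.trace_mul_comm
    (contractLower (lieGamma (fun i => D i) Γ X) (ham (fun i => D i) P g))
    (cov (fun i => D i) Γ (ham (fun i => D i) P f))
  simp only [e₃]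
  linear_combination e₄

omit [DecidableEq ι] in
/-- The Jacobi identity says that Hamiltonian vector fields preserve the bivector. -/
theorem lieBivector_ham (hD : ∀ i j a, D i (D j a) = D j (D i a)) (hP : ∀ i j, P i j = - P j i)
    (hJ : ∀ i j k, ∑ l, (P i l * D l (P j k) + P j l * D l (P k i) + P k l * D l (P i j)) = 0)
    (f : R) : lieBivector (fun i => D i) P (ham (fun i => D i) P f) = 0 := by
  ext i j
  -- Separates the Jacobi expression contracted with `df` from the terms with second derivatives of
  -- `f`. The latter are antisymmetric in `m` and `a`, so they cancel when summed.
  have e (m : ι) : (∑ a, P a m * D a f) * D m (P i j)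
        - P m j * D m (∑ a, P a i * D a f) - P i m * D m (∑ a, P a j * D a f)
      = ∑ a, D a f * (P a m * D m (P i j) + P i m * D m (P j a) + P j m * D m (P a i))
        - ∑ a, (P m j * P a i * D m (D a f) - P a j * P m i * D a (D m f)) := by
    simp only [map_sum, Derivation.leibniz, smul_eq_mul, Finset.mul_sum, Finset.sum_mul,
      ← Finset.sum_sub_distrib]
    refine Finset.sum_congr rfl fun a _ => ?_
    rw [hP i m, hP j m, hP j a, map_neg, hD a m]
    ring
  refine (Finset.sum_congr rfl fun m _ => e m).trans ?_
  rw [Finset.sum_sub_distrib, Finset.sum_comm]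
  simp only [← Finset.mul_sum, hJ, mul_zero, Finset.sum_const_zero, Finset.sum_sub_distrib]
  rw [zero_sub, Matrix.zero_apply, neg_eq_zero, sub_eq_zero]
  exact Finset.sum_comm

/-- The `ε`-part of the naturality of `ham` under `1 + ε DX` reads `[X, X_f] = X_{Xf} + (L_X
P)(df)`; the last term vanishes by assumption. -/
theorem lie_ham (hD : ∀ i j a, D i (D j a) = D j (D i a))
    (hX : lieBivector (fun i => D i) P X = 0) (f : R) :
    lie (fun i => D i) X (ham (fun i => D i) P f)
      = ham (fun i => D i) P (dir (fun i => D i) X f) := by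
  have h := (coordChange_jacobian hD X).ham_rel (bivectorRel_jacobian D P X) f
  rw [hX, expand_apply, ham_dual, vectorRel_jacobian_iff] at h
  rw [← h]
  ext
  simp [ham]

/-- The `ε`-part of the invariance of the pairing is a Leibniz rule with three terms; the one
containing `L_X P` drops out. -/
theorem dir_pairing (hX : lieBivector (fun i => D i) P X = 0) :
    dir (fun i => D i) X (pairing P S T)
      = pairing P (lieTensor (fun i => D i) S X) T + pairing P S (lieTensor (fun i => D i) T X) := by
  have h := pairing_eq (isUnit_jacobian D X) (bivectorRel_jacobian D P X)
    ((tensorRel_jacobian_iff D (S := S)).2 rfl) ((tensorRel_jacobian_iff D (S := T)).2 rfl)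
  rw [hX, pairing_dual, expand_apply] at h
  have h : _ = dir (fun i => D i) X (pairing P S T) := congrArg Dual.snd h
  rw [← h]
  simp [pairing]

omit [DecidableEq ι] in
theorem bracket_swap (hP : ∀ i j, P i j = - P j i) (f g : R) :
    bracket (fun i => D i) P f g = - bracket (fun i => D i) P g f := by
  rw [bracket, bracket, Finset.sum_comm, ← Finset.sum_neg_distrib]
  refine Finset.sum_congr rfl fun i _ => ?_
  rw [← Finset.sum_neg_distrib]
  refine Finset.sum_congr rfl fun j _ => ?_
  rw [hP j i]
  ring

/-- The derivative of `c₃` under a variation of the bivector by its Lie derivative. -/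
theorem snd_c₃ (hD : ∀ i j a, D i (D j a) = D j (D i a)) (hP : ∀ i j, P i j = - P j i)
    (hJ : ∀ i j k, ∑ l, (P i l * D l (P j k) + P j l * D l (P k i) + P k l * D l (P i j)) = 0)
    (f g : R) :
    (c₃ (fun i => dualD (D i)) (dualTensor Γ 0)
        (dualMatrix P (lieBivector (fun i => D i) P X)) (dual f 0) (dual g 0)).snd
      = dir (fun i => D i) X (c₃ (fun i => D i) Γ P f g)
        + pairing P (lieGamma (fun i => D i) Γ X)
          (lieGamma (fun i => D i) Γ (ham (fun i => D i) P (bracket (fun i => D i) P f g)))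
        - (c₃ (fun i => D i) Γ P (dir (fun i => D i) X f) g
          + bracket (fun i => D i) P (pairing P (lieGamma (fun i => D i) Γ X)
            (lieGamma (fun i => D i) Γ (ham (fun i => D i) P f))) g)
        - (c₃ (fun i => D i) Γ P f (dir (fun i => D i) X g)
          + bracket (fun i => D i) P f (pairing P (lieGamma (fun i => D i) Γ X)
            (lieGamma (fun i => D i) Γ (ham (fun i => D i) P g)))) := by
  have h := (coordChange_jacobian hD X).c₃_eq (fun i j a => by ext <;> simp [hD i])
    (bivectorRel_jacobian D P X) ((christoffelRel_jacobian_iff D (Γ := Γ)).2 rfl) f g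
  have h := congrArg Dual.snd h
  simp only [expand_apply, c₃_dual] at h
  have hb : bracket (fun i => D i) P f g = dir (fun i => D i) (ham (fun i => D i) P f) g :=
    bracket_eq_dir _ _ _ _
  -- For Hamiltonian fields the Jacobi identity gives `[X_f, X_g] = X_{{f,g}}`, so this becomes
  -- `L_{X_{{f,g}}}Γ = L_{X_f}L_{X_g}Γ - L_{X_g}L_{X_f}Γ`.
  have e := lieGamma_lie (Γ := Γ) (X := ham (fun i => D i) P f) (Y := ham (fun i => D i) P g) hD
  rw [lie_ham hD (lieBivector_ham hD hP hJ f), ← hb] at e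
  have e₁ := congrArg (pairing P (lieGamma (fun i => D i) Γ X)) e
  -- Bracketing with `g` on the right is `-X_g`, and `X_g` acts on the pairing by the Leibniz rule
  -- since it preserves `P`.
  have e₂ : bracket (fun i => D i) P (pairing P (lieGamma (fun i => D i) Γ X)
      (lieGamma (fun i => D i) Γ (ham (fun i => D i) P f))) g = _ :=
    (bracket_swap hP _ _).trans (congrArg Neg.neg ((bracket_eq_dir _ _ _ _).trans
      (dir_pairing (lieBivector_ham hD hP hJ g))))
  have e₃ : bracket (fun i => D i) P f (pairing P (lieGamma (fun i => D i) Γ X)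
      (lieGamma (fun i => D i) Γ (ham (fun i => D i) P g))) = _ :=
    (bracket_eq_dir _ _ _ _).trans (dir_pairing (lieBivector_ham hD hP hJ f))
  have e₄ : lieTensor (fun i => D i) (0 : ι → ι → ι → R) = 0 := by
    funext; simp [lieTensor]
  have e₅ := pairing_swap (T := lieTensor (fun i => D i) (lieGamma (fun i => D i) Γ X)
    (ham (fun i => D i) P g)) (S := lieGamma (fun i => D i) Γ (ham (fun i => D i) P f)) hP
  rw [pairing_add_right] at e₁
  rw [c₃_dual, ← h, e₂, e₃, e₄]
  simp only [ham_zero, zero_add, Pi.zero_apply, add_zero, lieGamma_add, pairing_add_left,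
    pairing_add_right, c₃]
  -- The pairings of `L_XΓ` with second Lie derivatives of `Γ` cancel by `e₁`. What remains is
  -- `⟨L_{X_g}T, L_{X_f}Γ⟩ - ⟨L_{X_f}T, L_{X_g}Γ⟩` with `T = L_XΓ`, and skewness of the pairing
  -- (`e₅`) makes this minus the variation of `c₃`.
  linear_combination - e₁ - e₅

end Derivation

end Jet

/-! ### Germs of smooth functions -/

open Filter Topology

noncomputable section SmoothGerm

variable (𝕜 : Type*) [RCLike 𝕜] {V W : Type*} [NormedAddCommGroup V] [NormedSpace ℝ V]
  [NormedAddCommGroup W] [NormedSpace ℝ W]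

/-- The ring of germs at `v` of smooth functions. -/
def smoothGerm (v : V) : Subring (Germ (𝓝 v) 𝕜) where
  carrier := {φ | ∃ f : V → 𝕜, ContDiffAt ℝ ∞ f v ∧ (f : Germ (𝓝 v) 𝕜) = φ}
  mul_mem' := by
    rintro _ _ ⟨f, hf, rfl⟩ ⟨g, hg, rfl⟩
    exact ⟨f * g, hf.mul hg, rfl⟩
  one_mem' := ⟨1, contDiffAt_const, rfl⟩
  add_mem' := by
    rintro _ _ ⟨f, hf, rfl⟩ ⟨g, hg, rfl⟩
    exact ⟨f + g, hf.add hg, rfl⟩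
  zero_mem' := ⟨0, contDiffAt_const, rfl⟩
  neg_mem' := by
    rintro _ ⟨f, hf, rfl⟩
    exact ⟨-f, hf.neg, rfl⟩

namespace SmoothGerm

variable {𝕜} {v : V}

/-- The germ of a smooth function. -/
def mk (f : V → 𝕜) (hf : ContDiffAt ℝ ∞ f v) : smoothGerm 𝕜 v := ⟨f, f, hf, rfl⟩

theorem mk_eq_mk {f g : V → 𝕜} {hf : ContDiffAt ℝ ∞ f v} {hg : ContDiffAt ℝ ∞ g v} :
    mk f hf = mk g hg ↔ f =ᶠ[𝓝 v] g :=
  Subtype.ext_iff.trans Germ.coe_eq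

theorem ind {p : smoothGerm 𝕜 v → Prop} (h : ∀ f hf, p (mk f hf)) (φ : smoothGerm 𝕜 v) : p φ := by
  obtain ⟨_, f, hf, rfl⟩ := φ
  exact h f hf

theorem mk_add {f g : V → 𝕜} (hf : ContDiffAt ℝ ∞ f v) (hg : ContDiffAt ℝ ∞ g v) :
    mk f hf + mk g hg = mk (f + g) (hf.add hg) := rfl

theorem mk_mul {f g : V → 𝕜} (hf : ContDiffAt ℝ ∞ f v) (hg : ContDiffAt ℝ ∞ g v) :
    mk f hf * mk g hg = mk (f * g) (hf.mul hg) := rfl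

theorem mk_sum {ι : Type*} (s : Finset ι) {f : ι → V → 𝕜} (hf : ∀ i, ContDiffAt ℝ ∞ (f i) v) :
    ∑ i ∈ s, mk (f i) (hf i) = mk (fun z => ∑ i ∈ s, f i z) (ContDiffAt.sum fun i _ => hf i) := by
  classical
  induction s using Finset.induction_on with
  | empty => simp only [Finset.sum_empty]; rfl
  | insert a s ha ih => 
    rw [Finset.sum_insert ha, ih, mk_add, mk_eq_mk]
    exact Eventually.of_forall fun z => (Finset.sum_insert ha (f := fun i => f i z)).symm

/-- The value of a germ. -/
def value : smoothGerm 𝕜 v →+* 𝕜 := Germ.valueRingHom.comp (smoothGerm 𝕜 v).subtype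

@[simp] theorem value_mk (f : V → 𝕜) (hf : ContDiffAt ℝ ∞ f v) : value (mk f hf) = f v := rfl

theorem contDiffAt_fderiv_apply {f : V → 𝕜} (hf : ContDiffAt ℝ ∞ f v) (w : V) :
    ContDiffAt ℝ ∞ (fun z => fderiv ℝ f z w) v :=
  (hf.fderiv_right (m := ∞) le_rfl).clm_apply contDiffAt_const

theorem eventually_differentiableAt {f : V → 𝕜} (hf : ContDiffAt ℝ ∞ f v) :
    ∀ᶠ z in 𝓝 v, DifferentiableAt ℝ f z := by
  filter_upwards [(hf.of_le (m := 1) (by norm_cast)).eventually (by simp)] with z hz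
  exact hz.differentiableAt one_ne_zero

/-- The derivative of germs of functions in the direction `w`. -/
def germD (v w : V) (φ : Germ (𝓝 v) 𝕜) : Germ (𝓝 v) 𝕜 :=
  Germ.map' (fun f z => fderiv ℝ f z w) (fun f g (h : f =ᶠ[𝓝 v] g) => by
    filter_upwards [h.fderiv (𝕜 := ℝ)] with z hz
    rw [hz]) φ

/-- The derivative of germs of smooth functions in the direction `w`. -/
def D (w : V) : Derivation ℤ (smoothGerm 𝕜 v) (smoothGerm 𝕜 v) :=
  Derivation.mk' (AddMonoidHom.toIntLinearMap
      { toFun := fun φ => ⟨germD v w φ.1, by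
          induction φ using ind with
          | h f hf => exact ⟨_, contDiffAt_fderiv_apply hf w, rfl⟩⟩
        map_zero' := by
          refine Subtype.ext (Germ.coe_eq.2 (Eventually.of_forall fun z => ?_))
          change fderiv ℝ (fun _ => (0 : 𝕜)) z w = 0
          simp
        map_add' := fun φ ψ => by
          induction φ using ind with
          | h f hf =>
            induction ψ using ind with
            | h g hg =>
              refine Subtype.ext (Germ.coe_eq.2 ?_)
              filter_upwards [eventually_differentiableAt hf, eventually_differentiableAt hg]
                with z h₁ h₂
              exact congrArg (· w) (fderiv_add h₁ h₂) })
    fun φ ψ => by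
      induction φ using ind with
      | h f hf =>
        induction ψ using ind with
        | h g hg =>
          refine Subtype.ext (Germ.coe_eq.2 ?_)
          filter_upwards [eventually_differentiableAt hf, eventually_differentiableAt hg]
            with z h₁ h₂
          exact congrArg (· w) (fderiv_mul h₁ h₂)

theorem D_mk (w : V) {f : V → 𝕜} (hf : ContDiffAt ℝ ∞ f v) :
    D w (mk f hf) = mk (fun z => fderiv ℝ f z w) (contDiffAt_fderiv_apply hf w) := rfl

theorem D_comm (w w' : V) (φ : smoothGerm 𝕜 v) : D w (D w' φ) = D w' (D w φ) := by
  induction φ using ind with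
  | h f hf =>
    rw [D_mk, D_mk, D_mk, D_mk, mk_eq_mk]
    have h2 : ContDiffAt ℝ 2 f v := hf.of_le (by norm_cast)
    filter_upwards [h2.eventually (by simp)] with z hz
    have hd : DifferentiableAt ℝ (fderiv ℝ f) z :=
      (hz.fderiv_right (m := 1) (by norm_num)).differentiableAt one_ne_zero
    rw [fderiv_clm_apply hd (differentiableAt_const _),
      fderiv_clm_apply hd (differentiableAt_const _)]
    simpa using hz.isSymmSndFDerivAt (by simp) w w'

/-- The pull-back of germs of smooth functions. -/
def pull (h : W → V) {w : W} (hh : ContDiffAt ℝ ∞ h w) : smoothGerm 𝕜 (h w) →+* smoothGerm 𝕜 w where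
  toFun φ := ⟨φ.1.compTendsto h hh.continuousAt, by
    induction φ using ind with
    | h f hf => exact ⟨f ∘ h, hf.comp w hh, rfl⟩⟩
  map_zero' := rfl
  map_one' := rfl
  map_add' φ ψ := by
    induction φ using ind with
    | h f hf =>
      induction ψ using ind with
      | h g hg => rfl
  map_mul' φ ψ := by
    induction φ using ind with
    | h f hf =>
      induction ψ using ind with
      | h g hg => rfl

theorem pull_mk (h : W → V) {w : W} (hh : ContDiffAt ℝ ∞ h w) (f : V → 𝕜)
    (hf : ContDiffAt ℝ ∞ f (h w)) :
    pull h hh (mk f hf) = mk (f ∘ h) (hf.comp w hh) := rfl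

@[simp] theorem value_pull (h : W → V) {w : W} (hh : ContDiffAt ℝ ∞ h w)
    (φ : smoothGerm 𝕜 (h w)) : value (pull h hh φ) = value φ := by
  induction φ using ind with
  | h f hf => rfl

/-- For maps carrying a constant direction to a constant direction no Jacobian coefficients appear.
It is meant for the inclusion of a time slice into `ℝ × Model d`. -/
theorem D_pull_of_fderiv_eq (h : W → V) {w : W} (hh : ContDiffAt ℝ ∞ h w) (a : W) (b : V)
    (hab : ∀ᶠ z in 𝓝 w, HasFDerivAt h (fderiv ℝ h z) z ∧ fderiv ℝ h z a = b)
    (φ : smoothGerm 𝕜 (h w)) : D a (pull h hh φ) = pull h hh (D b φ) := by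
  induction φ using ind with
  | h f hf =>
    rw [pull_mk, D_mk, D_mk, pull_mk, mk_eq_mk]
    filter_upwards [hab, hh.continuousAt (eventually_differentiableAt hf)] with z ⟨h₁, h₂⟩ h₃
    rw [((show DifferentiableAt ℝ f (h z) from h₃).hasFDerivAt.comp z h₁).fderiv]
    simp [h₂]

theorem eventually_hasFDerivAt {h : W → V} {w : W} (hh : ContDiffAt ℝ ∞ h w) :
    ∀ᶠ z in 𝓝 w, HasFDerivAt h (fderiv ℝ h z) z := by
  filter_upwards [(hh.of_le (m := 1) (by norm_cast)).eventually (by simp)] with z hz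
  exact (hz.differentiableAt one_ne_zero).hasFDerivAt

/-- The real entries of the Jacobian matrix, as germs. -/
theorem D_pull {d : ℕ} (h : W → Model d) {w : W} (hh : ContDiffAt ℝ ∞ h w) (a : W)
    (hJ : ∀ i, ContDiffAt ℝ ∞ (fun z => ((fderiv ℝ h z a i : ℝ) : 𝕜)) w)
    (φ : smoothGerm 𝕜 (h w)) :
    D a (pull h hh φ) = ∑ i, mk (fun z => ((fderiv ℝ h z a i : ℝ) : 𝕜)) (hJ i)
      * pull h hh (D (EuclideanSpace.single i (1 : ℝ)) φ) := by
  induction φ using ind with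
  | h f hf =>
    simp only [pull_mk, D_mk, mk_mul]
    rw [mk_sum, mk_eq_mk]
    filter_upwards [eventually_hasFDerivAt hh, hh.continuousAt (eventually_differentiableAt hf)]
      with z h₁ h₃
    rw [((show DifferentiableAt ℝ f (h z) from h₃).hasFDerivAt.comp z h₁).fderiv]
    have := (EuclideanSpace.basisFun (Fin d) ℝ).sum_repr (fderiv ℝ h z a)
    simp only [EuclideanSpace.basisFun_repr, EuclideanSpace.basisFun_apply] at this
    rw [ContinuousLinearMap.comp_apply, ← this, map_sum]
    simp [RCLike.real_smul_eq_coe_mul]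

end SmoothGerm

end SmoothGerm

/-! ### Coordinate frames on chart domains -/

open Filter Topology

section Frame

variable {d : ℕ} {M : Type*} [TopologicalSpace M] [ChartedSpace (Model d) M]
  [IsManifold (𝓡 d) ∞ M] {𝕜 : Type*} [RCLike 𝕜]

omit [IsManifold (𝓡 d) ∞ M] in
theorem extChartAt_source_mem_nhds_of_mem {x y : M} (hy : y ∈ (extChartAt (𝓡 d) x).source) :
    (extChartAt (𝓡 d) x).source ∈ 𝓝 y :=
  (isOpen_extChartAt_source x).mem_nhds hy

omit [IsManifold (𝓡 d) ∞ M] in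
theorem extChartAt_target_mem_nhds_of_mem {x : M} {z : Model d}
    (hz : z ∈ (extChartAt (𝓡 d) x).target) : (extChartAt (𝓡 d) x).target ∈ 𝓝 z :=
  (isOpen_extChartAt_target x).mem_nhds hz

theorem mdifferentiableAt_chart {x y : M} (hy : y ∈ (extChartAt (𝓡 d) x).source) :
    MDifferentiableAt (𝓡 d) 𝓘(ℝ, Model d) (extChartAt (𝓡 d) x) y :=
  mdifferentiableAt_extChartAt (by rwa [extChartAt_source] at hy)

theorem contMDiffAt_chart_symm {x : M} {z : Model d} (hz : z ∈ (extChartAt (𝓡 d) x).target) :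
    ContMDiffAt 𝓘(ℝ, Model d) (𝓡 d) ∞ (extChartAt (𝓡 d) x).symm z :=
  (contMDiffOn_extChartAt_symm x).contMDiffAt (extChartAt_target_mem_nhds_of_mem hz)

theorem contMDiffAt_chart {x y : M} (hy : y ∈ (extChartAt (𝓡 d) x).source) :
    ContMDiffAt (𝓡 d) 𝓘(ℝ, Model d) ∞ (extChartAt (𝓡 d) x) y :=
  contMDiffAt_extChartAt' (by rwa [extChartAt_source] at hy)

/-- The coordinates of tangent vectors in the chart around `x`. -/
noncomputable def chartDeriv (x y : M) : TangentSpace (𝓡 d) y →L[ℝ] Model d :=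
  mfderiv (𝓡 d) 𝓘(ℝ, Model d) (extChartAt (𝓡 d) x) y

theorem coordForm_apply {x y : M} (hy : y ∈ (extChartAt (𝓡 d) x).source) (i : Fin d)
    (v : TangentSpace (𝓡 d) y) : coordForm x i y v = chartDeriv x y v i := by
  have h := mfderiv_comp_apply (I := 𝓡 d) (I' := 𝓘(ℝ, Model d)) (I'' := 𝓘(ℝ, ℝ)) y
    (g := (EuclideanSpace.proj i : Model d →L[ℝ] ℝ)) (f := extChartAt (𝓡 d) x)
    (ContinuousLinearMap.differentiableAt _).mdifferentiableAt (mdifferentiableAt_chart hy) v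
  rw [mfderiv_eq_fderiv, ContinuousLinearMap.fderiv] at h
  exact h

theorem mvfderiv_eq_fderiv_chart {x y : M} (hy : y ∈ (extChartAt (𝓡 d) x).source)
    {F : Type*} [NormedAddCommGroup F] [NormedSpace ℝ F] (f : M → F) (v : TangentSpace (𝓡 d) y) :
    mvfderiv (𝓡 d) f y v
      = fderiv ℝ (f ∘ (extChartAt (𝓡 d) x).symm) (extChartAt (𝓡 d) x y) (chartDeriv x y v) := by
  set e := extChartAt (𝓡 d) x
  have hev : (f ∘ e.symm) ∘ e =ᶠ[𝓝 y] f := by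
    filter_upwards [extChartAt_source_mem_nhds_of_mem hy] with w hw
    exact congrArg f (e.left_inv hw)
  by_cases h : DifferentiableAt ℝ (f ∘ e.symm) (e y)
  · have := mfderiv_comp_apply (I := 𝓡 d) (I' := 𝓘(ℝ, Model d)) (I'' := 𝓘(ℝ, F)) y
      (g := f ∘ e.symm) (f := e) h.mdifferentiableAt (mdifferentiableAt_chart hy) v
    rw [hev.mfderiv_eq, mfderiv_eq_fderiv] at this
    exact this
  -- Without differentiability both derivatives take the default value zero; since the inverse chart
  -- is differentiable, non-differentiability passes from the coordinate expression to `f`.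
  · have h' : ¬ MDifferentiableAt (𝓡 d) 𝓘(ℝ, F) f y := by
      intro hf
      apply h
      have hs : MDifferentiableAt 𝓘(ℝ, Model d) (𝓡 d) e.symm (e y) :=
        (contMDiffAt_chart_symm (e.map_source hy)).mdifferentiableAt (by simp)
      have hf' : MDifferentiableAt (𝓡 d) 𝓘(ℝ, F) f (e.symm (e y)) := by rwa [e.left_inv hy]
      exact (hf'.comp _ hs).differentiableAt
    rw [fderiv_zero_of_not_differentiableAt h]
    simp [mvfderiv, mfderiv_zero_of_not_mdifferentiableAt h']

/-- The tangent space at `x` is identified with the model space by the preferred chart at `x`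
itself, so the derivative of that chart at `x` is the identity. -/
theorem chartDeriv_self (x : M) (v : TangentSpace (𝓡 d) x) : chartDeriv x x v = v := by
  have h := TangentBundle.continuousLinearMapAt_trivializationAt (𝕜 := ℝ) (I := 𝓡 d)
    (mem_chart_source (Model d) x)
  rw [chartDeriv, ← h, TangentBundle.continuousLinearMapAt_trivializationAt_eq_core
    (mem_chart_source (Model d) x)]
  exact (tangentBundleCore (𝓡 d) M).coordChange_self _ _ (mem_chart_source (Model d) x) v

theorem trivializationAt_snd {x y : M} (hy : y ∈ (extChartAt (𝓡 d) x).source)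
    (v : TangentSpace (𝓡 d) y) :
    ((trivializationAt (Model d) (TangentSpace (𝓡 d)) x) ⟨y, v⟩).2 = chartDeriv x y v := by
  have hy' : y ∈ (chartAt (Model d) x).source := by rwa [extChartAt_source] at hy
  have := congrFun (Bundle.Trivialization.continuousLinearMapAt_apply ℝ
      (trivializationAt (Model d) (TangentSpace (𝓡 d)) x) y) v
  rw [Bundle.Trivialization.coe_linearMapAt_of_mem _ hy',
    TangentBundle.continuousLinearMapAt_trivializationAt (𝕜 := ℝ) (I := 𝓡 d) hy'] at this
  exact this.symm

/-- `FiberBundle.extend` is constant in the trivialisation at `x`, and that trivialisation is the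
derivative of the chart. -/
theorem chartDeriv_coordField {x y : M} (hy : y ∈ (extChartAt (𝓡 d) x).source) (i : Fin d) :
    chartDeriv x y (coordField x i y) = EuclideanSpace.single i (1 : ℝ) := by
  have hy' : y ∈ (chartAt (Model d) x).source := by rwa [extChartAt_source] at hy
  rw [← trivializationAt_snd hy, coordField, FiberBundle.extend,
    Bundle.Trivialization.apply_mk_symm _ hy', trivializationAt_snd (mem_extChartAt_source x),
    chartDeriv_self]
  rfl

theorem chartDeriv_injective {x y : M} (hy : y ∈ (extChartAt (𝓡 d) x).source) :
    Function.Injective (chartDeriv (d := d) x y) :=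
  (isInvertible_mfderiv_extChartAt (I := 𝓡 d) hy).injective

theorem coordForm_coordField {x y : M} (hy : y ∈ (extChartAt (𝓡 d) x).source) (i j : Fin d) :
    coordForm x i y (coordField x j y) = if i = j then 1 else 0 := by
  rw [coordForm_apply hy, chartDeriv_coordField hy]
  simp

theorem chartDeriv_eq_sum {x y : M} (hy : y ∈ (extChartAt (𝓡 d) x).source)
    (v : TangentSpace (𝓡 d) y) :
    chartDeriv x y v = ∑ i, coordForm x i y v • (EuclideanSpace.single i (1 : ℝ) : Model d) := by
  have := (EuclideanSpace.basisFun (Fin d) ℝ).sum_repr (chartDeriv x y v)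
  simp only [EuclideanSpace.basisFun_repr, EuclideanSpace.basisFun_apply] at this
  simp only [coordForm_apply hy, this]

theorem sum_coordForm_smul_coordField {x y : M} (hy : y ∈ (extChartAt (𝓡 d) x).source)
    (v : TangentSpace (𝓡 d) y) : ∑ i, coordForm x i y v • coordField x i y = v := by
  apply chartDeriv_injective hy
  rw [map_sum, chartDeriv_eq_sum hy v]
  refine Finset.sum_congr rfl fun i _ => ?_
  rw [map_smul, chartDeriv_coordField hy]

theorem coordForm_self (x : M) (i : Fin d) : coordForm x i x = coordAt x i := by
  ext v
  rw [coordForm_apply (mem_extChartAt_source x), chartDeriv_self]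
  rfl

theorem coordField_self (x : M) (i : Fin d) : coordField x i x = partialAt x i :=
  FiberBundle.extend_apply_self ..

theorem mvfderiv_coordField {x y : M} (hy : y ∈ (extChartAt (𝓡 d) x).source)
    {F : Type*} [NormedAddCommGroup F] [NormedSpace ℝ F] (f : M → F) (i : Fin d) :
    mvfderiv (𝓡 d) f y (coordField x i y)
      = fderiv ℝ (f ∘ (extChartAt (𝓡 d) x).symm) (extChartAt (𝓡 d) x y)
          (EuclideanSpace.single i (1 : ℝ)) := by
  rw [mvfderiv_eq_fderiv_chart hy, chartDeriv_coordField hy]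

theorem mvfderiv_partialAt (x : M) {F : Type*} [NormedAddCommGroup F] [NormedSpace ℝ F]
    (f : M → F) (i : Fin d) :
    mvfderiv (𝓡 d) f x (partialAt x i)
      = fderiv ℝ (f ∘ (extChartAt (𝓡 d) x).symm) (extChartAt (𝓡 d) x x)
          (EuclideanSpace.single i (1 : ℝ)) := by
  rw [← coordField_self, mvfderiv_coordField (mem_extChartAt_source x)]

theorem mvfderiv_eq_sum {x y : M} (hy : y ∈ (extChartAt (𝓡 d) x).source)
    {F : Type*} [NormedAddCommGroup F] [NormedSpace ℝ F] (f : M → F) (v : TangentSpace (𝓡 d) y) :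
    mvfderiv (𝓡 d) f y v = ∑ i, coordForm x i y v •
      fderiv ℝ (f ∘ (extChartAt (𝓡 d) x).symm) (extChartAt (𝓡 d) x y)
          (EuclideanSpace.single i (1 : ℝ)) := by
  conv_lhs => rw [← sum_coordForm_smul_coordField hy v]
  rw [map_sum]
  simp only [map_smul, mvfderiv_coordField hy]

/-- A section is `C^n` at `y` if and only if its components in the chart around `x` are. -/
theorem contMDiffAt_section_iff_chartDeriv {x y : M} (hy : y ∈ (extChartAt (𝓡 d) x).source)
    {n : ℕ∞} {V : (y : M) → TangentSpace (𝓡 d) y} :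
    ContMDiffAt (𝓡 d) (𝓡 d).tangent n (fun w => (⟨w, V w⟩ : TangentBundle (𝓡 d) M)) y ↔
      ContMDiffAt (𝓡 d) 𝓘(ℝ, Model d) n (fun w => chartDeriv x w (V w)) y := by
  have hy' : y ∈ (chartAt (Model d) x).source := by rwa [extChartAt_source] at hy
  have : ContMDiffVectorBundle n (Model d) (TangentSpace (𝓡 d) : M → Type _) (𝓡 d) := by
    have : IsManifold (𝓡 d) ((n : WithTop ℕ∞) + 1) M := IsManifold.of_le (n := ∞) (by
      exact_mod_cast le_top)
    exact TangentBundle.contMDiffVectorBundle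
  refine ((trivializationAt (Model d) (TangentSpace (𝓡 d)) x).contMDiffAt_section_iff
    (IB := 𝓡 d) (n := n) (s := V) (x₀ := y) hy').trans (Filter.EventuallyEq.contMDiffAt_iff ?_)
  filter_upwards [extChartAt_source_mem_nhds_of_mem hy] with w hw
  exact trivializationAt_snd hw _

end Frame

/-! ### Coordinate expressions for functions and for germs -/

open Filter Topology

noncomputable section GermExpressions

variable {𝕜 : Type*} [RCLike 𝕜] {V W : Type*} [NormedAddCommGroup V] [NormedSpace ℝ V]
  [NormedAddCommGroup W] [NormedSpace ℝ W] {ι : Type*} [Fintype ι]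

/-- The derivatives of functions in the directions `e i`. -/
def pd (e : ι → V) (i : ι) (F : V → 𝕜) : V → 𝕜 := fun z => fderiv ℝ F z (e i)

/-- The inclusion of real functions into functions with values in `𝕜`. -/
def ofRealFun (𝕜 : Type*) [RCLike 𝕜] (V : Type*) : (V → ℝ) →+* (V → 𝕜) :=
  (algebraMap ℝ 𝕜).compLeft V

omit [NormedAddCommGroup V] [NormedSpace ℝ V] in
theorem ofRealFun_apply (F : V → ℝ) (z : V) : ofRealFun 𝕜 V F z = (F z : 𝕜) := rfl

theorem fderiv_ofReal (F : V → ℝ) (z w : V) :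
    fderiv ℝ (fun z => (F z : 𝕜)) z w = ((fderiv ℝ F z w : ℝ) : 𝕜) := by
  by_cases h : DifferentiableAt ℝ F z
  · have := ((RCLike.ofRealCLM (K := 𝕜)).hasFDerivAt.comp z h.hasFDerivAt).fderiv
    exact congrArg (· w) this
  · have h' : ¬ DifferentiableAt ℝ (fun z => (F z : 𝕜)) z := by
      intro hF
      apply h
      have := (RCLike.reCLM (K := 𝕜)).differentiableAt.comp z hF
      simpa [Function.comp_def] using this
    rw [fderiv_zero_of_not_differentiableAt h, fderiv_zero_of_not_differentiableAt h']
    simp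

omit [Fintype ι] in
theorem ofRealFun_pd (e : ι → V) (i : ι) (F : V → ℝ) :
    ofRealFun 𝕜 V (pd e i F) = pd e i (ofRealFun 𝕜 V F) :=
  funext fun z => (fderiv_ofReal F z (e i)).symm

theorem contDiffAt_ofRealFun {F : V → ℝ} {z : V} (h : ContDiffAt ℝ ∞ F z) :
    ContDiffAt ℝ ∞ (ofRealFun 𝕜 V F) z :=
  (RCLike.ofRealCLM (K := 𝕜)).contDiff.contDiffAt.comp z h

namespace SmoothGerm

open scoped Classical in
/-- The germ of a function, or zero if the function is not smooth. -/
def germ (z : V) (F : V → 𝕜) : smoothGerm 𝕜 z := if h : ContDiffAt ℝ ∞ F z then mk F h else 0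

variable {z : V} {F G : V → 𝕜}

theorem germ_eq (h : ContDiffAt ℝ ∞ F z) : germ z F = mk F h := dif_pos h

theorem coe_germ (h : ContDiffAt ℝ ∞ F z) : (germ z F : Germ (𝓝 z) 𝕜) = (F : Germ (𝓝 z) 𝕜) := by
  rw [germ_eq h]; rfl

theorem germ_congr (h : F =ᶠ[𝓝 z] G) : germ z F = germ z G := by
  by_cases hF : ContDiffAt ℝ ∞ F z
  · rw [germ_eq hF, germ_eq (hF.congr_of_eventuallyEq h.symm), mk_eq_mk]
    exact h
  · have hG : ¬ ContDiffAt ℝ ∞ G z := fun hG => hF (hG.congr_of_eventuallyEq h)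
    rw [germ, germ, dif_neg hF, dif_neg hG]

/-- The function `F` represents the germ `φ`. -/
def Represents (F : V → 𝕜) (φ : smoothGerm 𝕜 z) : Prop := (F : Germ (𝓝 z) 𝕜) = φ

theorem Represents.contDiffAt {φ : smoothGerm 𝕜 z} (h : Represents F φ) :
    ContDiffAt ℝ ∞ F z := by
  induction φ using ind with
  | h f hf => exact hf.congr_of_eventuallyEq (Germ.coe_eq.1 h)

theorem Represents.germ_eq {φ : smoothGerm 𝕜 z} (h : Represents F φ) : germ z F = φ :=
  Subtype.ext ((coe_germ (Represents.contDiffAt h)).trans h)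

theorem value_germ (h : ContDiffAt ℝ ∞ F z) : value (germ z F) = F z := by
  rw [germ_eq h, value_mk]

theorem D_germ (h : ContDiffAt ℝ ∞ F z) (w : V) :
    D w (germ z F) = germ z (fun z => fderiv ℝ F z w) := by
  rw [germ_eq h, D_mk, germ_eq]

theorem pull_germ (h : W → V) {w : W} (hh : ContDiffAt ℝ ∞ h w) (hF : ContDiffAt ℝ ∞ F (h w)) :
    pull h hh (germ (h w) F) = germ w (F ∘ h) := by
  rw [germ_eq hF, pull_mk, germ_eq]

/-- All components of a bivector are smooth at `z`. -/
def SmoothBivector (P : Matrix ι ι (V → 𝕜)) (z : V) : Prop := ∀ i j, ContDiffAt ℝ ∞ (P i j) z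

/-- All Christoffel symbols are smooth at `z`. -/
def SmoothChristoffel (Γ : ι → ι → ι → V → 𝕜) (z : V) : Prop :=
  ∀ i k l, ContDiffAt ℝ ∞ (Γ i k l) z

variable (e : ι → V) {P : Matrix ι ι (V → 𝕜)} {Γ : ι → ι → ι → V → 𝕜} {X : ι → V → 𝕜}

/-- The derivations of the ring of germs in the directions `e i`. -/
abbrev partials (e : ι → V) (z : V) (i : ι) : Derivation ℤ (smoothGerm 𝕜 z) (smoothGerm 𝕜 z) :=
  D (e i)

omit [Fintype ι] in
theorem coe_pd (i : ι) (F : V → 𝕜) :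
    Germ.coeRingHom (𝓝 z) (pd e i F) = germD z (e i) (Germ.coeRingHom (𝓝 z) F) := rfl

omit [Fintype ι] in
theorem subtype_partials (i : ι) (φ : smoothGerm 𝕜 z) :
    (smoothGerm 𝕜 z).subtype (partials e z i φ) = germD z (e i) ((smoothGerm 𝕜 z).subtype φ) := rfl

/-- The ring of functions and the ring of smooth germs both map to the ring of all germs, compatibly
with differentiation. The two expressions are compared there; the lemmas for the other expressions
follow the same pattern. -/
theorem represents_bracket (hP : SmoothBivector P z) (hF : ContDiffAt ℝ ∞ F z)
    (hG : ContDiffAt ℝ ∞ G z) :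
    Represents (Jet.bracket (pd e) P F G)
      (Jet.bracket (fun i => partials e z i)
      (P.map (germ z)) (germ z F) (germ z G) : smoothGerm 𝕜 z) := by
  refine (Jet.map_bracket (Germ.coeRingHom (𝓝 z)) (coe_pd e) P F G).trans
    (Eq.trans ?_ (Jet.map_bracket (smoothGerm 𝕜 z).subtype (subtype_partials e) _ _ _).symm)
  congr 1
  · ext i j; exact (coe_germ (hP i j)).symm
  · exact (coe_germ hF).symm
  · exact (coe_germ hG).symm

theorem represents_dir (hX : ∀ i, ContDiffAt ℝ ∞ (X i) z) (hF : ContDiffAt ℝ ∞ F z) :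
    Represents (Jet.dir (pd e) X F)
      (Jet.dir (fun i => partials e z i)
      (fun i => germ z (X i)) (germ z F) : smoothGerm 𝕜 z) := by
  refine (Jet.map_dir (Germ.coeRingHom (𝓝 z)) (coe_pd e) X F).trans
    (Eq.trans ?_ (Jet.map_dir (smoothGerm 𝕜 z).subtype (subtype_partials e) _ _).symm)
  congr 1
  · ext i; exact (coe_germ (hX i)).symm
  · exact (coe_germ hF).symm

theorem represents_ham (hP : SmoothBivector P z) (hF : ContDiffAt ℝ ∞ F z) (k : ι) :
    Represents (Jet.ham (pd e) P F k)
      (Jet.ham (fun i => partials e z i)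
      (P.map (germ z)) (germ z F) k : smoothGerm 𝕜 z) := by
  refine (Jet.map_ham (Germ.coeRingHom (𝓝 z)) (coe_pd e) P F k).trans
    (Eq.trans ?_ (Jet.map_ham (smoothGerm 𝕜 z).subtype (subtype_partials e) _ _ _).symm)
  congr 1
  · ext i j; exact (coe_germ (hP i j)).symm
  · exact (coe_germ hF).symm

theorem represents_lieGamma (hΓ : SmoothChristoffel Γ z) (hX : ∀ i, ContDiffAt ℝ ∞ (X i) z) (j k l : ι) :
    Represents (Jet.lieGamma (pd e) Γ X j k l)
      (Jet.lieGamma (fun i => partials e z i)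
      (fun i k l => germ z (Γ i k l)) (fun i => germ z (X i)) j k l : smoothGerm 𝕜 z) := by
  have h₁ := Jet.map_lieGamma (Germ.coeRingHom (𝓝 z)) (coe_pd e) Γ X j k l
  have h₂ := Jet.map_lieGamma (smoothGerm 𝕜 z).subtype (subtype_partials e)
    (fun i k l => germ z (Γ i k l)) (fun i => germ z (X i)) j k l
  refine h₁.trans (Eq.trans ?_ h₂.symm)
  congr 1
  · ext i k l; exact (coe_germ (hΓ i k l)).symm
  · ext i; exact (coe_germ (hX i)).symm

theorem represents_c₂ (hΓ : SmoothChristoffel Γ z) (hP : SmoothBivector P z) (hF : ContDiffAt ℝ ∞ F z)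
    (hG : ContDiffAt ℝ ∞ G z) :
    Represents (Jet.c₂ (pd e) Γ P F G)
      (Jet.c₂ (fun i => partials e z i)
      (fun i k l => germ z (Γ i k l)) (P.map (germ z)) (germ z F) (germ z G) :
        smoothGerm 𝕜 z) := by
  refine (Jet.map_c₂ (Germ.coeRingHom (𝓝 z)) (coe_pd e) Γ P F G).trans
    (Eq.trans ?_ (Jet.map_c₂ (smoothGerm 𝕜 z).subtype (subtype_partials e) _ _ _ _).symm)
  congr 1
  · ext i k l; exact (coe_germ (hΓ i k l)).symm
  · ext i j; exact (coe_germ (hP i j)).symm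
  · exact (coe_germ hF).symm
  · exact (coe_germ hG).symm

theorem represents_pairing {S T : ι → ι → ι → V → 𝕜} (hP : SmoothBivector P z)
    (hS : SmoothChristoffel S z) (hT : SmoothChristoffel T z) :
    Represents (Jet.pairing P S T)
      (Jet.pairing (P.map (germ z))
      (fun i k l => germ z (S i k l)) (fun i k l => germ z (T i k l)) : smoothGerm 𝕜 z) := by
  have h₁ := Jet.map_pairing (Germ.coeRingHom (𝓝 z)) P S T
  have h₂ := Jet.map_pairing (smoothGerm 𝕜 z).subtype (P.map (germ z))
    (fun i k l => germ z (S i k l)) (fun i k l => germ z (T i k l))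
  refine h₁.trans (Eq.trans ?_ h₂.symm)
  congr 1
  · ext i j; exact (coe_germ (hP i j)).symm
  · ext i k l; exact (coe_germ (hS i k l)).symm
  · ext i k l; exact (coe_germ (hT i k l)).symm

theorem contDiffAt_ham (hP : SmoothBivector P z) (hF : ContDiffAt ℝ ∞ F z) (k : ι) :
    ContDiffAt ℝ ∞ (Jet.ham (pd e) P F k) z := Represents.contDiffAt (represents_ham e hP hF k)

theorem germ_ham (hP : SmoothBivector P z) (hF : ContDiffAt ℝ ∞ F z) (k : ι) :
    germ z (Jet.ham (pd e) P F k)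
      = Jet.ham (fun i => partials e z i) (P.map (germ z)) (germ z F) k :=
  Represents.germ_eq (represents_ham e hP hF k)

theorem contDiffAt_lieGamma (hΓ : SmoothChristoffel Γ z) (hX : ∀ i, ContDiffAt ℝ ∞ (X i) z) :
    SmoothChristoffel (Jet.lieGamma (pd e) Γ X) z := fun j k l =>
  Represents.contDiffAt (represents_lieGamma e hΓ hX j k l)

theorem germ_lieGamma (hΓ : SmoothChristoffel Γ z) (hX : ∀ i, ContDiffAt ℝ ∞ (X i) z)
    (j k l : ι) :
    germ z (Jet.lieGamma (pd e) Γ X j k l) = Jet.lieGamma (fun i => partials e z i)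
      (fun i k l => germ z (Γ i k l)) (fun i => germ z (X i)) j k l :=
  Represents.germ_eq (represents_lieGamma e hΓ hX j k l)

theorem represents_pairing_lieGamma {Y : ι → V → 𝕜} (hΓ : SmoothChristoffel Γ z)
    (hP : SmoothBivector P z) (hX : ∀ i, ContDiffAt ℝ ∞ (X i) z)
    (hY : ∀ i, ContDiffAt ℝ ∞ (Y i) z) :
    Represents (Jet.pairing P (Jet.lieGamma (pd e) Γ X) (Jet.lieGamma (pd e) Γ Y))
      (Jet.pairing (P.map (germ z))
        (Jet.lieGamma (fun i => partials e z i) (fun i k l => germ z (Γ i k l))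
          (fun i => germ z (X i)))
        (Jet.lieGamma (fun i => partials e z i) (fun i k l => germ z (Γ i k l))
          (fun i => germ z (Y i))) : smoothGerm 𝕜 z) := by
  have := represents_pairing hP (contDiffAt_lieGamma e hΓ hX) (contDiffAt_lieGamma e hΓ hY)
  simpa only [germ_lieGamma e hΓ hX, germ_lieGamma e hΓ hY] using this

theorem represents_pairing_ham (hΓ : SmoothChristoffel Γ z)
    (hP : SmoothBivector P z) (hX : ∀ i, ContDiffAt ℝ ∞ (X i) z) (hF : ContDiffAt ℝ ∞ F z) :
    Represents (Jet.pairing P (Jet.lieGamma (pd e) Γ X) (Jet.lieGamma (pd e) Γ (Jet.ham (pd e) P F)))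
      (Jet.pairing (P.map (germ z))
        (Jet.lieGamma (fun i => partials e z i) (fun i k l => germ z (Γ i k l))
          (fun i => germ z (X i)))
        (Jet.lieGamma (fun i => partials e z i) (fun i k l => germ z (Γ i k l))
          (Jet.ham (fun i => partials e z i) (P.map (germ z)) (germ z F))) : smoothGerm 𝕜 z) := by
  have := represents_pairing_lieGamma e hΓ hP hX (contDiffAt_ham e hP hF)
  simpa only [germ_ham e hP hF] using this

theorem represents_c₃ (hΓ : SmoothChristoffel Γ z) (hP : SmoothBivector P z) (hF : ContDiffAt ℝ ∞ F z)
    (hG : ContDiffAt ℝ ∞ G z) :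
    Represents (Jet.c₃ (pd e) Γ P F G)
      (Jet.c₃ (fun i => partials e z i)
      (fun i k l => germ z (Γ i k l)) (P.map (germ z)) (germ z F) (germ z G) :
        smoothGerm 𝕜 z) := by
  have := represents_pairing_ham e hΓ hP (contDiffAt_ham e hP hF) hG
  simp only [germ_ham e hP hF] at this
  exact this

end SmoothGerm

end GermExpressions

/-! ### Geometric objects in a chart -/

open Filter Topology VectorField

/-- The standard frame of the model space. -/
noncomputable def frame (d : ℕ) (i : Fin d) : Model d := EuclideanSpace.single i (1 : ℝ)

noncomputable section Chart

variable {d : ℕ} {M : Type*} [TopologicalSpace M] [ChartedSpace (Model d) M]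
  [IsManifold (𝓡 d) ∞ M] {𝕜 : Type*} [RCLike 𝕜]

/-- The function `f` in the chart around `x`. -/
def read (x : M) (f : M → 𝕜) : Model d → 𝕜 := f ∘ (extChartAt (𝓡 d) x).symm

/-- The components of a vector field in the chart around `x`. -/
def vecHat (x : M) (X : (y : M) → TangentSpace (𝓡 d) y) (k : Fin d) : Model d → ℝ := fun z =>
  coordForm x k ((extChartAt (𝓡 d) x).symm z) (X ((extChartAt (𝓡 d) x).symm z))

/-- The components of a contravariant tensor in the chart around `x`. -/
def bivHat (x : M) (P : TwoTensor d M) : Matrix (Fin d) (Fin d) (Model d → ℝ) :=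
  .of fun i j z => P ((extChartAt (𝓡 d) x).symm z) (coordForm x i ((extChartAt (𝓡 d) x).symm z))
    (coordForm x j ((extChartAt (𝓡 d) x).symm z))

/-- The Christoffel symbols in the chart around `x`. -/
def chHat (nabla : Connection d M) (x : M) (i k l : Fin d) : Model d → ℝ := fun z =>
  coordForm x i ((extChartAt (𝓡 d) x).symm z) (nabla (coordField x l)
    ((extChartAt (𝓡 d) x).symm z) (coordField x k ((extChartAt (𝓡 d) x).symm z)))

omit [IsManifold (𝓡 d) ∞ M] in
theorem vecHat_chart {x y : M} (hy : y ∈ (extChartAt (𝓡 d) x).source)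
    (X : (y : M) → TangentSpace (𝓡 d) y) (k : Fin d) :
    vecHat x X k (extChartAt (𝓡 d) x y) = coordForm x k y (X y) := by
  rw [vecHat, (extChartAt (𝓡 d) x).left_inv hy]

omit [IsManifold (𝓡 d) ∞ M] in
theorem bivHat_chart {x y : M} (hy : y ∈ (extChartAt (𝓡 d) x).source) (P : TwoTensor d M)
    (i j : Fin d) :
    bivHat x P i j (extChartAt (𝓡 d) x y) = P y (coordForm x i y) (coordForm x j y) := by
  rw [bivHat, Matrix.of_apply, (extChartAt (𝓡 d) x).left_inv hy]

theorem chHat_chart {x y : M} (hy : y ∈ (extChartAt (𝓡 d) x).source) (nabla : Connection d M)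
    (i k l : Fin d) :
    chHat nabla x i k l (extChartAt (𝓡 d) x y)
      = coordForm x i y (nabla (coordField x l) y (coordField x k y)) := by
  rw [chHat, (extChartAt (𝓡 d) x).left_inv hy]

omit [IsManifold (𝓡 d) ∞ M] [RCLike 𝕜] in
theorem read_chart {x y : M} (hy : y ∈ (extChartAt (𝓡 d) x).source) (f : M → 𝕜) :
    read x f (extChartAt (𝓡 d) x y) = f y := by
  rw [read, Function.comp_apply, (extChartAt (𝓡 d) x).left_inv hy]

theorem mvfderiv_coordField_read {x y : M} (hy : y ∈ (extChartAt (𝓡 d) x).source) (f : M → 𝕜)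
    (i : Fin d) :
    mvfderiv (𝓡 d) f y (coordField x i y) = pd (frame d) i (read x f) (extChartAt (𝓡 d) x y) :=
  mvfderiv_coordField hy f i

/-- The components of a vector field as a vector field on the model space. -/
def vecField (x : M) (X : (y : M) → TangentSpace (𝓡 d) y) (z : Model d) : Model d :=
  WithLp.toLp 2 fun k => vecHat x X k z

theorem chartDeriv_eq_vecField {x y : M} (hy : y ∈ (extChartAt (𝓡 d) x).source)
    (X : (y : M) → TangentSpace (𝓡 d) y) :
    chartDeriv x y (X y) = vecField x X (extChartAt (𝓡 d) x y) := by
  ext k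
  rw [vecField, ← coordForm_apply hy]
  exact (vecHat_chart hy X k).symm

omit [IsManifold (𝓡 d) ∞ M] in
theorem contDiffAt_vecField {x : M} {X : (y : M) → TangentSpace (𝓡 d) y} {z : Model d}
    {n : WithTop ℕ∞} (h : ∀ k, ContDiffAt ℝ n (vecHat x X k) z) :
    ContDiffAt ℝ n (vecField x X) z :=
  contDiffAt_euclidean.2 h

theorem contMDiffAt_section_iff_vecHat {x y : M} (hy : y ∈ (extChartAt (𝓡 d) x).source)
    {n : ℕ∞} {X : (y : M) → TangentSpace (𝓡 d) y} :
    ContMDiffAt (𝓡 d) (𝓡 d).tangent n (fun w => (⟨w, X w⟩ : TangentBundle (𝓡 d) M)) y ↔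
      ∀ k, ContDiffAt ℝ n (vecHat x X k) (extChartAt (𝓡 d) x y) := by
  have hn : (n : WithTop ℕ∞) ≤ ∞ := by exact_mod_cast le_top
  rw [contMDiffAt_section_iff_chartDeriv hy]
  constructor
  · intro h k
    have hs := contMDiffAt_chart_symm ((extChartAt (𝓡 d) x).map_source hy)
    rw [← (extChartAt (𝓡 d) x).left_inv hy] at h
    have h' := (h.comp _ (hs.of_le hn)).contDiffAt
    refine ((contDiffAt_euclidean.1 h') k).congr_of_eventuallyEq ?_
    filter_upwards [extChartAt_target_mem_nhds_of_mem ((extChartAt (𝓡 d) x).map_source hy)]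
      with z hz
    exact coordForm_apply ((extChartAt (𝓡 d) x).map_target hz) k _
  · intro h
    have h' := (contDiffAt_vecField h).contMDiffAt.comp y ((contMDiffAt_chart hy).of_le hn)
    refine h'.congr_of_eventuallyEq ?_
    filter_upwards [extChartAt_source_mem_nhds_of_mem hy] with w hw
    exact chartDeriv_eq_vecField hw X

theorem mdifferentiableAt_section_of_vecHat {x y : M} (hy : y ∈ (extChartAt (𝓡 d) x).source)
    {X : (y : M) → TangentSpace (𝓡 d) y}
    (h : ∀ k, ContDiffAt ℝ ∞ (vecHat x X k) (extChartAt (𝓡 d) x y)) :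
    MDifferentiableAt (𝓡 d) (𝓡 d).tangent (fun w => (⟨w, X w⟩ : TangentBundle (𝓡 d) M)) y :=
  ((contMDiffAt_section_iff_vecHat (n := ⊤) hy).2 h).mdifferentiableAt (by simp)

theorem vecHat_coordField {x : M} {z : Model d} (hz : z ∈ (extChartAt (𝓡 d) x).target)
    (i k : Fin d) : vecHat x (coordField x i) k z = if k = i then 1 else 0 :=
  coordForm_coordField ((extChartAt (𝓡 d) x).map_target hz) k i

theorem contDiffAt_vecHat_coordField {x : M} {z : Model d}
    (hz : z ∈ (extChartAt (𝓡 d) x).target) (i k : Fin d) :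
    ContDiffAt ℝ ∞ (vecHat x (coordField x i) k) z := by
  refine (contDiffAt_const (c := if k = i then (1 : ℝ) else 0)).congr_of_eventuallyEq ?_
  filter_upwards [extChartAt_target_mem_nhds_of_mem hz] with w hw
  exact vecHat_coordField hw i k

theorem pd_vecHat_coordField {x : M} {z : Model d} (hz : z ∈ (extChartAt (𝓡 d) x).target)
    (i j k : Fin d) : pd (frame d) j (vecHat x (coordField x i) k) z = 0 := by
  have : vecHat x (coordField x i) k =ᶠ[𝓝 z] fun _ => if k = i then (1 : ℝ) else 0 := by
    filter_upwards [extChartAt_target_mem_nhds_of_mem hz] with w hw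
    exact vecHat_coordField hw i k
  rw [pd, this.fderiv_eq]
  simp

theorem mdifferentiableAt_coordField {x y : M} (hy : y ∈ (extChartAt (𝓡 d) x).source)
    (i : Fin d) :
    MDifferentiableAt (𝓡 d) (𝓡 d).tangent
      (fun w => (⟨w, coordField x i w⟩ : TangentBundle (𝓡 d) M)) y :=
  mdifferentiableAt_section_of_vecHat hy
    fun k => contDiffAt_vecHat_coordField ((extChartAt (𝓡 d) x).map_source hy) i k

/-! #### Lie brackets -/

theorem isInvertible_chartDeriv {x y : M} (hy : y ∈ (extChartAt (𝓡 d) x).source) :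
    (chartDeriv (d := d) x y).IsInvertible := isInvertible_mfderiv_extChartAt (I := 𝓡 d) hy

omit [IsManifold (𝓡 d) ∞ M] in
theorem mpullback_chart (x y : M) (V : Model d → Model d) :
    mpullback (𝓡 d) 𝓘(ℝ, Model d) (extChartAt (𝓡 d) x) V y
      = (chartDeriv x y).inverse (V (extChartAt (𝓡 d) x y)) := rfl

theorem fderiv_eq_sum_pd (F : Model d → 𝕜) (z v : Model d) :
    fderiv ℝ F z v = ∑ i, ((v i : ℝ) : 𝕜) * pd (frame d) i F z := by
  have := (EuclideanSpace.basisFun (Fin d) ℝ).sum_repr v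
  simp only [EuclideanSpace.basisFun_repr, EuclideanSpace.basisFun_apply] at this
  conv_lhs => rw [← this, map_sum]
  simp [RCLike.real_smul_eq_coe_mul, pd, frame]

omit [IsManifold (𝓡 d) ∞ M] in
theorem fderiv_vecField {x : M} {X : (y : M) → TangentSpace (𝓡 d) y} {z : Model d}
    (h : ∀ k, ContDiffAt ℝ 1 (vecHat x X k) z) (v : Model d) (k : Fin d) :
    fderiv ℝ (vecField x X) z v k = ∑ i, v i * pd (frame d) i (vecHat x X k) z := by
  have hd : DifferentiableAt ℝ (vecField x X) z :=
    (contDiffAt_vecField h).differentiableAt one_ne_zero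
  have := ((EuclideanSpace.proj k : Model d →L[ℝ] ℝ).hasFDerivAt.comp z hd.hasFDerivAt).fderiv
  have h' := fderiv_eq_sum_pd (𝕜 := ℝ) (vecHat x X k) z v
  rw [← show fderiv ℝ (vecHat x X k) z v = fderiv ℝ (vecField x X) z v k from
    congrArg (fun L : Model d →L[ℝ] ℝ => L v) this, h']
  rfl

theorem mlieBracket_model (V W : Model d → Model d) (z : Model d) :
    mlieBracket 𝓘(ℝ, Model d) V W z = lieBracket ℝ V W z :=
  (congrFun mlieBracketWithin_univ z).symm.trans
    ((congrFun mlieBracketWithin_eq_lieBracketWithin z).trans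
      (congrFun lieBracketWithin_univ z))

/-- The Lie bracket is natural under pull-back by the chart, which leaves the bracket of two vector
fields on the model space. -/
theorem coordForm_mlieBracket {x y : M} (hy : y ∈ (extChartAt (𝓡 d) x).source)
    {X Y : (y : M) → TangentSpace (𝓡 d) y}
    (hX : ∀ k, ContDiffAt ℝ 1 (vecHat x X k) (extChartAt (𝓡 d) x y))
    (hY : ∀ k, ContDiffAt ℝ 1 (vecHat x Y k) (extChartAt (𝓡 d) x y)) (k : Fin d) :
    coordForm x k y (mlieBracket (𝓡 d) X Y y)
      = Jet.lie (pd (frame d)) (vecHat x X) (vecHat x Y) k (extChartAt (𝓡 d) x y) := by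
  have hpull : ∀ Z : (y : M) → TangentSpace (𝓡 d) y,
      Z =ᶠ[𝓝 y] mpullback (𝓡 d) 𝓘(ℝ, Model d) (extChartAt (𝓡 d) x) (vecField x Z) := by
    intro Z
    filter_upwards [extChartAt_source_mem_nhds_of_mem hy] with w hw
    refine Eq.trans ?_ (mpullback_chart x w (vecField x Z)).symm
    rw [← chartDeriv_eq_vecField hw Z]
    exact ((isInvertible_chartDeriv hw).inverse_apply_self (Z w)).symm
  have hmd : ∀ Z : (y : M) → TangentSpace (𝓡 d) y,
      (∀ k, ContDiffAt ℝ 1 (vecHat x Z k) (extChartAt (𝓡 d) x y)) →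
      MDifferentiableAt 𝓘(ℝ, Model d) 𝓘(ℝ, Model d).tangent
        (fun z => (⟨z, vecField x Z z⟩ : TangentBundle 𝓘(ℝ, Model d) (Model d)))
        (extChartAt (𝓡 d) x y) := fun Z hZ =>
    (contMDiffAt_vectorSpace_iff_contDiffAt.2 (contDiffAt_vecField hZ)).mdifferentiableAt one_ne_zero
  have : IsManifold (𝓡 d) (minSmoothness ℝ 2) M := by
    rw [minSmoothness_of_isRCLikeNormedField]; infer_instance
  have hpb := mpullback_mlieBracket (n := ∞) (hmd X hX) (hmd Y hY) (contMDiffAt_chart hy)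
    (by rw [minSmoothness_of_isRCLikeNormedField]; norm_cast)
  rw [(hpull X).mlieBracket_vectorField_eq (hpull Y), ← hpb, coordForm_apply hy]
  have h := (isInvertible_chartDeriv hy).self_apply_inverse
    (mlieBracket 𝓘(ℝ, Model d) (vecField x X) (vecField x Y) (extChartAt (𝓡 d) x y))
  refine (congrArg (fun v : Model d => v k) h).trans ?_
  refine (congrArg (fun v : Model d => v k) (mlieBracket_model _ _ _)).trans ?_
  refine (congrArg₂ (· - ·) (fderiv_vecField hY (vecField x X (extChartAt (𝓡 d) x y)) k)
    (fderiv_vecField hX (vecField x Y (extChartAt (𝓡 d) x y)) k)).trans ?_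
  rw [← Finset.sum_sub_distrib, Jet.lie, Finset.sum_apply]
  rfl

/-! #### Covariant derivatives -/

theorem nabla_sum (nabla : Connection d M) {ι : Type*} (s : Finset ι)
    {V : ι → (y : M) → TangentSpace (𝓡 d) y} {y : M}
    (hV : ∀ i, MDifferentiableAt (𝓡 d) (𝓡 d).tangent
      (fun w => (⟨w, V i w⟩ : TangentBundle (𝓡 d) M)) y) :
    nabla (fun w => ∑ i ∈ s, V i w) y = ∑ i ∈ s, nabla (V i) y := by
  classical
  induction s using Finset.induction_on with
  | empty =>
    simp only [Finset.sum_empty]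
    exact congrFun nabla.zero y
  | insert a s ha ih =>
    have h : (fun w => ∑ i ∈ insert a s, V i w) = V a + fun w => ∑ i ∈ s, V i w := by
      funext w
      rw [Finset.sum_insert ha]; rfl
    rw [h, Finset.sum_insert ha, ← ih]
    exact nabla.isCovariantDerivativeOnUniv.add (hV a)
      (MDifferentiableAt.sum_section fun i _ => hV i)

theorem coordForm_nabla_coordField (nabla : Connection d M) {x y : M}
    (hy : y ∈ (extChartAt (𝓡 d) x).source) (v : TangentSpace (𝓡 d) y) (b c : Fin d) :
    coordForm x c y (nabla (coordField x b) y v) = ∑ a, coordForm x a y v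
      * chHat nabla x c a b (extChartAt (𝓡 d) x y) := by
  conv_lhs => rw [← sum_coordForm_smul_coordField hy v]
  simp only [map_sum, map_smul, smul_eq_mul, chHat_chart hy]

theorem coordForm_nabla (nabla : Connection d M) {x y : M}
    (hy : y ∈ (extChartAt (𝓡 d) x).source) {V : (y : M) → TangentSpace (𝓡 d) y}
    (hV : ∀ k, ContDiffAt ℝ ∞ (vecHat x V k) (extChartAt (𝓡 d) x y))
    (v : TangentSpace (𝓡 d) y) (c : Fin d) :
    coordForm x c y (nabla V y v) = mvfderiv (𝓡 d) (fun w => coordForm x c w (V w)) y v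
      + ∑ b, ∑ a, coordForm x b y (V y) * coordForm x a y v
        * chHat nabla x c a b (extChartAt (𝓡 d) x y) := by
  have hf : ∀ b, MDifferentiableAt (𝓡 d) 𝓘(ℝ, ℝ) (fun w => coordForm x b w (V w)) y := by
    intro b
    have : ContMDiffAt (𝓡 d) 𝓘(ℝ, ℝ) ∞ (vecHat x V b ∘ extChartAt (𝓡 d) x) y :=
      (hV b).contMDiffAt.comp y (contMDiffAt_chart hy)
    refine (this.congr_of_eventuallyEq ?_).mdifferentiableAt (by simp)
    filter_upwards [extChartAt_source_mem_nhds_of_mem hy] with w hw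
    exact (vecHat_chart hw V b).symm
  have hs : ∀ b, MDifferentiableAt (𝓡 d) (𝓡 d).tangent (fun w =>
      (⟨w, ((fun w => coordForm x b w (V w)) • coordField x b) w⟩ : TangentBundle (𝓡 d) M)) y :=
    fun b => MDifferentiableAt.smul_section (hf b) (mdifferentiableAt_coordField hy b)
  -- A covariant derivative is local, so `V` may be replaced by its expansion in the coordinate
  -- frame, which equals `V` only on the domain of the chart.
  have h₁ : nabla V y
      = nabla (fun w => ∑ b, ((fun w => coordForm x b w (V w)) • coordField x b) w) y := by
    refine nabla.isCovariantDerivativeOnUniv.congr_of_eventuallyEq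
      (mdifferentiableAt_section_of_vecHat hy hV)
      (MDifferentiableAt.sum_section fun i _ => hs i) univ_mem ?_
    filter_upwards [extChartAt_source_mem_nhds_of_mem hy] with w hw
    exact (sum_coordForm_smul_coordField hw (V w)).symm
  rw [h₁, nabla_sum nabla _ hs]
  have h₂ : ∀ b, coordForm x c y (nabla ((fun w => coordForm x b w (V w)) • coordField x b) y v)
      = coordForm x b y (V y) * ∑ a, coordForm x a y v
          * chHat nabla x c a b (extChartAt (𝓡 d) x y)
        + mvfderiv (𝓡 d) (fun w => coordForm x b w (V w)) y v * if c = b then 1 else 0 := by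
    intro b
    rw [← coordForm_nabla_coordField nabla hy, ← coordForm_coordField hy c b]
    have := nabla.isCovariantDerivativeOnUniv.leibniz (mdifferentiableAt_coordField hy b) (hf b)
    rw [show nabla.toFun ((fun w => coordForm x b w (V w)) • coordField x b) y = _ from this]
    simp
  rw [sum_apply, map_sum, Finset.sum_congr rfl fun b _ => h₂ b,
    Finset.sum_add_distrib, add_comm]
  simp [Finset.mul_sum, mul_assoc]

end Chart

/-! ### Coordinate expressions of the bidifferential operators -/

open Filter Topology VectorField

noncomputable section Chart

variable {d : ℕ} {M : Type*} [TopologicalSpace M] [ChartedSpace (Model d) M]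
  [IsManifold (𝓡 d) ∞ M] {𝕜 : Type*} [RCLike 𝕜]

theorem eventually_contDiffAt_one {V : Type*} [NormedAddCommGroup V] [NormedSpace ℝ V]
    {F : V → ℝ} {z : V} (h : ContDiffAt ℝ ∞ F z) : ∀ᶠ w in 𝓝 z, ContDiffAt ℝ 1 F w :=
  (h.of_le (by norm_cast)).eventually (by simp)

theorem lieComp_eq (nabla : Connection d M) (x : M)
    (hΓ : SmoothGerm.SmoothChristoffel (chHat nabla x) (extChartAt (𝓡 d) x x))
    {X : (y : M) → TangentSpace (𝓡 d) y}
    (hX : ∀ k, ContDiffAt ℝ ∞ (vecHat x X k) (extChartAt (𝓡 d) x x)) (j k l : Fin d) :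
    lieComp nabla X x j k l = Jet.lieGamma (pd (frame d)) (chHat nabla x) (vecHat x X) j k l
      (extChartAt (𝓡 d) x x) := by
  have hx := mem_extChartAt_source (I := 𝓡 d) x
  have hp := (extChartAt (𝓡 d) x).map_source hx
  set p := extChartAt (𝓡 d) x x with hp_def
  have hX1 : ∀ k, ContDiffAt ℝ 1 (vecHat x X k) p := fun k => (hX k).of_le (by norm_cast)
  -- `[X, ∂_i] = -(∂_i X^c) ∂_c`, the components of `∂_i` being constant.
  have hlie : ∀ i y, y ∈ (extChartAt (𝓡 d) x).source →
      (∀ k, ContDiffAt ℝ 1 (vecHat x X k) (extChartAt (𝓡 d) x y)) → ∀ c,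
      coordForm x c y (mlieBracket (𝓡 d) X (coordField x i) y)
        = - pd (frame d) i (vecHat x X c) (extChartAt (𝓡 d) x y) := by
    intro i y hy h c
    have hy' := (extChartAt (𝓡 d) x).map_source hy
    rw [coordForm_mlieBracket hy h fun k => (contDiffAt_vecHat_coordField hy' i k).of_le
      (by norm_cast), Jet.lie, Finset.sum_apply]
    simp only [Pi.sub_apply, Pi.mul_apply, pd_vecHat_coordField hy', vecHat_coordField hy']
    simp
  -- In the last term of `L_X∇` the field `[X, ∂_l]` is differentiated, so its components must be
  -- known on a neighbourhood and not only at `x`.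
  have hW : ∀ c, vecHat x (fun y => mlieBracket (𝓡 d) X (coordField x l) y) c
      =ᶠ[𝓝 p] - pd (frame d) l (vecHat x X c) := by
    intro c
    filter_upwards [extChartAt_target_mem_nhds_of_mem hp,
      eventually_all.2 fun k => eventually_contDiffAt_one (hX k)] with z hz hz1
    have := hlie l _ ((extChartAt (𝓡 d) x).map_target hz)
    rw [(extChartAt (𝓡 d) x).right_inv hz] at this
    exact this hz1 c
  have hWs : ∀ c, ContDiffAt ℝ ∞ (vecHat x (fun y => mlieBracket (𝓡 d) X (coordField x l) y) c) p :=
    fun c => (SmoothGerm.contDiffAt_fderiv_apply (hX c) (frame d l)).neg.congr_of_eventuallyEq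
      (hW c)
  have t₁ : coordForm x j x (mlieBracket (𝓡 d) X
      (fun y => nabla (coordField x l) y (coordField x k y)) x)
      = Jet.lie (pd (frame d)) (vecHat x X) (fun m => chHat nabla x m k l) j p :=
    coordForm_mlieBracket hx hX1 (fun m => (hΓ m k l).of_le (by norm_cast)) j
  have t₂ : coordForm x j x (nabla (coordField x l) x (mlieBracket (𝓡 d) X (coordField x k) x))
      = ∑ a, - pd (frame d) k (vecHat x X a) p * chHat nabla x j a l p := by
    rw [coordForm_nabla_coordField nabla hx]
    exact Finset.sum_congr rfl fun a _ => by rw [hlie k x hx hX1]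
  have t₃ : coordForm x j x (nabla (fun y => mlieBracket (𝓡 d) X (coordField x l) y) x
      (coordField x k x)) = - pd (frame d) k (pd (frame d) l (vecHat x X j)) p
        + ∑ b, - pd (frame d) l (vecHat x X b) p * chHat nabla x j k b p := by
    rw [coordForm_nabla nabla hx hWs, mvfderiv_coordField_read hx]
    congr 1
    · change fderiv ℝ (vecHat x (fun y => mlieBracket (𝓡 d) X (coordField x l) y) j) p _ = _
      rw [(hW j).fderiv_eq, fderiv_neg]
      rfl
    · refine Finset.sum_congr rfl fun b _ => ?_
      rw [hlie l x hx hX1]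
      simp only [coordForm_coordField hx]
      simp only [mul_ite, mul_one, mul_zero, ite_mul, zero_mul, Finset.sum_ite_eq',
        Finset.mem_univ, if_true]
      rfl
  rw [lieComp, lieConnection, ← coordForm_self, map_sub, map_sub, t₁, t₂, t₃, Jet.lieGamma,
    Jet.lie]
  simp only [Pi.add_apply, Finset.sum_apply, Pi.sub_apply, Pi.mul_apply, Finset.sum_add_distrib,
    Finset.sum_sub_distrib, neg_mul, Finset.sum_neg_distrib]
  simp only [mul_comm (chHat nabla x j _ l p), mul_comm (chHat nabla x j k _ p)]
  ring

omit [IsManifold (𝓡 d) ∞ M] in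
theorem eq_sum_coordAt {y : M} (α : TangentSpace (𝓡 d) y →L[ℝ] ℝ) :
    α = ∑ i, α (partialAt y i) • coordAt y i := by
  refine ContinuousLinearMap.ext fun v => ?_
  have := (EuclideanSpace.basisFun (Fin d) ℝ).sum_repr v
  simp only [EuclideanSpace.basisFun_apply] at this
  have h : ∑ i, (coordAt y i v) • partialAt y i = v := this
  conv_lhs => rw [← h]
  rw [map_sum, sum_apply]
  simp [mul_comm]

theorem mvfderiv_eq_sum_coordForm {x y : M} (hy : y ∈ (extChartAt (𝓡 d) x).source) (f : M → ℝ) :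
    mvfderiv (𝓡 d) f y
      = ∑ i, pd (frame d) i (read x f) (extChartAt (𝓡 d) x y) • coordForm x i y := by
  refine ContinuousLinearMap.ext fun v => ?_
  rw [mvfderiv_eq_sum hy, sum_apply]
  refine Finset.sum_congr rfl fun i _ => ?_
  rw [smul_apply, smul_eq_mul, smul_eq_mul, mul_comm]
  rfl

theorem coordForm_ham (P : TwoTensor d M) {x y : M} (hy : y ∈ (extChartAt (𝓡 d) x).source)
    (f : M → ℝ) (k : Fin d) :
    coordForm x k y (ham P f y)
      = Jet.ham (pd (frame d)) (bivHat x P) (read x f) k (extChartAt (𝓡 d) x y) := by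
  have h₁ : coordForm x k y (ham P f y) = P y (mvfderiv (𝓡 d) f y) (coordForm x k y) := by
    conv_rhs => rw [eq_sum_coordAt (coordForm x k y)]
    simp only [ham, map_sum, map_smul, smul_eq_mul, mul_comm]
  rw [h₁, mvfderiv_eq_sum_coordForm hy, Jet.ham, Finset.sum_apply, map_sum, LinearMap.sum_apply]
  refine Finset.sum_congr rfl fun i _ => ?_
  rw [map_smul, LinearMap.smul_apply, smul_eq_mul, Pi.mul_apply, bivHat_chart hy, mul_comm]

theorem vecHat_ham (P : TwoTensor d M) {x : M} {z : Model d}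
    (hz : z ∈ (extChartAt (𝓡 d) x).target) (f : M → ℝ) (k : Fin d) :
    vecHat x (ham P f) k z = Jet.ham (pd (frame d)) (bivHat x P) (read x f) k z := by
  have := coordForm_ham P ((extChartAt (𝓡 d) x).map_target hz) f k
  rwa [(extChartAt (𝓡 d) x).right_inv hz] at this

/-- The components of a contravariant tensor in the chart around `x`, in the field `𝕜`. -/
def bivHatK (𝕜 : Type*) [RCLike 𝕜] (x : M) (P : TwoTensor d M) :
    Matrix (Fin d) (Fin d) (Model d → 𝕜) := (bivHat x P).map (ofRealFun 𝕜 _)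

/-- The Christoffel symbols in the chart around `x`, in the field `𝕜`. -/
def chHatK (𝕜 : Type*) [RCLike 𝕜] (nabla : Connection d M) (x : M) (i k l : Fin d) :
    Model d → 𝕜 := ofRealFun 𝕜 _ (chHat nabla x i k l)

/-- The components of a vector field in the chart around `x`, in the field `𝕜`. -/
def vecHatK (𝕜 : Type*) [RCLike 𝕜] (x : M) (X : (y : M) → TangentSpace (𝓡 d) y) (k : Fin d) :
    Model d → 𝕜 := ofRealFun 𝕜 _ (vecHat x X k)

omit [IsManifold (𝓡 d) ∞ M] in
theorem coe_bivHat_eq_sum (P : TwoTensor d M) {x y : M} (hy : y ∈ (extChartAt (𝓡 d) x).source)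
    (a b : Fin d) : bivHatK 𝕜 x P a b (extChartAt (𝓡 d) x y) = ∑ i, ∑ j, (comp P y i j : 𝕜)
      * (coordForm x a y (partialAt y i) : 𝕜) * (coordForm x b y (partialAt y j) : 𝕜) := by
  have : bivHat x P a b (extChartAt (𝓡 d) x y) = ∑ i, ∑ j, comp P y i j
      * coordForm x a y (partialAt y i) * coordForm x b y (partialAt y j) := by
    rw [bivHat_chart hy]
    conv_lhs => rw [eq_sum_coordAt (coordForm x a y), eq_sum_coordAt (coordForm x b y)]
    simp only [map_sum, map_smul, LinearMap.sum_apply, LinearMap.smul_apply, smul_eq_mul, comp,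
      Finset.mul_sum]
    rw [Finset.sum_comm]
    refine Finset.sum_congr rfl fun i _ => Finset.sum_congr rfl fun j _ => ?_
    ring
  rw [bivHatK, Matrix.map_apply, ofRealFun_apply, this]
  push_cast
  rfl

/-- By definition the bracket at `y` is computed in the preferred chart around `y`. To differentiate
it near `x`, one fixed chart must serve for all nearby `y`. -/
theorem bracket_eq_chart (P : TwoTensor d M) {x y : M} (hy : y ∈ (extChartAt (𝓡 d) x).source)
    (f g : M → 𝕜) :
    bracket P f g y = Jet.bracket (pd (frame d)) (bivHatK 𝕜 x P) (read x f) (read x g)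
      (extChartAt (𝓡 d) x y) := by
  have h : ∀ (f : M → 𝕜) i, mvfderiv (𝓡 d) f y (partialAt y i)
      = ∑ a, (coordForm x a y (partialAt y i) : 𝕜)
        * pd (frame d) a (read x f) (extChartAt (𝓡 d) x y) := by
    intro f i
    rw [mvfderiv_eq_sum hy]
    exact Finset.sum_congr rfl fun a _ => RCLike.real_smul_eq_coe_mul _ _
  simp only [bracket, Jet.bracket, Finset.sum_apply, Pi.mul_apply, coe_bivHat_eq_sum P hy, h,
    Finset.mul_sum, Finset.sum_mul]
  calc _ = ∑ i, ∑ j, ∑ a, ∑ b, (comp P y i j : 𝕜) * (coordForm x a y (partialAt y i) : 𝕜)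
        * (coordForm x b y (partialAt y j) : 𝕜)
        * pd (frame d) a (read x f) (extChartAt (𝓡 d) x y)
        * pd (frame d) b (read x g) (extChartAt (𝓡 d) x y) := by
        refine Finset.sum_congr rfl fun i _ => Finset.sum_congr rfl fun j _ => ?_
        rw [Finset.sum_comm]
        refine Finset.sum_congr rfl fun i _ => Finset.sum_congr rfl fun j _ => ?_
        ring
    _ = ∑ i, ∑ a, ∑ j, ∑ b, (comp P y i j : 𝕜) * (coordForm x a y (partialAt y i) : 𝕜)
        * (coordForm x b y (partialAt y j) : 𝕜)
        * pd (frame d) a (read x f) (extChartAt (𝓡 d) x y)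
        * pd (frame d) b (read x g) (extChartAt (𝓡 d) x y) :=
        Finset.sum_congr rfl fun i _ => Finset.sum_comm
    _ = ∑ a, ∑ i, ∑ b, ∑ j, (comp P y i j : 𝕜) * (coordForm x a y (partialAt y i) : 𝕜)
        * (coordForm x b y (partialAt y j) : 𝕜)
        * pd (frame d) a (read x f) (extChartAt (𝓡 d) x y)
        * pd (frame d) b (read x g) (extChartAt (𝓡 d) x y) := by
        rw [Finset.sum_comm]
        exact Finset.sum_congr rfl fun i _ => Finset.sum_congr rfl fun j _ => Finset.sum_comm
    _ = _ := Finset.sum_congr rfl fun i _ => Finset.sum_comm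

end Chart

/-! ### The second-order operator as a sum of traces. -/

namespace Jet

open Matrix

section

variable {ι R : Type*} [Fintype ι] [CommRing R]

/-- The covariant derivative of a bivector. -/
def nablaBivector (D : ι → R → R) (Γ : ι → ι → ι → R) (P : Matrix ι ι R) (k i j : ι) : R :=
  D k (P i j) + ∑ m, (Γ i k m * P m j + Γ j k m * P i m)

/-- The contraction of a tensor with a covector. -/
def contract (N : ι → ι → ι → R) (f : ι → R) : Matrix ι ι R :=
  .of fun j k => ∑ i, N j i k * f i

variable {D : ι → Derivation ℤ R R} {Γ : ι → ι → ι → R} {P : Matrix ι ι R}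

/-- By Leibniz, the derivative falls on `P` or on `df`. The Christoffel terms completing `∂P` to
`∇P` in its first upper index cancel against those in the Hessian. -/
theorem cov_ham (f : R) :
    cov (fun i => D i) Γ (ham (fun i => D i) P f)
      = contract (nablaBivector (fun i => D i) Γ P) (fun i => D i f)
        + hess (fun i => D i) Γ f * P := by
  ext j k
  have h₁ : ∑ i, (∑ m, Γ i j m * P m k) * D i f = ∑ i, (∑ m, Γ m j i * D m f) * P i k := by
    simp only [Finset.sum_mul]
    rw [Finset.sum_comm]
    refine Finset.sum_congr rfl fun i _ => Finset.sum_congr rfl fun m _ => ?_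
    ring
  have h₂ : ∑ m, Γ k j m * ∑ i, P i m * D i f = ∑ i, (∑ m, Γ k j m * P i m) * D i f := by
    simp only [Finset.sum_mul, Finset.mul_sum]
    rw [Finset.sum_comm]
    refine Finset.sum_congr rfl fun i _ => Finset.sum_congr rfl fun m _ => ?_
    ring
  simp only [cov, ham, contract, hess, nablaBivector, Matrix.add_apply, Matrix.mul_apply,
    Matrix.of_apply, map_sum, Derivation.leibniz, smul_eq_mul, add_mul, sub_mul,
    Finset.sum_add_distrib, Finset.sum_sub_distrib]
  rw [h₁, h₂]
  simp only [mul_comm (P _ k), mul_comm (D _ f) (D _ _)]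
  ring

theorem nablaBivector_skew (hP : ∀ i j, P i j = -P j i) (k i j : ι) :
    nablaBivector (fun i => D i) Γ P k i j = -nablaBivector (fun i => D i) Γ P k j i := by
  have h₁ : ∀ m, Γ i k m * P m j + Γ j k m * P i m = -(Γ j k m * P m i + Γ i k m * P j m) := by
    intro m
    rw [hP m j, hP i m]; ring
  simp only [nablaBivector]
  rw [Finset.sum_congr rfl fun m _ => h₁ m, Finset.sum_neg_distrib, hP i j, map_neg]
  ring

theorem hess_symm (hD : ∀ i j a, D i (D j a) = D j (D i a)) (hΓ : ∀ i k l, Γ i k l = Γ i l k)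
    (f : R) (k l : ι) :
    hess (fun i => D i) Γ f k l = hess (fun i => D i) Γ f l k := by
  simp only [hess, Matrix.of_apply, hD k l, hΓ _ k l]

/-- Applied with `c` the imaginary unit, to assemble the real and imaginary parts of a complex
function. -/
theorem ham_const_mul {c : R} (hc : ∀ i, D i c = 0) (f : R) :
    ham (fun i => D i) P (c * f) = fun k => c * ham (fun i => D i) P f k := by
  funext k
  simp only [ham, Derivation.leibniz, hc, smul_eq_mul, mul_zero, add_zero, Finset.mul_sum]
  exact Finset.sum_congr rfl fun i _ => by ring

theorem lieGamma_const_mul {c : R} (hc : ∀ i, D i c = 0) (X : ι → R) (j k l : ι) :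
    lieGamma (fun i => D i) Γ (fun k => c * X k) j k l
      = c * lieGamma (fun i => D i) Γ X j k l := by
  simp only [lieGamma, Derivation.leibniz, hc, smul_eq_mul, mul_zero, add_zero, mul_add,
    Finset.mul_sum]
  congr 1
  exact Finset.sum_congr rfl fun i _ => by ring

end

section

variable {ι K : Type*} [Fintype ι] [Field K] [CharZero K]

/-- On expanding the right-hand side, `tr(HPGP)` occurs three times, each of `tr(HP·Ng)` and
`tr(GP·Nf)` twice, and `tr(Nf·Ng)` once. With the factor `-1/6` this explains the coefficients
`1/2`, `1/3` and `-1/6`; the signs of the first two come from transposing one skew factor. -/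
theorem sum_eq_trace {P H G : Matrix ι ι K} {N : ι → ι → ι → K} (f g : ι → K)
    (hP : ∀ i j, P i j = -P j i) (hH : ∀ i j, H i j = H j i)
    (hG : ∀ i j, G i j = G j i) (hN : ∀ k i j, N k i j = -N k j i) :
    ∑ k, ∑ l, ∑ r, ∑ s, (1 / 2 * P k r * P l s * H k l * G r s
        + 1 / 3 * P k r * N r l s * (H k l * g s + f s * G k l)
        - 1 / 6 * N l k r * N k l s * f r * g s)
      = -(1 / 6) * (trace₃ H P (contract N g + G * P) + trace₃ G P (contract N f + H * P)
        + ((contract N f + H * P) * (contract N g + G * P)).trace) := by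
  have swap (F : ι → ι → ι → ι → K) :
      ∑ k, ∑ l, ∑ r, ∑ s, F k l r s = ∑ l, ∑ r, ∑ k, ∑ s, F k l r s := by
    rw [Finset.sum_comm]
    exact Finset.sum_congr rfl fun l _ => Finset.sum_comm
  have e₁ : ∑ k, ∑ l, ∑ r, ∑ s, P k r * P l s * H k l * G r s = -(H * P * (G * P)).trace := by
    rw [swap, Matrix.trace, ← Finset.sum_neg_distrib]
    refine Finset.sum_congr rfl fun l _ => ?_
    rw [Matrix.diag_apply, Matrix.mul_apply, ← Finset.sum_neg_distrib]
    refine Finset.sum_congr rfl fun r _ => ?_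
    rw [Matrix.mul_apply, Matrix.mul_apply, Finset.sum_mul_sum, ← Finset.sum_neg_distrib]
    refine Finset.sum_congr rfl fun k _ => ?_
    rw [← Finset.sum_neg_distrib]
    refine Finset.sum_congr rfl fun s _ => ?_
    rw [hP l s, hH k l]
    ring
  have e₂ (H : Matrix ι ι K) (g : ι → K) (hH : ∀ i j, H i j = H j i) :
      ∑ k, ∑ l, ∑ r, ∑ s, P k r * N r l s * H k l * g s = -(H * P * contract N g).trace := by
    rw [swap, Matrix.trace, ← Finset.sum_neg_distrib]
    refine Finset.sum_congr rfl fun l _ => ?_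
    rw [Matrix.diag_apply, Matrix.mul_apply, ← Finset.sum_neg_distrib]
    refine Finset.sum_congr rfl fun r _ => ?_
    rw [Matrix.mul_apply, contract, Matrix.of_apply, Finset.sum_mul_sum, ← Finset.sum_neg_distrib]
    refine Finset.sum_congr rfl fun k _ => ?_
    rw [← Finset.sum_neg_distrib]
    refine Finset.sum_congr rfl fun s _ => ?_
    rw [hN r l s, hH k l]
    ring
  have e₃ : ∑ k, ∑ l, ∑ r, ∑ s, N l k r * N k l s * f r * g s
      = (contract N f * contract N g).trace := by
    rw [Finset.sum_comm, Matrix.trace]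
    refine Finset.sum_congr rfl fun l _ => ?_
    rw [Matrix.diag_apply, Matrix.mul_apply]
    refine Finset.sum_congr rfl fun k _ => ?_
    simp only [contract, Matrix.of_apply]
    rw [Finset.sum_mul_sum]
    refine Finset.sum_congr rfl fun r _ => Finset.sum_congr rfl fun s _ => ?_
    rw [hN l k r, hN k l s]
    ring
  have e₄ : (G * P * (H * P)).trace = (H * P * (G * P)).trace := Matrix.trace_mul_comm _ _
  have e₅ : (contract N f * (G * P)).trace = (G * P * contract N f).trace :=
    Matrix.trace_mul_comm _ _
  have e₆ : ∑ k, ∑ l, ∑ r, ∑ s, (1 / 2 * P k r * P l s * H k l * G r s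
        + 1 / 3 * P k r * N r l s * (H k l * g s + f s * G k l)
        - 1 / 6 * N l k r * N k l s * f r * g s)
      = 1 / 2 * ∑ k, ∑ l, ∑ r, ∑ s, P k r * P l s * H k l * G r s
        + 1 / 3 * ∑ k, ∑ l, ∑ r, ∑ s, P k r * N r l s * H k l * g s
        + 1 / 3 * ∑ k, ∑ l, ∑ r, ∑ s, P k r * N r l s * G k l * f s
        - 1 / 6 * ∑ k, ∑ l, ∑ r, ∑ s, N l k r * N k l s * f r * g s := by
    simp only [Finset.mul_sum, ← Finset.sum_add_distrib, ← Finset.sum_sub_distrib]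
    refine Finset.sum_congr rfl fun k _ => Finset.sum_congr rfl fun l _ =>
      Finset.sum_congr rfl fun r _ => Finset.sum_congr rfl fun s _ => ?_
    ring
  rw [e₆, e₁, e₂ H g hH, e₂ G f hG, e₃]
  simp only [trace₃, mul_add, add_mul, Matrix.trace_add]
  rw [e₄, e₅]
  field_simp
  ring

end

end Jet

/-! ### Lie derivatives of the connection along Hamiltonian fields of complex functions. -/

open Filter Topology

noncomputable section Chart

open SmoothGerm

variable {d : ℕ} {M : Type*} [TopologicalSpace M] [ChartedSpace (Model d) M]
  [IsManifold (𝓡 d) ∞ M] {𝕜 : Type*} [RCLike 𝕜]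

theorem D_germ_const {V : Type*} [NormedAddCommGroup V] [NormedSpace ℝ V] (z w : V) (c : 𝕜) :
    D w (germ z fun _ => c) = 0 := by
  rw [D_germ contDiffAt_const, germ_eq (by simpa using contDiffAt_const)]
  refine Subtype.ext (Germ.coe_eq.2 (Eventually.of_forall fun z => ?_))
  simp

theorem lieComp_ofReal (nabla : Connection d M) (x : M)
    (hΓ : SmoothChristoffel (chHat nabla x) (extChartAt (𝓡 d) x x))
    {X : (y : M) → TangentSpace (𝓡 d) y}
    (hX : ∀ k, ContDiffAt ℝ ∞ (vecHat x X k) (extChartAt (𝓡 d) x x)) (j k l : Fin d) :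
    (lieComp nabla X x j k l : 𝕜) = Jet.lieGamma (pd (frame d)) (chHatK 𝕜 nabla x)
      (vecHatK 𝕜 x X) j k l (extChartAt (𝓡 d) x x) := by
  rw [lieComp_eq nabla x hΓ hX]
  exact congrFun (Jet.map_lieGamma (ofRealFun 𝕜 (Model d)) (ofRealFun_pd (frame d))
    (chHat nabla x) (vecHat x X) j k l) (extChartAt (𝓡 d) x x)

omit [IsManifold (𝓡 d) ∞ M] in
theorem read_eq_re_add_im (x : M) (f : M → 𝕜) :
    read x f = ofRealFun 𝕜 _ (read (d := d) x fun y => RCLike.re (f y))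
      + (fun _ => (RCLike.I : 𝕜)) * ofRealFun 𝕜 _ (read (d := d) x fun y => RCLike.im (f y)) := by
  funext z
  have := RCLike.re_add_im (read x f z)
  rw [mul_comm] at this
  exact this.symm

/-- The definition splits `f` into real and imaginary parts, the coordinate expression does not.
They agree because `f ↦ L_{X_f}Γ` is additive and commutes with multiplication by constants. -/
theorem lieHam_eq (nabla : Connection d M) (x : M) {P : TwoTensor d M}
    (hΓ : SmoothChristoffel (chHat nabla x) (extChartAt (𝓡 d) x x))
    (hP : SmoothBivector (bivHat x P) (extChartAt (𝓡 d) x x)) {f : M → 𝕜}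
    (hf : ContDiffAt ℝ ∞ (read x f) (extChartAt (𝓡 d) x x)) (j k l : Fin d) :
    lieHam nabla P f x j k l = Jet.lieGamma (pd (frame d)) (chHatK 𝕜 nabla x)
      (Jet.ham (pd (frame d)) (bivHatK 𝕜 x P) (read x f)) j k l (extChartAt (𝓡 d) x x) := by
  have hp := mem_extChartAt_target (I := 𝓡 d) x
  set p := extChartAt (𝓡 d) x x
  have hΓK : SmoothChristoffel (chHatK 𝕜 nabla x) p := fun i k l => contDiffAt_ofRealFun (hΓ i k l)
  have hPK : SmoothBivector (bivHatK 𝕜 x P) p := fun i j => contDiffAt_ofRealFun (hP i j)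
  have hre : ContDiffAt ℝ ∞ (read (d := d) x fun y => RCLike.re (f y)) p :=
    (RCLike.reCLM (K := 𝕜)).contDiff.contDiffAt.comp p hf
  have him : ContDiffAt ℝ ∞ (read (d := d) x fun y => RCLike.im (f y)) p :=
    (RCLike.imCLM (K := 𝕜)).contDiff.contDiffAt.comp p hf
  -- Additivity and the Leibniz rule are available in the ring of smooth germs, so the comparison is
  -- carried out there and evaluated at the end.
  have hval : ∀ F : Model d → 𝕜, ContDiffAt ℝ ∞ F p →
      Jet.lieGamma (pd (frame d)) (chHatK 𝕜 nabla x)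
        (Jet.ham (pd (frame d)) (bivHatK 𝕜 x P) F) j k l p
      = value (Jet.lieGamma (fun i => partials (frame d) p i)
          (fun i k l => germ p (chHatK 𝕜 nabla x i k l))
          (Jet.ham (fun i => partials (frame d) p i) ((bivHatK 𝕜 x P).map (germ p)) (germ p F))
            j k l) := by
    intro F hF
    have h := germ_lieGamma (frame d) hΓK (contDiffAt_ham (frame d) hPK hF) j k l
    simp only [germ_ham (frame d) hPK hF] at h
    rw [← value_germ (contDiffAt_lieGamma (frame d) hΓK (contDiffAt_ham (frame d) hPK hF) j k l)]
    exact congrArg value h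
  have hreal : ∀ u : M → ℝ, ContDiffAt ℝ ∞ (read x u) p → (lieComp nabla (ham P u) x j k l : 𝕜)
      = Jet.lieGamma (pd (frame d)) (chHatK 𝕜 nabla x)
        (Jet.ham (pd (frame d)) (bivHatK 𝕜 x P) (ofRealFun 𝕜 _ (read x u))) j k l p := by
    intro u hu
    have heq : ∀ k, vecHat x (ham P u) k =ᶠ[𝓝 p] Jet.ham (pd (frame d)) (bivHat x P) (read x u) k :=
      fun k => by
        filter_upwards [extChartAt_target_mem_nhds_of_mem hp] with z hz
        exact vecHat_ham P hz u k
    have hs := contDiffAt_ham (frame d) hP hu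
    have hX : ∀ k, ContDiffAt ℝ ∞ (vecHat x (ham P u) k) p := fun k =>
      (hs k).congr_of_eventuallyEq (heq k)
    have hXK : ∀ k, ContDiffAt ℝ ∞ (vecHatK 𝕜 x (ham P u) k) p := fun k =>
      contDiffAt_ofRealFun (hX k)
    rw [lieComp_ofReal nabla x hΓ hX, hval _ (contDiffAt_ofRealFun hu),
      ← value_germ (contDiffAt_lieGamma (frame d) hΓK hXK j k l),
      germ_lieGamma (frame d) hΓK hXK j k l]
    congr 2
    funext k
    rw [← germ_ham (frame d) hPK (contDiffAt_ofRealFun hu)]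
    refine germ_congr ?_
    filter_upwards [heq k] with z hz
    rw [vecHatK, ofRealFun_apply, hz]
    exact congrFun (Jet.map_ham (ofRealFun 𝕜 (Model d)) (ofRealFun_pd (frame d))
      (bivHat x P) (read x u) k) z
  have hI : ∀ i, partials (𝕜 := 𝕜) (frame d) p i (germ p fun _ => (RCLike.I : 𝕜)) = 0 := fun i =>
    D_germ_const p _ _
  have hIs : ContDiffAt ℝ ∞ (fun _ : Model d => (RCLike.I : 𝕜)) p := contDiffAt_const
  have hsplit : germ p (read x f) = germ p (ofRealFun 𝕜 _ (read (d := d) x fun y => RCLike.re (f y)))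
      + germ p (fun _ => (RCLike.I : 𝕜))
        * germ p (ofRealFun 𝕜 _ (read (d := d) x fun y => RCLike.im (f y))) := by
    rw [germ_eq (contDiffAt_ofRealFun hre), germ_eq (contDiffAt_ofRealFun him), germ_eq hIs,
      mk_mul, mk_add, ← germ_eq, ← read_eq_re_add_im]
  rw [lieHam, hreal _ hre, hreal _ him, hval _ hf, hval _ (contDiffAt_ofRealFun hre),
    hval _ (contDiffAt_ofRealFun him), hsplit, Jet.ham_add, Jet.ham_const_mul hI, Jet.lieGamma_add]
  simp only [Pi.add_apply]
  rw [Jet.lieGamma_const_mul hI, map_add, map_mul, value_germ hIs]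

end Chart

/-! ### The bidifferential operators at the centre of the preferred chart. -/

open Filter Topology

noncomputable section Chart

open SmoothGerm

variable {d : ℕ} {M : Type*} [TopologicalSpace M] [ChartedSpace (Model d) M]
  [IsManifold (𝓡 d) ∞ M] {𝕜 : Type*} [RCLike 𝕜]

theorem germ_neg {V : Type*} [NormedAddCommGroup V] [NormedSpace ℝ V] {F : V → 𝕜} {z : V}
    (h : ContDiffAt ℝ ∞ F z) : germ z (-F) = -germ z F :=
  Represents.germ_eq (F := -F) (congrArg Neg.neg (coe_germ h).symm)

theorem coe_comp_eq (P : TwoTensor d M) (x : M) (i j : Fin d) :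
    (comp P x i j : 𝕜) = bivHatK 𝕜 x P i j (extChartAt (𝓡 d) x x) := by
  rw [bivHatK, Matrix.map_apply, ofRealFun_apply, bivHat_chart (mem_extChartAt_source x),
    coordForm_self, coordForm_self]
  rfl

theorem christoffel_eq (nabla : Connection d M) (x : M) (i k l : Fin d) :
    christoffel nabla x i k l = chHat nabla x i k l (extChartAt (𝓡 d) x x) := by
  rw [chHat_chart (mem_extChartAt_source x), coordForm_self, coordField_self]
  rfl

theorem mvfderiv_partialAt_read (x : M) (f : M → 𝕜) (i : Fin d) :
    mvfderiv (𝓡 d) f x (partialAt x i) = pd (frame d) i (read x f) (extChartAt (𝓡 d) x x) :=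
  mvfderiv_partialAt x f i

theorem hess_eq_self (nabla : Connection d M) (x : M) (f : M → 𝕜) (k l : Fin d) :
    hess nabla f x k l = pd (frame d) k (pd (frame d) l (read x f)) (extChartAt (𝓡 d) x x)
      - ∑ m, chHatK 𝕜 nabla x m k l (extChartAt (𝓡 d) x x)
        * pd (frame d) m (read x f) (extChartAt (𝓡 d) x x) := by
  have h : read x (dirDeriv (coordField x l) f)
      =ᶠ[𝓝 (extChartAt (𝓡 d) x x)] pd (frame d) l (read x f) := by
    filter_upwards [extChartAt_target_mem_nhds_of_mem (mem_extChartAt_target (I := 𝓡 d) x)]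
      with z hz
    have := mvfderiv_coordField_read ((extChartAt (𝓡 d) x).map_target hz) f l
    rwa [(extChartAt (𝓡 d) x).right_inv hz] at this
  rw [hess, mvfderiv_partialAt_read, pd, h.fderiv_eq]
  simp only [christoffel_eq, mvfderiv_partialAt_read]
  rfl

theorem coe_nablaP_eq (nabla : Connection d M) (P : TwoTensor d M) (x : M) (k i j : Fin d) :
    (nablaP nabla P x k i j : 𝕜) = pd (frame d) k (bivHatK 𝕜 x P i j) (extChartAt (𝓡 d) x x)
      + ∑ m, (chHatK 𝕜 nabla x i k m (extChartAt (𝓡 d) x x)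
          * bivHatK 𝕜 x P m j (extChartAt (𝓡 d) x x)
        + chHatK 𝕜 nabla x j k m (extChartAt (𝓡 d) x x)
          * bivHatK 𝕜 x P i m (extChartAt (𝓡 d) x x)) := by
  rw [nablaP, mvfderiv_partialAt]
  simp only [← coe_comp_eq, chHatK, ofRealFun_apply, ← christoffel_eq]
  push_cast
  congr 1
  exact (fderiv_ofReal (bivHat x P i j) (extChartAt (𝓡 d) x x) (frame d k)).symm

/-- The smoothness of the coordinate expressions of a connection and a tensor. -/
structure SmoothAt (nabla : Connection d M) (P : TwoTensor d M) (x : M) : Prop where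
  christoffel : SmoothChristoffel (chHat nabla x) (extChartAt (𝓡 d) x x)
  bivector : SmoothBivector (bivHat x P) (extChartAt (𝓡 d) x x)

variable {nabla : Connection d M} {P : TwoTensor d M} {x : M}

theorem SmoothAt.christoffelK (h : SmoothAt nabla P x) :
    SmoothChristoffel (chHatK 𝕜 nabla x) (extChartAt (𝓡 d) x x) :=
  fun i k l => contDiffAt_ofRealFun (h.christoffel i k l)

theorem SmoothAt.bivectorK (h : SmoothAt nabla P x) :
    SmoothBivector (bivHatK 𝕜 x P) (extChartAt (𝓡 d) x x) :=
  fun i j => contDiffAt_ofRealFun (h.bivector i j)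

/-- Hessians, `∇P` and differentials are the values of their germ counterparts, where skewness and
symmetry hold identically. Division by six requires a field, so `Jet.sum_eq_trace` is applied after
evaluation. -/
theorem C₂_eq_self (h : SmoothAt nabla P x) (hskew : ∀ y α β, P y α β = -P y β α)
    (hΓ : ∀ i k l, chHat nabla x i k l =ᶠ[𝓝 (extChartAt (𝓡 d) x x)] chHat nabla x i l k)
    {f g : M → 𝕜} (hf : ContDiffAt ℝ ∞ (read x f) (extChartAt (𝓡 d) x x))
    (hg : ContDiffAt ℝ ∞ (read x g) (extChartAt (𝓡 d) x x)) :
    C₂ nabla P f g x = -(1 / 6) * Jet.c₂ (pd (frame d)) (chHatK 𝕜 nabla x) (bivHatK 𝕜 x P)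
      (read x f) (read x g) (extChartAt (𝓡 d) x x) := by
  have hΓK := h.christoffelK (𝕜 := 𝕜)
  have hPK := h.bivectorK (𝕜 := 𝕜)
  set p := extChartAt (𝓡 d) x x
  set Γg := fun i k l => germ p (chHatK 𝕜 nabla x i k l) with hΓg
  set Pg := (bivHatK 𝕜 x P).map (germ p) with hPg
  set D := fun i => partials (𝕜 := 𝕜) (frame d) p i with hD
  have hPskew : ∀ i j, Pg i j = -Pg j i := by
    intro i j
    have : bivHatK 𝕜 x P i j = -bivHatK 𝕜 x P j i := by
      funext z
      simp only [bivHatK, Matrix.map_apply, Pi.neg_apply, ofRealFun_apply, bivHat, Matrix.of_apply]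
      rw [hskew]
      push_cast
      rfl
    rw [hPg, Matrix.map_apply, Matrix.map_apply, this, germ_neg (hPK j i)]
  have hΓsymm : ∀ i k l, Γg i k l = Γg i l k := fun i k l => germ_congr (by
    filter_upwards [hΓ i k l] with z hz
    simp only [chHatK, ofRealFun_apply, hz])
  have hDD : ∀ i j a, D i (D j a) = D j (D i a) := fun i j a => D_comm _ _ a
  have vP : ∀ i j, (comp P x i j : 𝕜) = value (Pg i j) := fun i j => by
    rw [coe_comp_eq, hPg, Matrix.map_apply, value_germ (hPK i j)]
  have vd : ∀ F : Model d → 𝕜, ContDiffAt ℝ ∞ F p → ∀ i,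
      pd (frame d) i F p = value (D i (germ p F)) := fun F hF i => by
    rw [hD, D_germ hF, value_germ (contDiffAt_fderiv_apply hF _)]
    rfl
  have vh : ∀ f : M → 𝕜, ContDiffAt ℝ ∞ (read x f) p → ∀ k l,
      hess nabla f x k l = value (Jet.hess (fun i => D i) Γg (germ p (read x f)) k l) := by
    intro f hf k l
    rw [hess_eq_self]
    change pd (frame d) k (pd (frame d) l (read x f)) p
      - ∑ m, chHatK 𝕜 nabla x m k l p * pd (frame d) m (read x f) p = _
    rw [vd (pd (frame d) l (read x f)) (contDiffAt_fderiv_apply hf (frame d l))]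
    simp only [Jet.hess, Matrix.of_apply, map_sub, map_sum, map_mul, vd _ hf, hΓg,
      value_germ (hΓK _ _ _)]
    rw [hD, D_germ hf]
    rfl
  have vN : ∀ k i j, (nablaP nabla P x k i j : 𝕜)
      = value (Jet.nablaBivector (fun i => D i) Γg Pg k i j) := by
    intro k i j
    rw [coe_nablaP_eq]
    change pd (frame d) k (bivHatK 𝕜 x P i j) p + ∑ m, (chHatK 𝕜 nabla x i k m p
      * bivHatK 𝕜 x P m j p + chHatK 𝕜 nabla x j k m p * bivHatK 𝕜 x P i m p) = _
    simp only [Jet.nablaBivector, map_add, map_sum, map_mul, hΓg, hPg,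
      Matrix.map_apply, value_germ (hΓK _ _ _), value_germ (hPK _ _), vd _ (hPK i j)]
  have vD : ∀ f : M → 𝕜, ContDiffAt ℝ ∞ (read x f) p → ∀ i,
      mvfderiv (𝓡 d) f x (partialAt x i) = value (D i (germ p (read x f))) := fun f hf i => by
    rw [mvfderiv_partialAt_read, vd _ hf]
  have hc := represents_c₂ (frame d) hΓK hPK hf hg
  rw [← value_germ hc.contDiffAt, hc.germ_eq, Jet.c₂, Jet.cov_ham, Jet.cov_ham]
  simp only [map_add, Jet.map_trace₃, Jet.map_trace, Matrix.map_mul]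
  have hA : ∀ f : M → 𝕜, (Jet.contract (Jet.nablaBivector (fun i => D i) Γg Pg)
        (fun i => D i (germ p (read x f))) + Jet.hess (fun i => D i) Γg (germ p (read x f)) * Pg).map
          value
      = Jet.contract (fun k i j => value (Jet.nablaBivector (fun i => D i) Γg Pg k i j))
          (fun i => value (D i (germ p (read x f))))
        + (Jet.hess (fun i => D i) Γg (germ p (read x f))).map value * Pg.map value := by
    intro f
    rw [← Matrix.map_mul]
    ext i j
    simp only [Matrix.map_apply, Matrix.add_apply, Jet.contract, Matrix.of_apply, map_add, map_sum,
      map_mul]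
  simp only [C₂]
  have key := Jet.sum_eq_trace (P := Pg.map value)
    (H := (Jet.hess (fun i => D i) Γg (germ p (read x f))).map value)
    (G := (Jet.hess (fun i => D i) Γg (germ p (read x g))).map value)
    (N := fun k i j => value (Jet.nablaBivector (fun i => D i) Γg Pg k i j))
    (fun i => value (D i (germ p (read x f)))) (fun i => value (D i (germ p (read x g))))
    (fun i j => by simp only [Matrix.map_apply]; rw [hPskew, map_neg])
    (fun i j => by simp only [Matrix.map_apply]; rw [Jet.hess_symm hDD hΓsymm])
    (fun i j => by simp only [Matrix.map_apply]; rw [Jet.hess_symm hDD hΓsymm])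
    (fun k i j => by rw [Jet.nablaBivector_skew hPskew, map_neg])
  rw [← hA f, ← hA g] at key
  refine Eq.trans ?_ key
  simp only [vP, vh f hf, vh g hg, vN, vD f hf, vD g hg, Matrix.map_apply]

theorem C₃_eq_self (h : SmoothAt nabla P x)
    {f g : M → 𝕜} (hf : ContDiffAt ℝ ∞ (read x f) (extChartAt (𝓡 d) x x))
    (hg : ContDiffAt ℝ ∞ (read x g) (extChartAt (𝓡 d) x x)) :
    C₃ nabla P f g x = -(1 / 6) * Jet.c₃ (pd (frame d)) (chHatK 𝕜 nabla x) (bivHatK 𝕜 x P)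
      (read x f) (read x g) (extChartAt (𝓡 d) x x) := by
  simp only [C₃, lieHam_eq nabla x h.christoffel h.bivector hf,
    lieHam_eq nabla x h.christoffel h.bivector hg, Jet.c₃, Jet.pairing, Finset.sum_apply,
    Pi.mul_apply, coe_comp_eq]

theorem derivCorrection_eq_self (h : SmoothAt nabla P x)
    {X : (y : M) → TangentSpace (𝓡 d) y}
    (hX : ∀ k, ContDiffAt ℝ ∞ (vecHat x X k) (extChartAt (𝓡 d) x x))
    {g : M → 𝕜} (hg : ContDiffAt ℝ ∞ (read x g) (extChartAt (𝓡 d) x x)) :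
    derivCorrection nabla P X g x = -(1 / 6) * Jet.pairing (bivHatK 𝕜 x P)
      (Jet.lieGamma (pd (frame d)) (chHatK 𝕜 nabla x) (vecHatK 𝕜 x X))
      (Jet.lieGamma (pd (frame d)) (chHatK 𝕜 nabla x)
        (Jet.ham (pd (frame d)) (bivHatK 𝕜 x P) (read x g))) (extChartAt (𝓡 d) x x) := by
  simp only [derivCorrection, lieHam_eq nabla x h.christoffel h.bivector hg,
    lieComp_ofReal nabla x h.christoffel hX, Jet.pairing, Finset.sum_apply,
    Pi.mul_apply, coe_comp_eq]

end Chart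

/-! ### Changes of charts -/

open Filter Topology

namespace SmoothGerm

section Represents

variable {𝕜 : Type*} [RCLike 𝕜] {V W : Type*} [NormedAddCommGroup V] [NormedSpace ℝ V]
  [NormedAddCommGroup W] [NormedSpace ℝ W] {z : V} {F G : V → 𝕜} {φ ψ : smoothGerm 𝕜 z}

theorem represents_germ (h : ContDiffAt ℝ ∞ F z) : Represents F (germ z F) := (coe_germ h).symm

theorem Represents.add (hF : Represents F φ) (hG : Represents G ψ) :
    Represents (fun z => F z + G z) (φ + ψ) := congrArg₂ (· + ·) hF hG

theorem Represents.mul (hF : Represents F φ) (hG : Represents G ψ) :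
    Represents (fun z => F z * G z) (φ * ψ) := congrArg₂ (· * ·) hF hG

theorem Represents.sum {ι : Type*} (s : Finset ι) {F : ι → V → 𝕜} {φ : ι → smoothGerm 𝕜 z}
    (h : ∀ i, Represents (F i) (φ i)) : Represents (fun z => ∑ i ∈ s, F i z) (∑ i ∈ s, φ i) := by
  classical
  induction s using Finset.induction_on with
  | empty => simp only [Finset.sum_empty]; rfl
  | insert a s ha ih =>
    simp only [Finset.sum_insert ha]
    exact (h a).add ih

theorem Represents.eq (hF : Represents F φ) (hG : Represents G ψ) (h : F =ᶠ[𝓝 z] G) : φ = ψ :=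
  Subtype.ext (hF.symm.trans ((Germ.coe_eq.2 h).trans hG))

theorem Represents.deriv (hF : Represents F φ) (w : V) :
    Represents (fun z => fderiv ℝ F z w) (D w φ) := by
  rw [← hF.germ_eq, D_germ hF.contDiffAt]
  exact represents_germ (contDiffAt_fderiv_apply hF.contDiffAt w)

theorem Represents.pull {h : W → V} {w : W} (hh : ContDiffAt ℝ ∞ h w)
    {φ : smoothGerm 𝕜 (h w)} (hF : Represents F φ) :
    Represents (F ∘ h) (SmoothGerm.pull h hh φ) := by
  rw [← hF.germ_eq, pull_germ h hh hF.contDiffAt]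
  exact represents_germ (hF.contDiffAt.comp w hh)

theorem Represents.value_eq (hF : Represents F φ) : value φ = F z := by
  rw [← hF.germ_eq, value_germ hF.contDiffAt]

theorem isUnit_of_value_ne_zero (h : value φ ≠ 0) : IsUnit φ := by
  induction φ using ind with
  | h f hf =>
    rw [value_mk] at h
    refine IsUnit.of_mul_eq_one (mk f⁻¹ (hf.inv h)) ?_
    rw [mk_mul]
    refine Subtype.ext (Germ.coe_eq.2 ?_)
    filter_upwards [hf.continuousAt.eventually_ne h] with w hw
    exact mul_inv_cancel₀ hw

/-- A smooth germ with nonzero value has a smooth inverse. Applied to the determinant, this reduces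
invertibility of a Jacobian near a point to invertibility at that point. -/
theorem isUnit_matrix_of_value {ι : Type*} [Fintype ι] [DecidableEq ι]
    {A : Matrix ι ι (smoothGerm 𝕜 z)} (h : IsUnit (A.map value)) : IsUnit A := by
  rw [Matrix.isUnit_iff_isUnit_det] at h ⊢
  apply isUnit_of_value_ne_zero
  rw [RingHom.map_det]
  exact h.ne_zero

end Represents

end SmoothGerm

noncomputable section Chart

open SmoothGerm

variable {d : ℕ} {M : Type*} [TopologicalSpace M] [ChartedSpace (Model d) M]
  [IsManifold (𝓡 d) ∞ M] {𝕜 : Type*} [RCLike 𝕜]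

/-- The coordinate expressions of a connection and a bivector are smooth, and the connection is
torsion-free. -/
structure Regular (nabla : Connection d M) (P : TwoTensor d M) : Prop where
  christoffel : ∀ x, ∀ z ∈ (extChartAt (𝓡 d) x).target, SmoothChristoffel (chHat nabla x) z
  bivector : ∀ x, ∀ z ∈ (extChartAt (𝓡 d) x).target, SmoothBivector (bivHat x P) z
  symm : ∀ x, ∀ z ∈ (extChartAt (𝓡 d) x).target, ∀ i k l,
    chHat nabla x i k l z = chHat nabla x i l k z
  skew : ∀ y α β, P y α β = -P y β α

/-- The coordinate `a` of the chart around `x` in the chart around `y`. -/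
def transition (y x : M) (z : Model d) : Model d :=
  extChartAt (𝓡 d) x ((extChartAt (𝓡 d) y).symm z)

variable {x y : M}

omit [IsManifold (𝓡 d) ∞ M] in
theorem eventually_mem_source (hy : y ∈ (extChartAt (𝓡 d) x).source) :
    ∀ᶠ z in 𝓝 (extChartAt (𝓡 d) y y), z ∈ (extChartAt (𝓡 d) y).target ∧
      (extChartAt (𝓡 d) y).symm z ∈ (extChartAt (𝓡 d) x).source := by
  refine Eventually.and (extChartAt_target_mem_nhds_of_mem (mem_extChartAt_target (I := 𝓡 d) y)) ?_
  refine (continuousAt_extChartAt_symm (I := 𝓡 d) y).eventually ?_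
  rw [extChartAt_to_inv]
  exact extChartAt_source_mem_nhds_of_mem hy

theorem contDiffAt_transition (hy : y ∈ (extChartAt (𝓡 d) x).source) :
    ContDiffAt ℝ ∞ (transition y x) (extChartAt (𝓡 d) y y) := by
  have h₁ := contMDiffAt_chart_symm (mem_extChartAt_target (I := 𝓡 d) y)
  have h₂ : ContMDiffAt (𝓡 d) 𝓘(ℝ, Model d) ∞ (extChartAt (𝓡 d) x)
      ((extChartAt (𝓡 d) y).symm (extChartAt (𝓡 d) y y)) := by
    rw [extChartAt_to_inv]
    exact contMDiffAt_chart hy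
  exact (h₂.comp _ h₁).contDiffAt

omit [IsManifold (𝓡 d) ∞ M] in
theorem transition_self (y x : M) :
    transition y x (extChartAt (𝓡 d) y y) = extChartAt (𝓡 d) x y := by
  rw [transition, extChartAt_to_inv]

/-- The Jacobian matrix of a map, as a matrix of functions. -/
def jac {V : Type*} [NormedAddCommGroup V] [NormedSpace ℝ V] (𝕜 : Type*) [RCLike 𝕜] {ι : Type*}
    (e : ι → V) (h : V → Model d) : ι → Fin d → V → 𝕜 :=
  fun i a => pd e i fun z => ((h z a : ℝ) : 𝕜)

theorem jac_transition {z : Model d} (hz : z ∈ (extChartAt (𝓡 d) y).target) (i a : Fin d) :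
    jac 𝕜 (frame d) (transition y x) i a z
      = (coordForm x a ((extChartAt (𝓡 d) y).symm z)
          (coordField y i ((extChartAt (𝓡 d) y).symm z)) : 𝕜) := by
  have := mvfderiv_coordField ((extChartAt (𝓡 d) y).map_target hz)
    (fun w => (EuclideanSpace.proj a : Model d →L[ℝ] ℝ) (extChartAt (𝓡 d) x w)) i
  rw [(extChartAt (𝓡 d) y).right_inv hz] at this
  rw [coordForm, this, ← fderiv_ofReal]
  rfl

section Jacobian

variable {V : Type*} [NormedAddCommGroup V] [NormedSpace ℝ V] {h : V → Model d} {z : V}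
  {ι : Type*} (e : ι → V)

theorem contDiffAt_coord (hh : ContDiffAt ℝ ∞ h z) (a : Fin d) :
    ContDiffAt ℝ ∞ (fun z => ((h z a : ℝ) : 𝕜)) z :=
  (RCLike.ofRealCLM (K := 𝕜)).contDiff.contDiffAt.comp z (contDiffAt_euclidean.1 hh a)

theorem represents_jac (hh : ContDiffAt ℝ ∞ h z) (i : ι) (a : Fin d) :
    Represents (jac 𝕜 e h i a) (D (e i) (germ z fun z => ((h z a : ℝ) : 𝕜))) :=
  (represents_germ (contDiffAt_coord hh a)).deriv (e i)

theorem D_pull_eq (hh : ContDiffAt ℝ ∞ h z) (w : V) (φ : smoothGerm 𝕜 (h z)) :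
    D w (pull h hh φ) = ∑ a, D w (germ z fun z => ((h z a : ℝ) : 𝕜))
      * pull h hh (D (frame d a) φ) := by
  have heq : ∀ a, (fun z => ((fderiv ℝ h z w a : ℝ) : 𝕜))
      =ᶠ[𝓝 z] fun z => fderiv ℝ (fun z => ((h z a : ℝ) : 𝕜)) z w := by
    intro a
    filter_upwards [eventually_hasFDerivAt hh] with u hu
    rw [fderiv_ofReal]
    have := ((EuclideanSpace.proj a : Model d →L[ℝ] ℝ).hasFDerivAt.comp u hu).fderiv
    exact congrArg (fun L : V →L[ℝ] ℝ => ((L w : ℝ) : 𝕜)) this.symm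
  have hs : ∀ a, ContDiffAt ℝ ∞ (fun z => ((fderiv ℝ h z w a : ℝ) : 𝕜)) z := fun a =>
    (contDiffAt_fderiv_apply (contDiffAt_coord hh a) w).congr_of_eventuallyEq (heq a)
  rw [D_pull h hh w hs]
  refine Finset.sum_congr rfl fun a _ => ?_
  rw [D_germ (contDiffAt_coord hh a), ← germ_eq, germ_congr (heq a)]
  rfl

end Jacobian

theorem sum_coordForm_coordField_mul {w : M}
    (hw : w ∈ (extChartAt (𝓡 d) y).source) (a : Fin d) (v : TangentSpace (𝓡 d) w) :
    ∑ i, coordForm y i w v * coordForm x a w (coordField y i w) = coordForm x a w v := by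
  conv_rhs => rw [← sum_coordForm_smul_coordField hw v]
  simp only [map_sum, map_smul, smul_eq_mul]

/-- The Jacobian matrix of a change of charts, as a matrix of germs. -/
def transitionJac (𝕜 : Type*) [RCLike 𝕜] (y x : M) :
    Matrix (Fin d) (Fin d) (smoothGerm 𝕜 (extChartAt (𝓡 d) y y)) :=
  .of fun i a => D (frame d i) (germ _ fun z => ((transition y x z a : ℝ) : 𝕜))

theorem coordChange_transition (hy : y ∈ (extChartAt (𝓡 d) x).source) :
    Jet.CoordChange (partials (𝕜 := 𝕜) (frame d) (transition y x (extChartAt (𝓡 d) y y)))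
      (partials (frame d) (extChartAt (𝓡 d) y y))
      (pull (transition y x) (contDiffAt_transition hy)) (transitionJac 𝕜 y x) where
  chain i φ := D_pull_eq _ _ _
  symm i k a := D_comm _ _ _
  isUnit := by
    apply isUnit_matrix_of_value
    have hq := mem_extChartAt_target (I := 𝓡 d) y
    have hval : ∀ i a : Fin d, ((transitionJac 𝕜 y x).map value) i a
        = (coordForm x a y (coordField y i y) : 𝕜) := by
      intro i a
      have := (represents_jac (𝕜 := 𝕜) (frame d) (contDiffAt_transition hy) i a).value_eq
      rw [jac_transition hq, extChartAt_to_inv] at this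
      exact this
    -- The inverse at `y` is the Jacobian of the opposite change of charts.
    refine IsUnit.of_mul_eq_one (.of fun a i => (coordForm y i y (coordField x a y) : 𝕜)) ?_
    ext i j
    simp only [Matrix.mul_apply, hval, Matrix.of_apply, ← RCLike.ofReal_mul, ← RCLike.ofReal_sum]
    have : ∑ a, coordForm x a y (coordField y i y) * coordForm y j y (coordField x a y)
        = coordForm y j y (coordField y i y) := by
      conv_rhs => rw [← sum_coordForm_smul_coordField hy (coordField y i y)]
      simp only [map_sum, map_smul, smul_eq_mul]
    rw [this, coordForm_coordField (mem_extChartAt_source y), Matrix.one_apply]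
    simp only [eq_comm (a := j)]
    split_ifs <;> simp

theorem represents_transitionJac (hy : y ∈ (extChartAt (𝓡 d) x).source) (i a : Fin d) :
    Represents (jac 𝕜 (frame d) (transition y x) i a) (transitionJac 𝕜 y x i a) :=
  represents_jac (frame d) (contDiffAt_transition hy) i a

theorem bivectorRel_transition {P : TwoTensor d M}
    (hPs : ∀ x, ∀ z ∈ (extChartAt (𝓡 d) x).target, SmoothBivector (bivHat x P) z)
    (hy : y ∈ (extChartAt (𝓡 d) x).source) :
    Jet.BivectorRel (pull (transition y x) (contDiffAt_transition hy)) (transitionJac 𝕜 y x)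
      ((bivHatK 𝕜 x P).map (germ _)) ((bivHatK 𝕜 y P).map (germ _)) := by
  intro a b
  have hx : SmoothBivector (bivHatK 𝕜 x P) (transition y x (extChartAt (𝓡 d) y y)) := by
    rw [transition_self]
    exact fun i j => contDiffAt_ofRealFun (hPs x _ ((extChartAt (𝓡 d) x).map_source hy) i j)
  have hyP : SmoothBivector (bivHatK 𝕜 y P) (extChartAt (𝓡 d) y y) :=
    fun i j => contDiffAt_ofRealFun (hPs y _ (mem_extChartAt_target y) i j)
  refine Represents.eq (Represents.sum _ fun i => Represents.sum _ fun j =>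
    ((represents_germ (hyP i j)).mul (represents_transitionJac hy i a)).mul
      (represents_transitionJac hy j b)) ((represents_germ (hx a b)).pull _) ?_
  filter_upwards [eventually_mem_source hy] with z hz
  have hw := (extChartAt (𝓡 d) y).map_target hz.1
  simp only [jac_transition hz.1, bivHatK, Matrix.map_apply, ofRealFun_apply, Function.comp_apply,
    ← RCLike.ofReal_mul, ← RCLike.ofReal_sum]
  congr 1
  rw [transition, bivHat_chart hz.2]
  simp only [bivHat, Matrix.of_apply]
  set w := (extChartAt (𝓡 d) y).symm z
  have hc : ∀ a : Fin d, coordForm x a w = ∑ i, coordForm x a w (coordField y i w) • coordForm y i w := by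
    intro a
    refine ContinuousLinearMap.ext fun v => ?_
    rw [← sum_coordForm_coordField_mul hw a v, sum_apply]
    exact Finset.sum_congr rfl fun i _ => by rw [smul_apply, smul_eq_mul, mul_comm]
  conv_rhs => rw [hc a, hc b]
  simp only [map_sum, map_smul, LinearMap.sum_apply, LinearMap.smul_apply, smul_eq_mul,
    Finset.mul_sum]
  rw [Finset.sum_comm]
  exact Finset.sum_congr rfl fun i _ => Finset.sum_congr rfl fun j _ => by ring

theorem vectorRel_transition {X : (y : M) → TangentSpace (𝓡 d) y}
    (hXs : ∀ x, ∀ z ∈ (extChartAt (𝓡 d) x).target, ∀ k, ContDiffAt ℝ ∞ (vecHat x X k) z)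
    (hy : y ∈ (extChartAt (𝓡 d) x).source) :
    Jet.VectorRel (pull (transition y x) (contDiffAt_transition hy)) (transitionJac 𝕜 y x)
      (fun i => germ _ (vecHatK 𝕜 x X i)) (fun i => germ _ (vecHatK 𝕜 y X i)) := by
  intro a
  have hx : ∀ i, ContDiffAt ℝ ∞ (vecHatK 𝕜 x X i) (transition y x (extChartAt (𝓡 d) y y)) := by
    rw [transition_self]
    exact fun i => contDiffAt_ofRealFun (hXs x _ ((extChartAt (𝓡 d) x).map_source hy) i)
  have hyX : ∀ i, ContDiffAt ℝ ∞ (vecHatK 𝕜 y X i) (extChartAt (𝓡 d) y y) :=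
    fun i => contDiffAt_ofRealFun (hXs y _ (mem_extChartAt_target y) i)
  refine Represents.eq (Represents.sum _ fun i => (represents_germ (hyX i)).mul
    (represents_transitionJac hy i a)) ((represents_germ (hx a)).pull _) ?_
  filter_upwards [eventually_mem_source hy] with z hz
  have hw := (extChartAt (𝓡 d) y).map_target hz.1
  simp only [jac_transition hz.1, vecHatK, ofRealFun_apply, Function.comp_apply,
    ← RCLike.ofReal_mul, ← RCLike.ofReal_sum]
  congr 1
  rw [transition, vecHat_chart hz.2, ← sum_coordForm_coordField_mul hw a]
  rfl

theorem contDiffAt_vecHat_coordField_of_mem {w : M} (hw : w ∈ (extChartAt (𝓡 d) x).source)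
    (hw' : w ∈ (extChartAt (𝓡 d) y).source) (i k : Fin d) :
    ContDiffAt ℝ ∞ (vecHat x (coordField y i) k) (extChartAt (𝓡 d) x w) :=
  (contMDiffAt_section_iff_vecHat (n := ⊤) hw).1 ((contMDiffAt_section_iff_vecHat (n := ⊤) hw').2
    fun k => contDiffAt_vecHat_coordField ((extChartAt (𝓡 d) y).map_source hw') i k) k

/-- This is `coordForm_nabla` in the chart around `x`, applied to the field `∂_l` of the chart
around `y`. The components of that field are the entries of row `l` of the Jacobian, and their
derivatives along `∂_k` form the inhomogeneous term. -/
theorem christoffelRel_transition {nabla : Connection d M}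
    (hΓs : ∀ x, ∀ z ∈ (extChartAt (𝓡 d) x).target, SmoothChristoffel (chHat nabla x) z)
    (hy : y ∈ (extChartAt (𝓡 d) x).source) :
    Jet.ChristoffelRel (partials (frame d) (extChartAt (𝓡 d) y y))
      (pull (transition y x) (contDiffAt_transition hy)) (transitionJac 𝕜 y x)
      (fun i k l => germ _ (chHatK 𝕜 nabla x i k l))
      (fun i k l => germ _ (chHatK 𝕜 nabla y i k l)) := by
  intro c k l
  have hx : SmoothChristoffel (chHatK 𝕜 nabla x) (transition y x (extChartAt (𝓡 d) y y)) := by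
    rw [transition_self]
    exact fun i k l => contDiffAt_ofRealFun (hΓs x _ ((extChartAt (𝓡 d) x).map_source hy) i k l)
  have hyΓ : SmoothChristoffel (chHatK 𝕜 nabla y) (extChartAt (𝓡 d) y y) :=
    fun i k l => contDiffAt_ofRealFun (hΓs y _ (mem_extChartAt_target y) i k l)
  have hJ := fun i a => represents_transitionJac (𝕜 := 𝕜) hy i a
  refine Represents.eq (Represents.sum _ fun m => (hJ m c).mul (represents_germ (hyΓ m k l)))
    ((Represents.sum _ fun a => Represents.sum _ fun b => ((hJ k a).mul (hJ l b)).mul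
      ((represents_germ (hx c a b)).pull (contDiffAt_transition hy))).add
      ((hJ l c).deriv (frame d k))) ?_
  filter_upwards [eventually_mem_source hy, (eventually_mem_source hy).eventually_nhds] with z hz hz'
  have hw := (extChartAt (𝓡 d) y).map_target hz.1
  have hd : fderiv ℝ (jac 𝕜 (frame d) (transition y x) l c) z (frame d k)
      = (mvfderiv (𝓡 d) (fun w => coordForm x c w (coordField y l w))
          ((extChartAt (𝓡 d) y).symm z) (coordField y k ((extChartAt (𝓡 d) y).symm z)) : 𝕜) := by
    have heq : jac 𝕜 (frame d) (transition y x) l c =ᶠ[𝓝 z]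
        fun z => ((read y (fun w => coordForm x c w (coordField y l w)) z : ℝ) : 𝕜) := by
      filter_upwards [hz'] with u hu
      exact jac_transition hu.1 l c
    rw [heq.fderiv_eq, fderiv_ofReal, mvfderiv_coordField_read hw,
      (extChartAt (𝓡 d) y).right_inv hz.1]
    rfl
  rw [hd]
  simp only [jac_transition hz.1, chHatK, ofRealFun_apply, Function.comp_apply,
    ← RCLike.ofReal_mul, ← RCLike.ofReal_sum, ← RCLike.ofReal_add]
  congr 1
  have hn := coordForm_nabla nabla hz.2
    (fun k => contDiffAt_vecHat_coordField_of_mem hz.2 hw l k)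
    (coordField y k ((extChartAt (𝓡 d) y).symm z)) c
  rw [← sum_coordForm_coordField_mul hw c, add_comm] at hn
  rw [Finset.sum_comm (f := fun a b => _ * _ * chHat nabla x c a b _)]
  refine Eq.trans (Eq.trans ?_ hn) ?_
  · exact Finset.sum_congr rfl fun m _ => mul_comm _ _
  · congr 1
    refine Finset.sum_congr rfl fun b _ => Finset.sum_congr rfl fun a _ => ?_
    rw [transition]
    ring

theorem pull_read (hy : y ∈ (extChartAt (𝓡 d) x).source) {f : M → 𝕜}
    (hf : ContDiffAt ℝ ∞ (read x f) (transition y x (extChartAt (𝓡 d) y y))) :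
    pull (transition y x) (contDiffAt_transition hy) (germ _ (read x f)) = germ _ (read y f) := by
  rw [pull_germ _ (contDiffAt_transition hy) hf]
  refine germ_congr ?_
  filter_upwards [eventually_mem_source hy] with z hz
  rw [Function.comp_apply, transition, read_chart hz.2]
  rfl

end Chart

/-! ### Coordinate expressions at all points of a chart -/

open Filter Topology

noncomputable section Chart

open SmoothGerm

variable {d : ℕ} {M : Type*} [TopologicalSpace M] [ChartedSpace (Model d) M]
  [IsManifold (𝓡 d) ∞ M] {𝕜 : Type*} [RCLike 𝕜]

/-- The germs of the components of a tensor. -/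
abbrev bivGerm (𝕜 : Type*) [RCLike 𝕜] (x : M) (P : TwoTensor d M) (z : Model d) :
    Matrix (Fin d) (Fin d) (smoothGerm 𝕜 z) := (bivHatK 𝕜 x P).map (germ z)

/-- The germs of the Christoffel symbols. -/
abbrev chGerm (𝕜 : Type*) [RCLike 𝕜] (nabla : Connection d M) (x : M) (z : Model d)
    (i k l : Fin d) : smoothGerm 𝕜 z := germ z (chHatK 𝕜 nabla x i k l)

/-- The germs of the components of a vector field. -/
abbrev vecGerm (𝕜 : Type*) [RCLike 𝕜] (x : M) (X : (y : M) → TangentSpace (𝓡 d) y) (z : Model d)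
    (i : Fin d) : smoothGerm 𝕜 z := germ z (vecHatK 𝕜 x X i)

/-- The partial derivatives of germs. -/
abbrev partialGerm (z : Model d) (i : Fin d) : smoothGerm 𝕜 z → smoothGerm 𝕜 z :=
  partials (frame d) z i

/-- The vector field `X` is smooth in all charts. -/
def SmoothVec (X : (y : M) → TangentSpace (𝓡 d) y) : Prop :=
  ∀ x, ∀ z ∈ (extChartAt (𝓡 d) x).target, ∀ k, ContDiffAt ℝ ∞ (vecHat x X k) z

theorem smoothVec_of_contMDiff {X : (y : M) → TangentSpace (𝓡 d) y}
    (hX : ContMDiff (𝓡 d) (𝓡 d).tangent ∞ (fun y => (⟨y, X y⟩ : TangentBundle (𝓡 d) M))) :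
    SmoothVec X := fun x z hz k => by
  have := (contMDiffAt_section_iff_vecHat (n := ⊤) ((extChartAt (𝓡 d) x).map_target hz)).1
    (hX.contMDiffAt) k
  rwa [(extChartAt (𝓡 d) x).right_inv hz] at this

theorem contDiffAt_read {f : M → 𝕜} (hf : ContMDiff (𝓡 d) 𝓘(ℝ, 𝕜) ∞ f) (x : M) {z : Model d}
    (hz : z ∈ (extChartAt (𝓡 d) x).target) : ContDiffAt ℝ ∞ (read x f) z :=
  (hf.contMDiffAt.comp z (contMDiffAt_chart_symm hz)).contDiffAt

variable {nabla : Connection d M} {P : TwoTensor d M}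

theorem Regular.smoothAt (h : Regular nabla P) (x : M) : SmoothAt nabla P x where
  christoffel := h.christoffel x _ (mem_extChartAt_target x)
  bivector := h.bivector x _ (mem_extChartAt_target x)

theorem Regular.christoffelK (h : Regular nabla P) {x : M} {z : Model d}
    (hz : z ∈ (extChartAt (𝓡 d) x).target) : SmoothChristoffel (chHatK 𝕜 nabla x) z :=
  fun i k l => contDiffAt_ofRealFun (h.christoffel x z hz i k l)

theorem Regular.bivectorK (h : Regular nabla P) {x : M} {z : Model d}
    (hz : z ∈ (extChartAt (𝓡 d) x).target) : SmoothBivector (bivHatK 𝕜 x P) z :=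
  fun i j => contDiffAt_ofRealFun (h.bivector x z hz i j)

omit [IsManifold (𝓡 d) ∞ M] in
theorem SmoothVec.contDiffAtK {X : (y : M) → TangentSpace (𝓡 d) y} (h : SmoothVec X) {x : M}
    {z : Model d} (hz : z ∈ (extChartAt (𝓡 d) x).target) (k : Fin d) :
    ContDiffAt ℝ ∞ (vecHatK 𝕜 x X k) z := contDiffAt_ofRealFun (h x z hz k)

theorem Regular.symm_germ (h : Regular nabla P) {x : M} {z : Model d}
    (hz : z ∈ (extChartAt (𝓡 d) x).target) (i k l : Fin d) :
    chGerm 𝕜 nabla x z i k l = chGerm 𝕜 nabla x z i l k := germ_congr (by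
  filter_upwards [extChartAt_target_mem_nhds_of_mem hz] with u hu
  simp only [chHatK, ofRealFun_apply, h.symm x u hu i k l])

theorem Regular.skew_germ (h : Regular nabla P) {x : M} {z : Model d}
    (hz : z ∈ (extChartAt (𝓡 d) x).target) (i j : Fin d) :
    bivGerm 𝕜 x P z i j = -bivGerm 𝕜 x P z j i := by
  have : bivHatK 𝕜 x P i j = -bivHatK 𝕜 x P j i := by
    funext z
    simp only [bivHatK, Matrix.map_apply, Pi.neg_apply, ofRealFun_apply, bivHat, Matrix.of_apply]
    rw [h.skew]
    push_cast
    rfl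
  rw [bivGerm, Matrix.map_apply, Matrix.map_apply, this, germ_neg (h.bivectorK hz j i)]

variable {x y : M} {f g : M → 𝕜}

/-- The operators are defined at `y` through the preferred chart around `y`, but `D_X` and the
bracket differentiate them. Naturality under the transition map rewrites them in one chart around
`x`, for all `y` in its domain. -/
theorem C₂_eq_chart (h : Regular nabla P) (hf : ContMDiff (𝓡 d) 𝓘(ℝ, 𝕜) ∞ f)
    (hg : ContMDiff (𝓡 d) 𝓘(ℝ, 𝕜) ∞ g) (hy : y ∈ (extChartAt (𝓡 d) x).source) :
    C₂ nabla P f g y = -(1 / 6) * Jet.c₂ (pd (frame d)) (chHatK 𝕜 nabla x) (bivHatK 𝕜 x P)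
      (read x f) (read x g) (extChartAt (𝓡 d) x y) := by
  have hq := mem_extChartAt_target (I := 𝓡 d) y
  have hp := (extChartAt (𝓡 d) x).map_source hy
  rw [C₂_eq_self (h.smoothAt y) h.skew (fun i k l => by
      filter_upwards [extChartAt_target_mem_nhds_of_mem hq] with u hu
      exact h.symm y u hu i k l) (contDiffAt_read hf y hq) (contDiffAt_read hg y hq)]
  -- The pull-back of germs starts from the point `transition y x _`, so the base point in the chart
  -- around `x` must be written in this form.
  rw [← transition_self y x] at hp ⊢
  congr 1
  rw [← (represents_c₂ (frame d) (h.christoffelK hq) (h.bivectorK hq)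
      (contDiffAt_read hf y hq) (contDiffAt_read hg y hq)).value_eq,
    ← (represents_c₂ (frame d) (h.christoffelK hp) (h.bivectorK hp)
      (contDiffAt_read hf x hp) (contDiffAt_read hg x hp)).value_eq,
    ← value_pull (transition y x) (contDiffAt_transition hy),
    ← (coordChange_transition hy).c₂_eq (bivectorRel_transition h.bivector hy)
      (christoffelRel_transition h.christoffel hy),
    pull_read hy (contDiffAt_read hf x hp), pull_read hy (contDiffAt_read hg x hp)]

theorem C₃_eq_chart (h : Regular nabla P) (hf : ContMDiff (𝓡 d) 𝓘(ℝ, 𝕜) ∞ f)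
    (hg : ContMDiff (𝓡 d) 𝓘(ℝ, 𝕜) ∞ g) (hy : y ∈ (extChartAt (𝓡 d) x).source) :
    C₃ nabla P f g y = -(1 / 6) * Jet.c₃ (pd (frame d)) (chHatK 𝕜 nabla x) (bivHatK 𝕜 x P)
      (read x f) (read x g) (extChartAt (𝓡 d) x y) := by
  have hq := mem_extChartAt_target (I := 𝓡 d) y
  have hp := (extChartAt (𝓡 d) x).map_source hy
  rw [C₃_eq_self (h.smoothAt y) (contDiffAt_read hf y hq) (contDiffAt_read hg y hq)]
  rw [← transition_self y x] at hp ⊢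
  congr 1
  rw [← (represents_c₃ (frame d) (h.christoffelK hq) (h.bivectorK hq)
      (contDiffAt_read hf y hq) (contDiffAt_read hg y hq)).value_eq,
    ← (represents_c₃ (frame d) (h.christoffelK hp) (h.bivectorK hp)
      (contDiffAt_read hf x hp) (contDiffAt_read hg x hp)).value_eq,
    ← value_pull (transition y x) (contDiffAt_transition hy),
    ← (coordChange_transition hy).c₃_eq (fun i j a => D_comm _ _ _)
      (bivectorRel_transition h.bivector hy)
      (christoffelRel_transition h.christoffel hy),
    pull_read hy (contDiffAt_read hf x hp), pull_read hy (contDiffAt_read hg x hp)]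

theorem derivCorrection_eq_chart (h : Regular nabla P) {X : (y : M) → TangentSpace (𝓡 d) y}
    (hX : SmoothVec X) (hg : ContMDiff (𝓡 d) 𝓘(ℝ, 𝕜) ∞ g)
    (hy : y ∈ (extChartAt (𝓡 d) x).source) :
    derivCorrection nabla P X g y = -(1 / 6) * Jet.pairing (bivHatK 𝕜 x P)
      (Jet.lieGamma (pd (frame d)) (chHatK 𝕜 nabla x) (vecHatK 𝕜 x X))
      (Jet.lieGamma (pd (frame d)) (chHatK 𝕜 nabla x)
        (Jet.ham (pd (frame d)) (bivHatK 𝕜 x P) (read x g))) (extChartAt (𝓡 d) x y) := by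
  have hq := mem_extChartAt_target (I := 𝓡 d) y
  have hp := (extChartAt (𝓡 d) x).map_source hy
  rw [derivCorrection_eq_self (h.smoothAt y) (hX y _ hq) (contDiffAt_read hg y hq)]
  rw [← transition_self y x] at hp ⊢
  congr 1
  rw [← (represents_pairing_ham (frame d) (h.christoffelK hq) (h.bivectorK hq)
      (hX.contDiffAtK hq) (contDiffAt_read hg y hq)).value_eq,
    ← (represents_pairing_ham (frame d) (h.christoffelK hp) (h.bivectorK hp)
      (hX.contDiffAtK hp) (contDiffAt_read hg x hp)).value_eq,
    ← value_pull (transition y x) (contDiffAt_transition hy),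
    ← (coordChange_transition hy).pairing_lieGamma_eq (fun i j a => D_comm _ _ _)
      (bivectorRel_transition h.bivector hy)
      (christoffelRel_transition h.christoffel hy) (vectorRel_transition hX hy),
    pull_read hy (contDiffAt_read hg x hp)]

/-- The germ of a constant function. -/
def constGerm (z : Model d) (c : 𝕜) : smoothGerm 𝕜 z := germ z fun _ => c

theorem value_constGerm (z : Model d) (c : 𝕜) : value (constGerm z c) = c :=
  value_germ contDiffAt_const

theorem partialGerm_constGerm (z : Model d) (c : 𝕜) (i : Fin d) :
    partials (frame d) z i (constGerm z c) = 0 := D_germ_const _ _ _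

omit [IsManifold (𝓡 d) ∞ M] in
theorem represents_read {F : M → 𝕜} {G : Model d → 𝕜} (c : 𝕜)
    {φ : smoothGerm 𝕜 (extChartAt (𝓡 d) x x)} (hG : Represents G φ)
    (h : ∀ y ∈ (extChartAt (𝓡 d) x).source, F y = c * G (extChartAt (𝓡 d) x y)) :
    Represents (read x F) (constGerm _ c * φ) := by
  refine Eq.trans (Germ.coe_eq.2 ?_) ((represents_germ contDiffAt_const).mul hG)
  filter_upwards [extChartAt_target_mem_nhds_of_mem (mem_extChartAt_target (I := 𝓡 d) x)] with z hz
  have := h _ ((extChartAt (𝓡 d) x).map_target hz)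
  rwa [(extChartAt (𝓡 d) x).right_inv hz] at this

theorem represents_read_C₂ (h : Regular nabla P) (hf : ContMDiff (𝓡 d) 𝓘(ℝ, 𝕜) ∞ f)
    (hg : ContMDiff (𝓡 d) 𝓘(ℝ, 𝕜) ∞ g) (x : M) :
    Represents (read x (C₂ nabla P f g)) (constGerm _ (-(1 / 6)) *
      Jet.c₂ (partialGerm (extChartAt (𝓡 d) x x)) (chGerm 𝕜 nabla x _) (bivGerm 𝕜 x P _)
        (germ _ (read x f)) (germ _ (read x g))) :=
  have hp := mem_extChartAt_target (I := 𝓡 d) x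
  represents_read _ (represents_c₂ (frame d) (h.christoffelK hp) (h.bivectorK hp)
    (contDiffAt_read hf x hp) (contDiffAt_read hg x hp)) fun _ hy => C₂_eq_chart h hf hg hy

theorem represents_read_C₃ (h : Regular nabla P) (hf : ContMDiff (𝓡 d) 𝓘(ℝ, 𝕜) ∞ f)
    (hg : ContMDiff (𝓡 d) 𝓘(ℝ, 𝕜) ∞ g) (x : M) :
    Represents (read x (C₃ nabla P f g)) (constGerm _ (-(1 / 6)) *
      Jet.c₃ (partialGerm (extChartAt (𝓡 d) x x)) (chGerm 𝕜 nabla x _) (bivGerm 𝕜 x P _)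
        (germ _ (read x f)) (germ _ (read x g))) :=
  have hp := mem_extChartAt_target (I := 𝓡 d) x
  represents_read _ (represents_c₃ (frame d) (h.christoffelK hp) (h.bivectorK hp)
    (contDiffAt_read hf x hp) (contDiffAt_read hg x hp)) fun _ hy => C₃_eq_chart h hf hg hy

theorem represents_read_derivCorrection (h : Regular nabla P)
    {X : (y : M) → TangentSpace (𝓡 d) y} (hX : SmoothVec X)
    (hg : ContMDiff (𝓡 d) 𝓘(ℝ, 𝕜) ∞ g) (x : M) :
    Represents (read x (derivCorrection nabla P X g)) (constGerm _ (-(1 / 6)) *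
      Jet.pairing (bivGerm 𝕜 x P (extChartAt (𝓡 d) x x))
        (Jet.lieGamma (partialGerm _) (chGerm 𝕜 nabla x _) (vecGerm 𝕜 x X _))
        (Jet.lieGamma (partialGerm _) (chGerm 𝕜 nabla x _)
          (Jet.ham (partialGerm _) (bivGerm 𝕜 x P _) (germ _ (read x g))))) :=
  have hp := mem_extChartAt_target (I := 𝓡 d) x
  represents_read _ (represents_pairing_ham (frame d) (h.christoffelK hp) (h.bivectorK hp)
    (hX.contDiffAtK hp) (contDiffAt_read hg x hp)) fun _ hy => derivCorrection_eq_chart h hX hg hy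

theorem represents_read_bracket (h : Regular nabla P) (hf : ContMDiff (𝓡 d) 𝓘(ℝ, 𝕜) ∞ f)
    (hg : ContMDiff (𝓡 d) 𝓘(ℝ, 𝕜) ∞ g) (x : M) :
    Represents (read x (bracket P f g))
      (Jet.bracket (partialGerm (extChartAt (𝓡 d) x x)) (bivGerm 𝕜 x P _)
        (germ _ (read x f)) (germ _ (read x g))) := by
  have hp := mem_extChartAt_target (I := 𝓡 d) x
  refine Eq.trans (Germ.coe_eq.2 ?_) (represents_bracket (frame d) (h.bivectorK hp)
    (contDiffAt_read hf x hp) (contDiffAt_read hg x hp))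
  filter_upwards [extChartAt_target_mem_nhds_of_mem hp] with z hz
  have := bracket_eq_chart P ((extChartAt (𝓡 d) x).map_target hz) f g
  rwa [(extChartAt (𝓡 d) x).right_inv hz] at this

theorem dirDeriv_eq_chart (X : (y : M) → TangentSpace (𝓡 d) y) (f : M → 𝕜)
    (hy : y ∈ (extChartAt (𝓡 d) x).source) :
    dirDeriv X f y = Jet.dir (pd (frame d)) (vecHatK 𝕜 x X) (read x f)
      (extChartAt (𝓡 d) x y) := by
  rw [dirDeriv, mvfderiv_eq_sum hy, Jet.dir, Finset.sum_apply]
  refine Finset.sum_congr rfl fun i _ => ?_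
  rw [RCLike.real_smul_eq_coe_mul, Pi.mul_apply, vecHatK, ofRealFun_apply, vecHat_chart hy]
  rfl

theorem represents_read_dirDeriv {X : (y : M) → TangentSpace (𝓡 d) y} (hX : SmoothVec X)
    {φ : smoothGerm 𝕜 (extChartAt (𝓡 d) x x)} (hf : Represents (read x f) φ) :
    Represents (read x (dirDeriv X f))
      (Jet.dir (partialGerm (extChartAt (𝓡 d) x x)) (vecGerm 𝕜 x X _) φ) := by
  have hp := mem_extChartAt_target (I := 𝓡 d) x
  rw [← hf.germ_eq]
  refine Eq.trans (Germ.coe_eq.2 ?_) (represents_dir (frame d) (hX.contDiffAtK hp) hf.contDiffAt)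
  filter_upwards [extChartAt_target_mem_nhds_of_mem hp] with z hz
  have := dirDeriv_eq_chart X f ((extChartAt (𝓡 d) x).map_target hz)
  rwa [(extChartAt (𝓡 d) x).right_inv hz] at this

end Chart

/-! ### Smoothness of the coordinate expressions -/

open Filter Topology VectorField

noncomputable section Chart

open SmoothGerm

variable {d : ℕ} {M : Type*} [TopologicalSpace M] [T2Space M] [ChartedSpace (Model d) M]
  [IsManifold (𝓡 d) ∞ M] {𝕜 : Type*} [RCLike 𝕜] {x : M} {z : Model d}

/-- The Hausdorff property is what makes a bump function in a chart extend smoothly by zero. -/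
theorem exists_bump {y : M} (hy : y ∈ (extChartAt (𝓡 d) x).source) :
    ∃ χ : M → ℝ, ContMDiff (𝓡 d) 𝓘(ℝ, ℝ) ∞ χ ∧ χ =ᶠ[𝓝 y] 1 ∧
      tsupport χ ⊆ (extChartAt (𝓡 d) x).source := by
  obtain ⟨χ, -, hχ⟩ := (SmoothBumpFunction.nhds_basis_tsupport (I := 𝓡 d) y).mem_iff.1
    (extChartAt_source_mem_nhds_of_mem hy)
  exact ⟨χ, χ.contMDiff, χ.eventuallyEq_one, hχ⟩

/-- `IsPoisson` speaks only of globally defined functions. Coordinates that are cut off away from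
the point let it be tested on the components of `P`. -/
theorem exists_coordinate (hz : z ∈ (extChartAt (𝓡 d) x).target) (i : Fin d) :
    ∃ F : M → ℝ, ContMDiff (𝓡 d) 𝓘(ℝ, ℝ) ∞ F ∧ read x F =ᶠ[𝓝 z] fun w => w i := by
  obtain ⟨χ, hχ, h1, hs⟩ := exists_bump ((extChartAt (𝓡 d) x).map_target hz)
  refine ⟨fun y => χ y * extChartAt (𝓡 d) x y i, contMDiff_of_tsupport fun y hy => ?_, ?_⟩
  · have hy' := hs (closure_mono (Function.support_mul_subset_left _ _) hy)
    refine hχ.contMDiffAt.mul ?_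
    exact (EuclideanSpace.proj i : Model d →L[ℝ] ℝ).contMDiff.contMDiffAt.comp y
      (contMDiffAt_chart hy')
  · have hc := (contMDiffAt_chart_symm hz).continuousAt.eventually h1
    filter_upwards [hc, extChartAt_target_mem_nhds_of_mem hz] with w hw hw'
    rw [read, Function.comp_apply, hw, (extChartAt (𝓡 d) x).right_inv hw']
    simp

omit [T2Space M] in
theorem read_bracket (P : TwoTensor d M) (hz : z ∈ (extChartAt (𝓡 d) x).target) (f g : M → ℝ) :
    read x (bracket P f g) z = ∑ a, ∑ b, bivHat x P a b z * pd (frame d) a (read x f) z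
      * pd (frame d) b (read x g) z := by
  have := bracket_eq_chart P ((extChartAt (𝓡 d) x).map_target hz) f g
  rw [(extChartAt (𝓡 d) x).right_inv hz] at this
  refine this.trans ?_
  simp only [Jet.bracket, Finset.sum_apply, Pi.mul_apply, bivHatK, Matrix.map_apply,
    ofRealFun_apply, RCLike.ofReal_real_eq_id, id]

theorem pd_coordinate {F : Model d → ℝ} {i : Fin d} (h : F =ᶠ[𝓝 z] fun w => w i) (a : Fin d) :
    pd (frame d) a F z = if a = i then 1 else 0 := by
  rw [pd, h.fderiv_eq]
  refine (congrArg (fun L : Model d →L[ℝ] ℝ => L (frame d a))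
    (EuclideanSpace.proj i : Model d →L[ℝ] ℝ).hasFDerivAt.fderiv).trans ?_
  simp [frame, eq_comm]

omit [T2Space M] in
theorem read_bracket_left (P : TwoTensor d M) (hz : z ∈ (extChartAt (𝓡 d) x).target) {F : M → ℝ}
    {i : Fin d} (h : read x F =ᶠ[𝓝 z] fun w => w i) (g : M → ℝ) :
    read x (bracket P F g) =ᶠ[𝓝 z]
      fun w => ∑ b, bivHat x P i b w * pd (frame d) b (read x g) w := by
  filter_upwards [extChartAt_target_mem_nhds_of_mem hz, h.eventually_nhds] with w hw hh
  rw [read_bracket P hw]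
  simp [pd_coordinate hh]

omit [T2Space M] in
theorem read_bracket_coordinate (P : TwoTensor d M) (hz : z ∈ (extChartAt (𝓡 d) x).target)
    {F G : M → ℝ} {i j : Fin d} (hF : read x F =ᶠ[𝓝 z] fun w => w i)
    (hG : read x G =ᶠ[𝓝 z] fun w => w j) :
    read x (bracket P F G) =ᶠ[𝓝 z] bivHat x P i j := by
  filter_upwards [read_bracket_left P hz hF G, hG.eventually_nhds] with w hw hh
  rw [hw]
  simp [pd_coordinate hh]

theorem IsPoisson.smoothBivector {P : TwoTensor d M} (hP : IsPoisson P)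
    (hz : z ∈ (extChartAt (𝓡 d) x).target) : SmoothBivector (bivHat x P) z := by
  intro i j
  obtain ⟨F, hF, hFi⟩ := exists_coordinate hz i
  obtain ⟨G, hG, hGj⟩ := exists_coordinate hz j
  exact (contDiffAt_read (hP.smooth F G hF hG) x hz).congr_of_eventuallyEq
    (read_bracket_coordinate P hz hFi hGj).symm

/-- The Jacobi identity for three cut-off coordinates. Near `z` their brackets are components of
`P`, and a further bracket with a coordinate contracts `P` with the derivative. -/
theorem IsPoisson.jacobi_bivHat {P : TwoTensor d M} (hP : IsPoisson P)
    (hz : z ∈ (extChartAt (𝓡 d) x).target) (i j k : Fin d) :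
    ∑ l, (bivHat x P i l z * pd (frame d) l (bivHat x P j k) z
      + bivHat x P j l z * pd (frame d) l (bivHat x P k i) z
      + bivHat x P k l z * pd (frame d) l (bivHat x P i j) z) = 0 := by
  obtain ⟨F, hF, hFi⟩ := exists_coordinate hz i
  obtain ⟨G, hG, hGj⟩ := exists_coordinate hz j
  obtain ⟨H, hH, hHk⟩ := exists_coordinate hz k
  have key : ∀ {i j k : Fin d} {F G H : M → ℝ}, read x F =ᶠ[𝓝 z] (fun w => w i) →
      read x G =ᶠ[𝓝 z] (fun w => w j) → read x H =ᶠ[𝓝 z] (fun w => w k) →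
      read x (bracket P F (bracket P G H)) z
        = ∑ l, bivHat x P i l z * pd (frame d) l (bivHat x P j k) z := by
    intro i j k F G H hF hG hH
    rw [(read_bracket_left P hz hF _).eq_of_nhds]
    simp only [pd, (read_bracket_coordinate P hz hG hH).fderiv_eq]
  have h := congrFun (hP.jacobi F G H hF hG hH) ((extChartAt (𝓡 d) x).symm z)
  simp only [Finset.sum_add_distrib]
  rw [← key hFi hGj hHk, ← key hGj hHk hFi, ← key hHk hFi hGj]
  exact h

theorem IsPoisson.jacobi_germ {P : TwoTensor d M} (hP : IsPoisson P)
    (hz : z ∈ (extChartAt (𝓡 d) x).target) (i j k : Fin d) :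
    ∑ l, (bivGerm 𝕜 x P z i l * partialGerm z l (bivGerm 𝕜 x P z j k)
      + bivGerm 𝕜 x P z j l * partialGerm z l (bivGerm 𝕜 x P z k i)
      + bivGerm 𝕜 x P z k l * partialGerm z l (bivGerm 𝕜 x P z i j)) = 0 := by
  have hb : ∀ i j, Represents (bivHatK 𝕜 x P i j) (bivGerm 𝕜 x P z i j) := fun i j =>
    represents_germ (contDiffAt_ofRealFun (hP.smoothBivector hz i j))
  have ht : ∀ i l j k, Represents
      (fun w => bivHatK 𝕜 x P i l w * pd (frame d) l (bivHatK 𝕜 x P j k) w)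
      (bivGerm 𝕜 x P z i l * partialGerm z l (bivGerm 𝕜 x P z j k)) := fun i l j k =>
    (hb i l).mul ((hb j k).deriv _)
  refine (Represents.sum _ fun l => ((ht i l j k).add (ht j l k i)).add (ht k l i j)).eq
    (F := fun w => ∑ l, _) (G := fun _ => 0) rfl ?_
  filter_upwards [extChartAt_target_mem_nhds_of_mem hz] with w hw
  have := congrArg (fun r : ℝ => (r : 𝕜)) (hP.jacobi_bivHat hw i j k)
  push_cast at this
  refine Eq.trans (Finset.sum_congr rfl fun l _ => ?_) this
  have hpd : ∀ i j, pd (frame d) l (bivHatK 𝕜 x P i j) w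
      = ((pd (frame d) l (bivHat x P i j) w : ℝ) : 𝕜) := fun i j =>
    fderiv_ofReal (bivHat x P i j) w _
  simp only [hpd]
  rfl

theorem smoothChristoffel {nabla : Connection d M}
    (hsmooth : CovariantDerivative.ContMDiffCovariantDerivative nabla ∞)
    (hz : z ∈ (extChartAt (𝓡 d) x).target) : SmoothChristoffel (chHat nabla x) z := by
  have hcs : ∀ l y, y ∈ (extChartAt (𝓡 d) x).source → ContMDiffAt (𝓡 d) (𝓡 d).tangent ∞
      (fun w => (⟨w, coordField x l w⟩ : TangentBundle (𝓡 d) M)) y := fun l y hy =>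
    (contMDiffAt_section_iff_vecHat (n := ⊤) hy).2
      fun k => contDiffAt_vecHat_coordField ((extChartAt (𝓡 d) x).map_source hy) l k
  intro i k l
  have hy := (extChartAt (𝓡 d) x).map_target hz
  obtain ⟨χ, hχ, h1, hs⟩ := exists_bump hy
  set y := (extChartAt (𝓡 d) x).symm z
  -- The smoothness of the connection is used for a global section, so `∂_l` is multiplied by a
  -- cut-off. Locality of `∇` removes the cut-off near `y`.
  have hV : ContMDiff (𝓡 d) (𝓡 d).tangent ∞
      (fun w => (⟨w, (χ • coordField x l) w⟩ : TangentBundle (𝓡 d) M)) :=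
    ContMDiffOn.smul_section_of_tsupport hχ.contMDiffOn
      (isOpen_extChartAt_source x) hs fun w hw => (hcs l w hw).contMDiffWithinAt
  have hN := hsmooth.contMDiff.contMDiff (σ := χ • coordField x l) hV.contMDiffOn
  have hk : ContMDiffAt (𝓡 d) (𝓡 d).tangent ∞ (fun w =>
      (⟨w, nabla (χ • coordField x l) w (coordField x k w)⟩ : TangentBundle (𝓡 d) M)) y :=
    (contMDiffOn_univ.1 hN).contMDiffAt.clm_bundle_apply (hcs k y hy)
  have hk' := (contMDiffAt_section_iff_vecHat (n := ⊤) hy).1 hk i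
  rw [(extChartAt (𝓡 d) x).right_inv hz] at hk'
  refine hk'.congr_of_eventuallyEq ?_
  have hc := (contMDiffAt_chart_symm hz).continuousAt.eventually h1.eventually_nhds
  filter_upwards [hc, extChartAt_target_mem_nhds_of_mem hz] with w hw hw'
  have hy' := (extChartAt (𝓡 d) x).map_target hw'
  have := nabla.isCovariantDerivativeOnUniv.congr_of_eventuallyEq (σ := χ • coordField x l)
    (σ' := coordField x l)
    (hV.contMDiffAt.mdifferentiableAt (by simp)) (mdifferentiableAt_coordField hy' l) univ_mem (by
      filter_upwards [hw] with u hu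
      rw [Pi.smul_apply', hu]
      simp)
  rw [chHat, vecHat]
  exact congrArg (fun L : TangentSpace (𝓡 d) ((extChartAt (𝓡 d) x).symm w) →L[ℝ]
    TangentSpace (𝓡 d) ((extChartAt (𝓡 d) x).symm w) => coordForm x i _ (L (coordField x k _)))
    this.symm

-- Vanishing torsion applied to two coordinate fields, whose Lie bracket is zero.
omit [T2Space M] in
theorem chHat_symm {nabla : Connection d M} (htorsion : nabla.torsion = 0)
    (hz : z ∈ (extChartAt (𝓡 d) x).target) (i k l : Fin d) :
    chHat nabla x i k l z = chHat nabla x i l k z := by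
  have hy := (extChartAt (𝓡 d) x).map_target hz
  have h := (CovariantDerivative.torsion_eq_zero_iff nabla).1 htorsion
    (mdifferentiableAt_coordField hy k) (mdifferentiableAt_coordField hy l)
  have h' := congrArg (coordForm x i ((extChartAt (𝓡 d) x).symm z)) h
  have hs := fun a k => (contDiffAt_vecHat_coordField ((extChartAt (𝓡 d) x).map_source hy)
    a k).of_le (m := 1) (by norm_cast)
  rw [coordForm_mlieBracket hy (hs k) (hs l), (extChartAt (𝓡 d) x).right_inv hz, map_sub] at h'
  refine sub_eq_zero.1 (h'.trans ?_)
  simp only [Jet.lie, Finset.sum_apply, Pi.sub_apply, Pi.mul_apply, pd_vecHat_coordField hz]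
  simp

theorem regular {nabla : Connection d M}
    (hsmooth : CovariantDerivative.ContMDiffCovariantDerivative nabla ∞)
    (htorsion : nabla.torsion = 0) {P : TwoTensor d M} (hP : IsPoisson P) : Regular nabla P where
  christoffel _ _ hz := smoothChristoffel hsmooth hz
  bivector _ _ hz := hP.smoothBivector hz
  symm _ _ hz := chHat_symm htorsion hz
  skew := hP.skew

end Chart

/-! ### Families of functions depending on a time parameter -/

open Filter Topology

noncomputable section Time

open SmoothGerm

variable {d : ℕ} {𝕜 : Type*} [RCLike 𝕜] {p : Model d}

/-- The spatial frame of `ℝ × Model d`. -/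
def spaceFrame (d : ℕ) (i : Fin d) : ℝ × Model d := (0, frame d i)

/-- The inclusion of the space at time `t`. -/
def atTime (t : ℝ) (z : Model d) : ℝ × Model d := (t, z)

theorem hasFDerivAt_atTime (t : ℝ) (z : Model d) :
    HasFDerivAt (atTime t) (ContinuousLinearMap.inr ℝ ℝ (Model d)) z :=
  hasFDerivAt_prodMk_right t z

theorem contDiffAt_atTime (t : ℝ) (z : Model d) : ContDiffAt ℝ ∞ (atTime t) z :=
  contDiffAt_const.prodMk contDiffAt_id

theorem D_pull_atTime (t : ℝ) (i : Fin d) (φ : smoothGerm 𝕜 (atTime t p)) :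
    D (frame d i) (pull (atTime t) (contDiffAt_atTime t p) φ)
      = pull (atTime t) (contDiffAt_atTime t p) (D (spaceFrame d i) φ) := by
  refine D_pull_of_fderiv_eq _ _ _ _ (Eventually.of_forall fun z => ?_) φ
  rw [(hasFDerivAt_atTime t z).fderiv]
  exact ⟨hasFDerivAt_atTime t z, rfl⟩

theorem pull_atTime_partials (t : ℝ) (i : Fin d) (φ : smoothGerm 𝕜 (atTime t p)) :
    pull (atTime t) (contDiffAt_atTime t p) (partials (spaceFrame d) (atTime t p) i φ)
      = partials (frame d) p i (pull (atTime t) (contDiffAt_atTime t p) φ) :=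
  (D_pull_atTime t i φ).symm

/-- The germ at time zero, together with its time derivative. -/
def timeDual (𝕜 : Type*) [RCLike 𝕜] (p : Model d) :
    smoothGerm 𝕜 (atTime 0 p) →+* Jet.Dual (smoothGerm 𝕜 p) :=
  Jet.toDual (pull (atTime 0) (contDiffAt_atTime 0 p))
    ((pull (𝕜 := 𝕜) (atTime 0) (contDiffAt_atTime 0 p)).toAddMonoidHom.comp
      (D (𝕜 := 𝕜) (v := atTime 0 p) ((1 : ℝ), (0 : Model d))).toLinearMap.toAddMonoidHom)
    fun a b => by simp

theorem timeDual_apply (φ : smoothGerm 𝕜 (atTime 0 p)) :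
    timeDual 𝕜 p φ = Jet.dual (pull (atTime 0) (contDiffAt_atTime 0 p) φ)
      (pull (atTime 0) (contDiffAt_atTime 0 p) (D ((1 : ℝ), (0 : Model d)) φ)) := rfl

/-- Time and space derivatives commute. Hence `Jet.map_bracket`, `Jet.map_c₂` and `Jet.map_c₃` apply
to `timeDual`, and the time derivative of each expression is its `ε`-part over the dual numbers. -/
theorem timeDual_D (i : Fin d) (φ : smoothGerm 𝕜 (atTime 0 p)) :
    timeDual 𝕜 p (D (spaceFrame d i) φ) = Jet.dualD (D (frame d i)) (timeDual 𝕜 p φ) := by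
  rw [timeDual_apply, timeDual_apply]
  ext
  · exact congrArg _ (D_pull_atTime 0 i φ).symm
  · refine congrArg Subtype.val ?_
    rw [D_comm]
    exact (D_pull_atTime 0 i _).symm

theorem timeDual_germ_comp_snd {F : Model d → 𝕜} (hF : ContDiffAt ℝ ∞ F p) :
    timeDual 𝕜 p (germ _ (F ∘ Prod.snd)) = Jet.dual (germ p F) 0 := by
  have h : ContDiffAt ℝ ∞ (F ∘ Prod.snd) (atTime (0 : ℝ) p) := hF.comp _ contDiffAt_snd
  rw [timeDual_apply, pull_germ _ _ h, D_germ h]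
  have hz : (fun v : ℝ × Model d => fderiv ℝ (F ∘ Prod.snd) v ((1 : ℝ), (0 : Model d)))
      =ᶠ[𝓝 (atTime 0 p)] fun _ => 0 := by
    have hs : Tendsto (Prod.snd : ℝ × Model d → Model d) (𝓝 (atTime 0 p)) (𝓝 p) :=
      continuous_snd.tendsto _
    filter_upwards [hs.eventually (eventually_differentiableAt hF)] with v hv
    rw [(hv.hasFDerivAt.comp v hasFDerivAt_snd).fderiv]
    simp
  rw [germ_congr hz, pull_germ _ _ contDiffAt_const]
  congr 1
  exact (coe_germ contDiffAt_const) |> fun h => Subtype.ext h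

/-- Turns the algebraic `ε`-part back into an actual derivative in `t`, with the space point held
fixed. -/
theorem hasDerivAt_of_represents {F : ℝ × Model d → 𝕜} {φ : smoothGerm 𝕜 (atTime 0 p)}
    (h : Represents F φ) {u : ℝ → 𝕜} (hu : ∀ᶠ t in 𝓝 0, u t = F (t, p)) :
    HasDerivAt u (value (timeDual 𝕜 p φ).snd) 0 := by
  have hd : HasFDerivAt F (fderiv ℝ F (atTime 0 p)) (atTime 0 p) :=
    (eventually_differentiableAt h.contDiffAt).self_of_nhds.hasFDerivAt
  have := (hd.comp_hasDerivAt (0 : ℝ) ((hasDerivAt_id (0 : ℝ)).prodMk (hasDerivAt_const (0 : ℝ) p)))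
  rw [timeDual_apply, value_pull, (h.deriv _).value_eq]
  exact this.congr_of_eventuallyEq hu

section Slice

variable {t : ℝ} {Γ : Fin d → Fin d → Fin d → Model d → 𝕜}
  {Q : Matrix (Fin d) (Fin d) (ℝ × Model d → 𝕜)} {R : Matrix (Fin d) (Fin d) (Model d → 𝕜)}
  {f g : Model d → 𝕜}

theorem pull_atTime_snd {F : Model d → 𝕜} (hF : ContDiffAt ℝ ∞ F p) :
    pull (atTime t) (contDiffAt_atTime t p) (germ (atTime t p) (F ∘ Prod.snd)) = germ p F :=
  pull_germ _ _ (show ContDiffAt ℝ ∞ (F ∘ Prod.snd) (atTime t p) from hF.comp _ contDiffAt_snd)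

theorem pull_atTime_bivector (hQ : SmoothBivector Q (atTime t p))
    (hR : ∀ i j, Q i j ∘ atTime t = R i j) :
    (Q.map (germ (atTime t p))).map (pull (atTime t) (contDiffAt_atTime t p))
      = R.map (germ p) := by
  ext i j : 2
  simp only [Matrix.map_apply]
  rw [pull_germ _ _ (hQ i j), hR]

theorem smoothBivector_slice (hQ : SmoothBivector Q (atTime t p))
    (hR : ∀ i j, Q i j ∘ atTime t = R i j) : SmoothBivector R p := fun i j => by
  rw [← hR]
  exact (hQ i j).comp p (contDiffAt_atTime t p)

/-- Only space derivatives occur, and these commute with restriction to a time slice. So the values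
at all times `t` come from a single expression on `ℝ × Model d`, which can be differentiated in `t`.
-/
theorem bracket_slice (hQ : SmoothBivector Q (atTime t p))
    (hR : ∀ i j, Q i j ∘ atTime t = R i j) (hf : ContDiffAt ℝ ∞ f p) (hg : ContDiffAt ℝ ∞ g p) :
    Jet.bracket (pd (frame d)) R f g p
      = Jet.bracket (pd (spaceFrame d)) Q (f ∘ Prod.snd) (g ∘ Prod.snd) (atTime t p) := by
  have h₁ := (represents_bracket (frame d) (smoothBivector_slice hQ hR) hf hg).value_eq
  have h₂ := (represents_bracket (spaceFrame d) hQ (hf.comp (atTime t p) contDiffAt_snd)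
    (hg.comp (atTime t p) contDiffAt_snd)).value_eq
  refine h₁.symm.trans (Eq.trans ?_ h₂)
  rw [← value_pull (atTime t) (contDiffAt_atTime t p),
    Jet.map_bracket (D := fun i => partials (𝕜 := 𝕜) (spaceFrame d) (atTime t p) i)
      (D' := fun i => partials (𝕜 := 𝕜) (frame d) p i)
      (pull (𝕜 := 𝕜) (atTime t) (contDiffAt_atTime t p)) (pull_atTime_partials t), pull_atTime_bivector hQ hR,
    pull_atTime_snd hf, pull_atTime_snd hg]

theorem c₂_slice (hΓ : SmoothChristoffel Γ p) (hQ : SmoothBivector Q (atTime t p))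
    (hR : ∀ i j, Q i j ∘ atTime t = R i j) (hf : ContDiffAt ℝ ∞ f p) (hg : ContDiffAt ℝ ∞ g p) :
    Jet.c₂ (pd (frame d)) Γ R f g p = Jet.c₂ (pd (spaceFrame d))
      (fun i k l => Γ i k l ∘ Prod.snd) Q (f ∘ Prod.snd) (g ∘ Prod.snd) (atTime t p) := by
  have h₁ := (represents_c₂ (frame d) hΓ (smoothBivector_slice hQ hR) hf hg).value_eq
  have h₂ := (represents_c₂ (spaceFrame d)
    (fun i k l => (hΓ i k l).comp (atTime t p) contDiffAt_snd) hQ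
    (hf.comp (atTime t p) contDiffAt_snd) (hg.comp (atTime t p) contDiffAt_snd)).value_eq
  refine h₁.symm.trans (Eq.trans ?_ h₂)
  rw [← value_pull (atTime t) (contDiffAt_atTime t p),
    Jet.map_c₂ (D := fun i => partials (𝕜 := 𝕜) (spaceFrame d) (atTime t p) i)
      (D' := fun i => partials (𝕜 := 𝕜) (frame d) p i)
      (pull (𝕜 := 𝕜) (atTime t) (contDiffAt_atTime t p)) (pull_atTime_partials t), pull_atTime_bivector hQ hR,
    pull_atTime_snd hf, pull_atTime_snd hg]
  simp only [pull_atTime_snd (hΓ _ _ _)]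

theorem c₃_slice (hΓ : SmoothChristoffel Γ p) (hQ : SmoothBivector Q (atTime t p))
    (hR : ∀ i j, Q i j ∘ atTime t = R i j) (hf : ContDiffAt ℝ ∞ f p) (hg : ContDiffAt ℝ ∞ g p) :
    Jet.c₃ (pd (frame d)) Γ R f g p = Jet.c₃ (pd (spaceFrame d))
      (fun i k l => Γ i k l ∘ Prod.snd) Q (f ∘ Prod.snd) (g ∘ Prod.snd) (atTime t p) := by
  have h₁ := (represents_c₃ (frame d) hΓ (smoothBivector_slice hQ hR) hf hg).value_eq
  have h₂ := (represents_c₃ (spaceFrame d)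
    (fun i k l => (hΓ i k l).comp (atTime t p) contDiffAt_snd) hQ
    (hf.comp (atTime t p) contDiffAt_snd) (hg.comp (atTime t p) contDiffAt_snd)).value_eq
  refine h₁.symm.trans (Eq.trans ?_ h₂)
  rw [← value_pull (atTime t) (contDiffAt_atTime t p),
    Jet.map_c₃ (D := fun i => partials (𝕜 := 𝕜) (spaceFrame d) (atTime t p) i)
      (D' := fun i => partials (𝕜 := 𝕜) (frame d) p i)
      (pull (𝕜 := 𝕜) (atTime t) (contDiffAt_atTime t p)) (pull_atTime_partials t), pull_atTime_bivector hQ hR,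
    pull_atTime_snd hf, pull_atTime_snd hg]
  simp only [pull_atTime_snd (hΓ _ _ _)]

end Slice

end Time

/-! ### Flows in a chart -/

open Filter Topology

noncomputable section Flow

open SmoothGerm

variable {d : ℕ} {M : Type*} [TopologicalSpace M] [ChartedSpace (Model d) M]
  [IsManifold (𝓡 d) ∞ M] {𝕜 : Type*} [RCLike 𝕜]

/-- A flow in the chart around `x`. -/
def flowRead (x : M) (φ : ℝ → M → M) (v : ℝ × Model d) : Model d :=
  extChartAt (𝓡 d) x (φ v.1 ((extChartAt (𝓡 d) x).symm v.2))

/-- The points of `ℝ × Model d` at which the flow is defined and stays in the chart. -/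
structure FlowPoint (x : M) (U : Set M) (ε : ℝ) (φ : ℝ → M → M) (v : ℝ × Model d) : Prop where
  time : v.1 ∈ Set.Ioo (-ε) ε
  target : v.2 ∈ (extChartAt (𝓡 d) x).target
  domain : (extChartAt (𝓡 d) x).symm v.2 ∈ U
  source : φ v.1 ((extChartAt (𝓡 d) x).symm v.2) ∈ (extChartAt (𝓡 d) x).source

variable {X : (y : M) → TangentSpace (𝓡 d) y} {U : Set M} {ε : ℝ} {φ : ℝ → M → M} {x : M}
  {v : ℝ × Model d}

omit [IsManifold (𝓡 d) ∞ M] in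
theorem IsLocalFlow.contMDiffAt (h : IsLocalFlow X U ε φ) {t : ℝ} (ht : t ∈ Set.Ioo (-ε) ε) {y : M}
    (hy : y ∈ U) : ContMDiffAt (𝓘(ℝ, ℝ).prod (𝓡 d)) (𝓡 d) ∞ (fun p : ℝ × M => φ p.1 p.2) (t, y) :=
  h.smooth.contMDiffAt ((isOpen_Ioo.prod h.isOpen).mem_nhds ⟨ht, hy⟩)

theorem contMDiffAt_time_chart_symm (hv : v.2 ∈ (extChartAt (𝓡 d) x).target) :
    ContMDiffAt 𝓘(ℝ, ℝ × Model d) (𝓘(ℝ, ℝ).prod (𝓡 d)) ∞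
      (fun v : ℝ × Model d => (v.1, (extChartAt (𝓡 d) x).symm v.2)) v :=
  (contDiffAt_fst.contMDiffAt).prodMk
    ((contMDiffAt_chart_symm hv).comp v contDiffAt_snd.contMDiffAt)

theorem IsLocalFlow.contMDiffAt_flow (h : IsLocalFlow X U ε φ) (ht : v.1 ∈ Set.Ioo (-ε) ε)
    (hv : v.2 ∈ (extChartAt (𝓡 d) x).target) (hU : (extChartAt (𝓡 d) x).symm v.2 ∈ U) :
    ContMDiffAt 𝓘(ℝ, ℝ × Model d) (𝓡 d) ∞
      (fun v : ℝ × Model d => φ v.1 ((extChartAt (𝓡 d) x).symm v.2)) v :=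
  ContMDiffAt.comp (g := fun p : ℝ × M => φ p.1 p.2) v (h.contMDiffAt ht hU)
    (contMDiffAt_time_chart_symm hv)

theorem IsLocalFlow.eventually_flowPoint (h : IsLocalFlow X U ε φ) (hx : x ∈ U) :
    ∀ᶠ v in 𝓝 (atTime 0 (extChartAt (𝓡 d) x x)), FlowPoint x U ε φ v := by
  have h0 : (0 : ℝ) ∈ Set.Ioo (-ε) ε := ⟨neg_lt_zero.2 h.pos, h.pos⟩
  have hp := mem_extChartAt_target (I := 𝓡 d) x
  have h₁ : ∀ᶠ v in 𝓝 (atTime 0 (extChartAt (𝓡 d) x x)), v.1 ∈ Set.Ioo (-ε) ε :=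
    continuous_fst.continuousAt.eventually (isOpen_Ioo.mem_nhds h0)
  have h₂ : ∀ᶠ v in 𝓝 (atTime 0 (extChartAt (𝓡 d) x x)), v.2 ∈ (extChartAt (𝓡 d) x).target :=
    continuous_snd.continuousAt.eventually (extChartAt_target_mem_nhds_of_mem hp)
  have h₃ : ∀ᶠ v in 𝓝 (atTime 0 (extChartAt (𝓡 d) x x)), (extChartAt (𝓡 d) x).symm v.2 ∈ U := by
    have hc := (contMDiffAt_chart_symm hp).continuousAt.eventually (p := fun y => y ∈ U)
      (by rw [extChartAt_to_inv]; exact h.isOpen.mem_nhds hx)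
    exact (continuous_snd.tendsto (atTime 0 (extChartAt (𝓡 d) x x))).eventually hc
  have h₄ : ∀ᶠ v in 𝓝 (atTime 0 (extChartAt (𝓡 d) x x)),
      φ v.1 ((extChartAt (𝓡 d) x).symm v.2) ∈ (extChartAt (𝓡 d) x).source := by
    have := h.contMDiffAt_flow (v := atTime 0 (extChartAt (𝓡 d) x x)) (x := x) h0 hp
      (by rw [atTime, extChartAt_to_inv]; exact hx)
    refine this.continuousAt.eventually (p := fun y => y ∈ (extChartAt (𝓡 d) x).source) ?_
    simp only [atTime, extChartAt_to_inv, h.zero x hx]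
    exact extChartAt_source_mem_nhds_of_mem (mem_extChartAt_source x)
  filter_upwards [h₁, h₂, h₃, h₄] with v h₁ h₂ h₃ h₄ using ⟨h₁, h₂, h₃, h₄⟩

theorem IsLocalFlow.contDiffAt_flowRead (h : IsLocalFlow X U ε φ) (hv : FlowPoint x U ε φ v) :
    ContDiffAt ℝ ∞ (flowRead x φ) v :=
  ((contMDiffAt_chart hv.source).comp v
    (h.contMDiffAt_flow hv.time hv.target hv.domain)).contDiffAt

omit [IsManifold (𝓡 d) ∞ M] in
theorem IsLocalFlow.mdifferentiableAt (h : IsLocalFlow X U ε φ) {t : ℝ}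
    (ht : t ∈ Set.Ioo (-ε) ε) {y : M} (hy : y ∈ U) :
    MDifferentiableAt (𝓡 d) (𝓡 d) (φ t) y :=
  (ContMDiffAt.comp (g := fun p : ℝ × M => φ p.1 p.2) y (h.contMDiffAt ht hy)
    (contMDiffAt_const.prodMk contMDiffAt_id)).mdifferentiableAt (by simp)

theorem coordForm_mfderiv {t : ℝ} {y : M} (hφ : MDifferentiableAt (𝓡 d) (𝓡 d) (φ t) y)
    (hs : φ t y ∈ (extChartAt (𝓡 d) x).source) (a : Fin d) (w : TangentSpace (𝓡 d) y) :
    coordForm x a (φ t y) (mfderiv (𝓡 d) (𝓡 d) (φ t) y w)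
      = mvfderiv (𝓡 d) (fun u => extChartAt (𝓡 d) x (φ t u) a) y w := by
  have hc : MDifferentiableAt (𝓡 d) 𝓘(ℝ, ℝ)
      (fun u : M => (EuclideanSpace.proj a : Model d →L[ℝ] ℝ) (extChartAt (𝓡 d) x u)) (φ t y) :=
    ((EuclideanSpace.proj a : Model d →L[ℝ] ℝ).contMDiff.contMDiffAt.comp _
      (contMDiffAt_chart hs)).mdifferentiableAt (n := ∞) (by simp)
  have := mfderiv_comp y hc hφ
  exact (congrArg (fun L : TangentSpace (𝓡 d) y →L[ℝ] ℝ => L w) this).symm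

theorem IsLocalFlow.jac_flowRead (h : IsLocalFlow X U ε φ) (hv : FlowPoint x U ε φ v)
    (i a : Fin d) :
    jac 𝕜 (spaceFrame d) (flowRead x φ) i a v
      = (coordForm x a (φ v.1 ((extChartAt (𝓡 d) x).symm v.2))
          (mfderiv (𝓡 d) (𝓡 d) (φ v.1) ((extChartAt (𝓡 d) x).symm v.2)
            (coordField x i ((extChartAt (𝓡 d) x).symm v.2))) : 𝕜) := by
  rw [coordForm_mfderiv (h.mdifferentiableAt hv.time hv.domain) hv.source,
    mvfderiv_coordField_read ((extChartAt (𝓡 d) x).map_target hv.target),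
    (extChartAt (𝓡 d) x).right_inv hv.target, jac, pd, fderiv_ofReal]
  congr 1
  have hd : DifferentiableAt ℝ (fun v => flowRead x φ v a) v :=
    ((contDiffAt_euclidean.1 (h.contDiffAt_flowRead hv) a).of_le
      (m := 1) (by norm_cast)).differentiableAt one_ne_zero
  have := (HasFDerivAt.comp (g := fun v => flowRead x φ v a) v.2 (f := atTime v.1)
    hd.hasFDerivAt (hasFDerivAt_atTime v.1 v.2)).fderiv
  exact (congrArg (fun L : Model d →L[ℝ] ℝ => L (frame d i)) this).symm

/-- The Jacobian matrix of the flow in the space directions. -/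
def flowJac (𝕜 : Type*) [RCLike 𝕜] (x : M) (φ : ℝ → M → M) (v : ℝ × Model d) :
    Matrix (Fin d) (Fin d) 𝕜 := .of fun i a => jac 𝕜 (spaceFrame d) (flowRead x φ) i a v

theorem IsLocalFlow.isInvertible_mfderiv (h : IsLocalFlow X U ε φ) (hv : FlowPoint x U ε φ v)
    (hJ : IsUnit (flowJac 𝕜 x φ v)) :
    (mfderiv (𝓡 d) (𝓡 d) (φ v.1) ((extChartAt (𝓡 d) x).symm v.2)).IsInvertible := by
  have hy := (extChartAt (𝓡 d) x).map_target hv.target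
  set y := (extChartAt (𝓡 d) x).symm v.2 with hydef
  -- Both tangent spaces are the model space by definition, so the derivative is an endomorphism of
  -- a finite-dimensional space and injectivity suffices.
  let L : Model d →L[ℝ] Model d := mfderiv (𝓡 d) (𝓡 d) (φ v.1) y
  have hinj : Function.Injective (L : Model d →ₗ[ℝ] Model d) := by
    refine (injective_iff_map_eq_zero (L : Model d →ₗ[ℝ] Model d)).2 fun w hw => ?_
    have hsum : ∀ a, ∑ i, coordForm x i y w * coordForm x a (φ v.1 y)
        (mfderiv (𝓡 d) (𝓡 d) (φ v.1) y (coordField x i y)) = 0 := by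
      intro a
      have : coordForm x a (φ v.1 y) (mfderiv (𝓡 d) (𝓡 d) (φ v.1) y w) = 0 := by
        rw [show mfderiv (𝓡 d) (𝓡 d) (φ v.1) y w = 0 from hw, map_zero]
      rw [← this]
      conv_rhs => rw [← sum_coordForm_smul_coordField hy w]
      simp only [map_sum, map_smul, smul_eq_mul]
    have hvec : Matrix.vecMul (fun i => (coordForm x i y w : 𝕜)) (flowJac 𝕜 x φ v) = 0 := by
      funext a
      simp only [Matrix.vecMul, dotProduct, flowJac, Matrix.of_apply, h.jac_flowRead hv]
      rw [← hydef]
      have := congrArg (fun r : ℝ => (r : 𝕜)) (hsum a)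
      push_cast at this
      exact this
    have h0 : (fun i => (coordForm x i y w : 𝕜)) = 0 :=
      Matrix.vecMul_injective_of_isUnit hJ (hvec.trans (Matrix.zero_vecMul _).symm)
    have h0' : ∀ i, coordForm x i y w = 0 := fun i => RCLike.ofReal_eq_zero.1 (congrFun h0 i)
    have := sum_coordForm_smul_coordField hy w
    simp only [h0', zero_smul, Finset.sum_const_zero] at this
    exact this.symm
  exact ⟨(LinearEquiv.ofInjectiveEndo _ hinj).toContinuousLinearEquiv, by ext w; rfl⟩

omit [IsManifold (𝓡 d) ∞ M] in
theorem pushforward_neg_apply (P : TwoTensor d M) (φ : ℝ → M → M) (t : ℝ) (y : M)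
    (α β : TangentSpace (𝓡 d) y →L[ℝ] ℝ) :
    pushforward φ (-t) P y α β = P (φ t y) (α.comp (mfderiv (𝓡 d) (𝓡 d) (φ t) y).inverse)
      (β.comp (mfderiv (𝓡 d) (𝓡 d) (φ t) y).inverse) := by
  -- The tangent space depends on the base point `φ (-(-t)) y`; substituting for a variable `s`
  -- avoids a transport along `-(-t) = t`.
  have : ∀ s, -s = t → pushforward φ s P y α β
      = P (φ t y) (α.comp (mfderiv (𝓡 d) (𝓡 d) (φ t) y).inverse)
        (β.comp (mfderiv (𝓡 d) (𝓡 d) (φ t) y).inverse) := by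
    rintro s rfl
    rfl
  exact this _ (neg_neg t)

/-- The matrix form `Jᵀ Q J = P ∘ φ` of the push-forward, free of the inverse derivative.
Invertibility is essential: otherwise `inverse` takes its default value zero. -/
theorem IsLocalFlow.pushforward_rel (h : IsLocalFlow X U ε φ) (P : TwoTensor d M)
    (hv : FlowPoint x U ε φ v) (hJ : IsUnit (flowJac 𝕜 x φ v)) (a b : Fin d) :
    ∑ i, ∑ j, bivHatK 𝕜 x (pushforward φ (-v.1) P) i j v.2
        * jac 𝕜 (spaceFrame d) (flowRead x φ) i a v * jac 𝕜 (spaceFrame d) (flowRead x φ) j b v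
      = bivHatK 𝕜 x P a b (flowRead x φ v) := by
  have hy := (extChartAt (𝓡 d) x).map_target hv.target
  have hinv := h.isInvertible_mfderiv hv hJ
  simp only [h.jac_flowRead hv, bivHatK, Matrix.map_apply, ofRealFun_apply,
    ← RCLike.ofReal_mul, ← RCLike.ofReal_sum]
  congr 1
  rw [flowRead, bivHat_chart hv.source]
  simp only [bivHat, Matrix.of_apply, pushforward_neg_apply]
  set y := (extChartAt (𝓡 d) x).symm v.2
  have hc : ∀ a : Fin d, coordForm x a (φ v.1 y) = ∑ i, coordForm x a (φ v.1 y)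
      (mfderiv (𝓡 d) (𝓡 d) (φ v.1) y (coordField x i y)) •
        (coordForm x i y).comp (mfderiv (𝓡 d) (𝓡 d) (φ v.1) y).inverse := by
    intro a
    refine ContinuousLinearMap.ext fun w => ?_
    have hw := hinv.self_apply_inverse w
    have hs := sum_coordForm_smul_coordField hy ((mfderiv (𝓡 d) (𝓡 d) (φ v.1) y).inverse w)
    conv_lhs => rw [← hw, ← hs]
    simp only [map_sum, map_smul, smul_eq_mul, sum_apply, smul_apply, ContinuousLinearMap.comp_apply]
    exact Finset.sum_congr rfl fun i _ => mul_comm _ _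
  conv_rhs => rw [hc a, hc b]
  simp only [map_sum, map_smul, LinearMap.sum_apply, LinearMap.smul_apply, smul_eq_mul,
    Finset.mul_sum]
  rw [Finset.sum_comm]
  exact Finset.sum_congr rfl fun i _ => Finset.sum_congr rfl fun j _ => by ring

end Flow

/-! ### The derivative of the push-forward along a flow -/

open Filter Topology
open scoped Matrix

noncomputable section Flow

open SmoothGerm

variable {d : ℕ} {M : Type*} [TopologicalSpace M] [ChartedSpace (Model d) M]
  [IsManifold (𝓡 d) ∞ M] {𝕜 : Type*} [RCLike 𝕜]
  {X : (y : M) → TangentSpace (𝓡 d) y} {U : Set M} {ε : ℝ} {φ : ℝ → M → M} {x : M}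
  {v : ℝ × Model d} {P : TwoTensor d M}

/-- The components of the push-forwards of a tensor along a flow. -/
def pushHat (𝕜 : Type*) [RCLike 𝕜] (x : M) (φ : ℝ → M → M) (P : TwoTensor d M) :
    Matrix (Fin d) (Fin d) (ℝ × Model d → 𝕜) :=
  .of fun i j v => bivHatK 𝕜 x (pushforward φ (-v.1) P) i j v.2

/-- The Jacobian matrix of the flow in the space directions, as a matrix of germs. -/
def flowJacGerm (𝕜 : Type*) [RCLike 𝕜] (x : M) (φ : ℝ → M → M) (v : ℝ × Model d) :
    Matrix (Fin d) (Fin d) (smoothGerm 𝕜 v) :=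
  .of fun i a => D (spaceFrame d i) (germ v fun w => ((flowRead x φ w a : ℝ) : 𝕜))

theorem IsLocalFlow.represents_flowJacGerm (h : IsLocalFlow X U ε φ) (hv : FlowPoint x U ε φ v)
    (i a : Fin d) :
    Represents (jac 𝕜 (spaceFrame d) (flowRead x φ) i a) (flowJacGerm 𝕜 x φ v i a) :=
  represents_jac (spaceFrame d) (h.contDiffAt_flowRead hv) i a

theorem IsLocalFlow.map_value_flowJacGerm (h : IsLocalFlow X U ε φ) (hv : FlowPoint x U ε φ v) :
    (flowJacGerm 𝕜 x φ v).map value = flowJac 𝕜 x φ v := by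
  ext i a
  exact (h.represents_flowJacGerm hv i a).value_eq

/-- The points at which the flow is defined and invertible to first order. -/
structure GoodPoint (𝕜 : Type*) [RCLike 𝕜] (x : M) (U : Set M) (ε : ℝ) (φ : ℝ → M → M)
    (v : ℝ × Model d) : Prop extends FlowPoint x U ε φ v where
  isUnit : IsUnit (flowJac 𝕜 x φ v)

/-- Smoothness is not visible in the definition through `inverse`. The equation `Jᵀ Q J = P ∘ φ` has
the solution `Kᵀ (P ∘ φ) K` with smooth germs, where `K` inverts `J`; uniqueness in the ring of all
germs identifies the push-forward with it. The equation is needed on a whole neighbourhood, hence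
the hypothesis on all nearby points. -/
theorem IsLocalFlow.smoothBivector_pushHat (h : IsLocalFlow X U ε φ)
    (hP : ∀ z ∈ (extChartAt (𝓡 d) x).target, SmoothBivector (bivHat x P) z)
    (hv : ∀ᶠ w in 𝓝 v, GoodPoint 𝕜 x U ε φ w) : SmoothBivector (pushHat 𝕜 x φ P) v := by
  have hv0 := hv.self_of_nhds
  have hJ : IsUnit (flowJacGerm 𝕜 x φ v) := isUnit_matrix_of_value (by
    rw [h.map_value_flowJacGerm hv0.toFlowPoint]
    exact hv0.isUnit)
  obtain ⟨K, hK⟩ := hJ.exists_right_inv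
  have hPψ : ∀ a b, ContDiffAt ℝ ∞ (bivHatK 𝕜 x P a b ∘ flowRead x φ) v := fun a b =>
    ContDiffAt.comp v (contDiffAt_ofRealFun (hP _ ((extChartAt (𝓡 d) x).map_source hv0.source) a b))
      (h.contDiffAt_flowRead hv0.toFlowPoint)
  set Pψ : Matrix (Fin d) (Fin d) (smoothGerm 𝕜 v) :=
    .of fun a b => germ v (bivHatK 𝕜 x P a b ∘ flowRead x φ) with hPψ_def
  set J := flowJacGerm 𝕜 x φ v with hJ_def
  have h₁ : Jᵀ * (Kᵀ * Pψ * K) * J = Pψ := by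
    have hKJ : K * J = 1 := mul_eq_one_comm.1 hK
    have hKJT : Jᵀ * Kᵀ = 1 := by rw [← Matrix.transpose_mul, hKJ, Matrix.transpose_one]
    rw [← mul_assoc, ← mul_assoc, hKJT, one_mul, mul_assoc, hKJ, mul_one]
  have r₁ : Jet.BivectorRel (RingHom.id _) (J.map (smoothGerm 𝕜 v).subtype)
      (Pψ.map (smoothGerm 𝕜 v).subtype) ((Kᵀ * Pψ * K).map (smoothGerm 𝕜 v).subtype) := by
    have := congrArg (fun A => A.map (smoothGerm 𝕜 v).subtype) h₁
    rw [Jet.bivectorRel_iff]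
    refine Eq.trans ?_ (this.trans ?_)
    · simp only [Matrix.map_mul, Matrix.transpose_map]
    · ext; rfl
  have r₂ : Jet.BivectorRel (RingHom.id _) (J.map (smoothGerm 𝕜 v).subtype)
      (Pψ.map (smoothGerm 𝕜 v).subtype) ((pushHat 𝕜 x φ P).map (Germ.coeRingHom (𝓝 v))) := by
    intro a b
    have e₁ : ∀ i a, J.map (smoothGerm 𝕜 v).subtype i a
        = Germ.coeRingHom (𝓝 v) (jac 𝕜 (spaceFrame d) (flowRead x φ) i a) := fun i a =>
      (h.represents_flowJacGerm hv0.toFlowPoint i a).symm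
    have e₂ : Pψ.map (smoothGerm 𝕜 v).subtype a b
        = Germ.coeRingHom (𝓝 v) (bivHatK 𝕜 x P a b ∘ flowRead x φ) := coe_germ (hPψ a b)
    rw [e₂, RingHom.id_apply]
    simp only [e₁, Matrix.map_apply, ← map_mul, ← map_sum]
    refine Germ.coe_eq.2 ?_
    filter_upwards [hv] with w hw
    simp only [Finset.sum_apply, Pi.mul_apply]
    exact h.pushforward_rel P hw.toFlowPoint hw.isUnit a b
  have key := Jet.BivectorRel.unique (hJ.map (RingHom.mapMatrix (smoothGerm 𝕜 v).subtype)) r₂ r₁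
  intro i j
  exact Represents.contDiffAt (φ := (Kᵀ * Pψ * K) i j) (congrFun (congrFun key i) j)

omit [IsManifold (𝓡 d) ∞ M] in
theorem IsLocalFlow.flowRead_zero (h : IsLocalFlow X U ε φ) {z : Model d}
    (hz : FlowPoint x U ε φ (atTime 0 z)) : flowRead x φ (atTime 0 z) = z := by
  have h0 := h.zero _ hz.domain
  simp only [flowRead, atTime] at h0 ⊢
  rw [h0]
  exact (extChartAt (𝓡 d) x).right_inv hz.target

theorem IsLocalFlow.fderiv_flowRead (h : IsLocalFlow X U ε φ) {z : Model d}
    (hz : FlowPoint x U ε φ (atTime 0 z)) :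
    fderiv ℝ (flowRead x φ) (atTime 0 z) ((1 : ℝ), (0 : Model d)) = vecField x X z := by
  have hy := hz.domain
  have hs := hz.source
  simp only [atTime] at hy hs
  have h₁ := (h.integralCurve _ hy 0 ⟨neg_lt_zero.2 h.pos, h.pos⟩).hasMFDerivAt
    (Ioo_mem_nhds (neg_lt_zero.2 h.pos) h.pos)
  have h₂ := ((contMDiffAt_chart hs).mdifferentiableAt (by simp)).hasMFDerivAt
  have h₃ := (h₂.comp (0 : ℝ) h₁).hasFDerivAt
  have h₄ : HasFDerivAt (flowRead x φ) (fderiv ℝ (flowRead x φ) (atTime 0 z)) (atTime 0 z) :=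
    (eventually_hasFDerivAt (h.contDiffAt_flowRead hz)).self_of_nhds
  have h₅ := HasFDerivAt.comp (f := fun t : ℝ => (t, z)) (0 : ℝ) h₄ (hasFDerivAt_prodMk_left 0 z)
  have h₆ := congrArg (fun L : ℝ →L[ℝ] Model d => L 1) (h₅.unique h₃)
  have h₇ : fderiv ℝ (flowRead x φ) (atTime 0 z) ((1 : ℝ), (0 : Model d))
      = chartDeriv x (φ 0 ((extChartAt (𝓡 d) x).symm z)) (X (φ 0 ((extChartAt (𝓡 d) x).symm z))) := by
    refine Eq.trans ?_ (h₆.trans ?_)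
    · simp
    · exact congrArg (fun w => mfderiv (𝓡 d) 𝓘(ℝ, Model d) (extChartAt (𝓡 d) x)
        (φ 0 ((extChartAt (𝓡 d) x).symm z)) w) (one_smul ℝ _)
  rw [h₇, chartDeriv_eq_vecField hs]
  congr 1
  exact h.flowRead_zero hz

theorem IsLocalFlow.eventually_flowPoint_zero (h : IsLocalFlow X U ε φ) (hx : x ∈ U) :
    ∀ᶠ z in 𝓝 (extChartAt (𝓡 d) x x), FlowPoint x U ε φ (atTime 0 z) :=
  (contDiffAt_atTime 0 (extChartAt (𝓡 d) x x)).continuousAt.eventually (h.eventually_flowPoint hx)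

/-- The Taylor expansion `F ∘ φ_t = F + t X F + …` to first order: the flow induces the
infinitesimal coordinate change `Jet.expand`. -/
theorem IsLocalFlow.timeDual_comp_flowRead (h : IsLocalFlow X U ε φ) (hx : x ∈ U)
    (hX : SmoothVec X) {F : Model d → 𝕜} (hF : ContDiffAt ℝ ∞ F (extChartAt (𝓡 d) x x)) :
    timeDual 𝕜 (extChartAt (𝓡 d) x x) (germ _ (F ∘ flowRead x φ))
      = Jet.expand (partials (frame d) _) (vecGerm 𝕜 x X _) (germ _ F) := by
  have h0 := (h.eventually_flowPoint hx).self_of_nhds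
  have hF' : ContDiffAt ℝ ∞ F (flowRead x φ (atTime 0 (extChartAt (𝓡 d) x x))) := by
    rwa [h.flowRead_zero h0]
  have hc : ContDiffAt ℝ ∞ (F ∘ flowRead x φ) (atTime 0 (extChartAt (𝓡 d) x x)) :=
    hF'.comp _ (h.contDiffAt_flowRead h0)
  have hp := mem_extChartAt_target (I := 𝓡 d) x
  rw [timeDual_apply, Jet.expand_apply, pull_germ _ _ hc, D_germ hc,
    pull_germ _ _ (contDiffAt_fderiv_apply hc _)]
  congr 1
  · refine germ_congr ?_
    filter_upwards [h.eventually_flowPoint_zero hx] with z hz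
    rw [Function.comp_apply, Function.comp_apply, h.flowRead_zero hz]
  · rw [← (represents_dir (frame d) (hX.contDiffAtK hp) hF).germ_eq]
    refine germ_congr ?_
    filter_upwards [h.eventually_flowPoint_zero hx, eventually_differentiableAt hF] with z hz hd
    rw [Function.comp_apply]
    have hd' : DifferentiableAt ℝ F (flowRead x φ (atTime 0 z)) := by rwa [h.flowRead_zero hz]
    have := (hd'.hasFDerivAt.comp _
      (eventually_hasFDerivAt (h.contDiffAt_flowRead hz)).self_of_nhds).fderiv
    rw [this, ContinuousLinearMap.comp_apply, h.fderiv_flowRead hz, h.flowRead_zero hz,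
      fderiv_eq_sum_pd, Jet.dir, Finset.sum_apply]
    rfl

theorem partials_germ_coordinate (z : Model d) (i a : Fin d) :
    partials (frame d) z i (germ z fun w => ((w a : ℝ) : 𝕜)) = if i = a then 1 else 0 := by
  have hc : ContDiffAt ℝ ∞ (fun w : Model d => ((w a : ℝ) : 𝕜)) z :=
    contDiffAt_coord contDiffAt_id a
  rw [D_germ hc]
  have : (fun w => fderiv ℝ (fun w : Model d => ((w a : ℝ) : 𝕜)) w (frame d i))
      = fun _ => if i = a then 1 else 0 := by
    funext w
    rw [fderiv_ofReal]
    refine (congrArg (fun r : ℝ => (r : 𝕜)) (pd_coordinate (z := w) EventuallyEq.rfl i)).trans ?_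
    split_ifs <;> simp
  rw [this]
  split_ifs
  · exact Represents.germ_eq (φ := 1) rfl
  · exact Represents.germ_eq (φ := 0) rfl

/-- The preceding expansion for coordinate functions, differentiated in space: the Jacobian of the
flow is `1 + t DX + …`. -/
theorem IsLocalFlow.timeDual_flowJacGerm (h : IsLocalFlow X U ε φ) (hx : x ∈ U)
    (hX : SmoothVec X) :
    (flowJacGerm 𝕜 x φ (atTime 0 (extChartAt (𝓡 d) x x))).map (timeDual 𝕜 _)
      = Jet.jacobian (partials (frame d) _) (vecGerm 𝕜 x X (extChartAt (𝓡 d) x x)) := by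
  refine Matrix.ext fun i a => ?_
  have hF : ContDiffAt ℝ ∞ (fun w : Model d => ((w a : ℝ) : 𝕜)) (extChartAt (𝓡 d) x x) :=
    contDiffAt_coord contDiffAt_id a
  have := h.timeDual_comp_flowRead hx hX hF
  rw [Matrix.map_apply, flowJacGerm, Matrix.of_apply, timeDual_D]
  rw [show (fun w => ((flowRead x φ w a : ℝ) : 𝕜))
    = (fun w : Model d => ((w a : ℝ) : 𝕜)) ∘ flowRead x φ from rfl, this, Jet.expand_apply,
    Jet.jacobian, Jet.dualMatrix, Matrix.of_apply, Jet.dir]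
  simp only [partials_germ_coordinate]
  simp only [mul_ite, mul_one, mul_zero, Finset.sum_ite_eq', Finset.mem_univ, if_true]
  rw [Matrix.one_apply, ← partials_germ_coordinate (𝕜 := 𝕜) (extChartAt (𝓡 d) x x) i a]
  rfl

theorem IsLocalFlow.eventually_goodPoint (h : IsLocalFlow X U ε φ) (hx : x ∈ U)
    (hX : SmoothVec X) :
    ∀ᶠ w in 𝓝 (atTime 0 (extChartAt (𝓡 d) x x)), GoodPoint 𝕜 x U ε φ w := by
  have h0 := (h.eventually_flowPoint hx).self_of_nhds
  have hcont : ContinuousAt (flowJac 𝕜 x φ) (atTime 0 (extChartAt (𝓡 d) x x)) :=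
    continuousAt_pi.2 fun i => continuousAt_pi.2 fun a =>
      (h.represents_flowJacGerm h0 i a).contDiffAt.continuousAt
  have hdet : ContinuousAt (fun w => (flowJac 𝕜 x φ w).det) (atTime 0 (extChartAt (𝓡 d) x x)) :=
    (Continuous.matrix_det continuous_id).continuousAt.comp hcont
  -- At time zero the Jacobian is the constant part of `1 + ε DX`; by continuity of the determinant
  -- it stays invertible nearby.
  have hone : flowJac 𝕜 x φ (atTime 0 (extChartAt (𝓡 d) x x)) = 1 := by
    rw [← h.map_value_flowJacGerm h0]
    have hr := congrArg (fun A => A.map fun a => value a.fst) (h.timeDual_flowJacGerm (𝕜 := 𝕜) hx hX)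
    ext i a
    have := congrFun (congrFun hr i) a
    simp only [Matrix.map_apply, timeDual_apply, value_pull, Jet.jacobian, Jet.dualMatrix,
      Matrix.of_apply, Matrix.one_apply] at this ⊢
    rw [this]
    split_ifs
    · exact map_one value
    · exact map_zero value
  have hne := hdet.eventually_ne (y := 0) (by rw [hone, Matrix.det_one]; exact one_ne_zero)
  filter_upwards [h.eventually_flowPoint hx, hne] with w hw hw'
  exact ⟨hw, (Matrix.isUnit_iff_isUnit_det _).2 hw'.isUnit⟩

/-- The time derivative of the push-forwards is the Lie derivative. -/
theorem IsLocalFlow.timeDual_pushHat (h : IsLocalFlow X U ε φ) (hx : x ∈ U) (hX : SmoothVec X)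
    (hP : ∀ z ∈ (extChartAt (𝓡 d) x).target, SmoothBivector (bivHat x P) z) :
    ((pushHat 𝕜 x φ P).map (germ (atTime 0 (extChartAt (𝓡 d) x x)))).map (timeDual 𝕜 _)
      = Jet.dualMatrix (bivGerm 𝕜 x P _)
        (Jet.lieBivector (partialGerm (extChartAt (𝓡 d) x x)) (bivGerm 𝕜 x P _)
          (vecGerm 𝕜 x X _)) := by
  have hp := mem_extChartAt_target (I := 𝓡 d) x
  have h0 := (h.eventually_flowPoint hx).self_of_nhds
  have hPs : ∀ a b, ContDiffAt ℝ ∞ (bivHatK 𝕜 x P a b) (extChartAt (𝓡 d) x x) := fun a b =>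
    contDiffAt_ofRealFun (hP _ hp a b)
  -- Applying `timeDual` to `Jᵀ Q J = P ∘ φ` gives the bivector law for `1 + ε DX`, of which `P + ε
  -- L_X P` is already a solution.
  refine Jet.BivectorRel.unique (Jet.isUnit_jacobian _ _) ?_ (Jet.bivectorRel_jacobian _ _ _)
  intro a b
  have hgood := h.eventually_goodPoint (𝕜 := 𝕜) hx hX
  have hQ := h.smoothBivector_pushHat hP hgood
  have hrel : ∑ i, ∑ j, germ (atTime 0 (extChartAt (𝓡 d) x x)) (pushHat 𝕜 x φ P i j)
      * flowJacGerm 𝕜 x φ _ i a * flowJacGerm 𝕜 x φ _ j b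
      = germ _ (bivHatK 𝕜 x P a b ∘ flowRead x φ) := by
    refine Represents.eq (Represents.sum _ fun i => Represents.sum _ fun j =>
      ((represents_germ (hQ i j)).mul (h.represents_flowJacGerm h0 i a)).mul
        (h.represents_flowJacGerm h0 j b)) (represents_germ (ContDiffAt.comp _ ?_
          (h.contDiffAt_flowRead h0))) ?_
    · rw [h.flowRead_zero h0]
      exact hPs a b
    · filter_upwards [hgood] with w hw
      exact h.pushforward_rel P hw.toFlowPoint hw.isUnit a b
  have := congrArg (timeDual 𝕜 (extChartAt (𝓡 d) x x)) hrel
  rw [h.timeDual_comp_flowRead hx hX (hPs a b), map_sum] at this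
  simp only [map_sum, map_mul] at this
  rw [← h.timeDual_flowJacGerm hx hX]
  exact this

end Flow

/-! ### The derivatives of the coefficients of the star product -/

open Filter Topology

section ConstMul

namespace Jet

variable {ι R : Type*} [Fintype ι] [CommRing R] {D : ι → Derivation ℤ R R} {P : Matrix ι ι R}
  {c : R}

theorem dir_const_mul (hc : ∀ i, D i c = 0) (X : ι → R) (f : R) :
    dir (fun i => D i) X (c * f) = c * dir (fun i => D i) X f := by
  simp only [dir, Derivation.leibniz, hc, smul_eq_mul, mul_zero, add_zero, Finset.mul_sum]
  exact Finset.sum_congr rfl fun i _ => by ring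

theorem bracket_const_mul_left (hc : ∀ i, D i c = 0) (f g : R) :
    bracket (fun i => D i) P (c * f) g = c * bracket (fun i => D i) P f g := by
  simp only [bracket, Derivation.leibniz, hc, smul_eq_mul, mul_zero, add_zero, Finset.mul_sum]
  exact Finset.sum_congr rfl fun i _ => Finset.sum_congr rfl fun j _ => by ring

theorem bracket_const_mul_right (hc : ∀ i, D i c = 0) (f g : R) :
    bracket (fun i => D i) P f (c * g) = c * bracket (fun i => D i) P f g := by
  simp only [bracket, Derivation.leibniz, hc, smul_eq_mul, mul_zero, add_zero, Finset.mul_sum]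
  exact Finset.sum_congr rfl fun i _ => Finset.sum_congr rfl fun j _ => by ring

end Jet

end ConstMul

noncomputable section Flow

open SmoothGerm

variable {d : ℕ} {M : Type*} [TopologicalSpace M] [ChartedSpace (Model d) M]
  [IsManifold (𝓡 d) ∞ M] {𝕜 : Type*} [RCLike 𝕜] {nabla : Connection d M}
  {X : (y : M) → TangentSpace (𝓡 d) y} {U : Set M} {ε : ℝ} {φ : ℝ → M → M} {x : M}
  {P : TwoTensor d M} {f g : M → 𝕜} {α β : smoothGerm 𝕜 (extChartAt (𝓡 d) x x)}

omit [IsManifold (𝓡 d) ∞ M] in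
theorem value_of_represents_read (hf : Represents (read x f) α) : f x = value α := by
  rw [hf.value_eq, read_chart (mem_extChartAt_source x)]

theorem dirDeriv_eq_value (hX : SmoothVec X) (hf : Represents (read x f) α) :
    dirDeriv X f x = value (Jet.dir (partialGerm _) (vecGerm 𝕜 x X _) α) :=
  value_of_represents_read (represents_read_dirDeriv hX hf)

theorem bracket_eq_value (h : Regular nabla P) (hf : Represents (read x f) α)
    (hg : Represents (read x g) β) :
    bracket P f g x = value (Jet.bracket (partialGerm _) (bivGerm 𝕜 x P _) α β) := by
  rw [bracket_eq_chart P (mem_extChartAt_source x), ← hf.germ_eq, ← hg.germ_eq]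
  exact (represents_bracket (frame d) (h.bivectorK (mem_extChartAt_target x)) hf.contDiffAt
    hg.contDiffAt).value_eq.symm

theorem dirDeriv_eq_mul_value (hX : SmoothVec X) {c : 𝕜}
    (hf : Represents (read x f) (constGerm _ c * α)) :
    dirDeriv X f x = c * value (Jet.dir (partialGerm _) (vecGerm 𝕜 x X _) α) := by
  have e := Jet.dir_const_mul (D := fun i => partials (𝕜 := 𝕜) (frame d) (extChartAt (𝓡 d) x x) i)
    (partialGerm_constGerm (extChartAt (𝓡 d) x x) c) (vecGerm 𝕜 x X _) α
  have e' := congrArg value e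
  rw [map_mul, value_constGerm] at e'
  exact (dirDeriv_eq_value hX hf).trans e'

theorem bracket_eq_mul_value_left (h : Regular nabla P) {c : 𝕜}
    (hf : Represents (read x f) (constGerm _ c * α)) (hg : Represents (read x g) β) :
    bracket P f g x = c * value (Jet.bracket (partialGerm _) (bivGerm 𝕜 x P _) α β) := by
  have e := Jet.bracket_const_mul_left
    (D := fun i => partials (𝕜 := 𝕜) (frame d) (extChartAt (𝓡 d) x x) i) (P := bivGerm 𝕜 x P _)
    (partialGerm_constGerm (extChartAt (𝓡 d) x x) c) α β
  have e' := congrArg value e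
  rw [map_mul, value_constGerm] at e'
  exact (bracket_eq_value h hf hg).trans e'

theorem bracket_eq_mul_value_right (h : Regular nabla P) {c : 𝕜}
    (hf : Represents (read x f) α) (hg : Represents (read x g) (constGerm _ c * β)) :
    bracket P f g x = c * value (Jet.bracket (partialGerm _) (bivGerm 𝕜 x P _) α β) := by
  have e := Jet.bracket_const_mul_right
    (D := fun i => partials (𝕜 := 𝕜) (frame d) (extChartAt (𝓡 d) x x) i) (P := bivGerm 𝕜 x P _)
    (partialGerm_constGerm (extChartAt (𝓡 d) x x) c) α β
  have e' := congrArg value e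
  rw [map_mul, value_constGerm] at e'
  exact (bracket_eq_value h hf hg).trans e'

/-- Smoothness is required only near `x`, in the form of representing germs, because the arguments
will include functions such as `X f`. -/
theorem C₂_eq_value (h : Regular nabla P) (hf : Represents (read x f) α)
    (hg : Represents (read x g) β) :
    C₂ nabla P f g x = -(1 / 6) * value (Jet.c₂ (partialGerm _) (chGerm 𝕜 nabla x _)
      (bivGerm 𝕜 x P _) α β) := by
  have hp := mem_extChartAt_target (I := 𝓡 d) x
  rw [C₂_eq_self (h.smoothAt x) h.skew (fun i k l => by
      filter_upwards [extChartAt_target_mem_nhds_of_mem hp] with u hu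
      exact h.symm x u hu i k l) hf.contDiffAt hg.contDiffAt, ← hf.germ_eq, ← hg.germ_eq]
  congr 1
  exact (represents_c₂ (frame d) (h.christoffelK hp) (h.bivectorK hp) hf.contDiffAt
    hg.contDiffAt).value_eq.symm

theorem C₃_eq_value (h : Regular nabla P) (hf : Represents (read x f) α)
    (hg : Represents (read x g) β) :
    C₃ nabla P f g x = -(1 / 6) * value (Jet.c₃ (partialGerm _) (chGerm 𝕜 nabla x _)
      (bivGerm 𝕜 x P _) α β) := by
  have hp := mem_extChartAt_target (I := 𝓡 d) x
  rw [C₃_eq_self (h.smoothAt x) hf.contDiffAt hg.contDiffAt, ← hf.germ_eq, ← hg.germ_eq]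
  congr 1
  exact (represents_c₃ (frame d) (h.christoffelK hp) (h.bivectorK hp) hf.contDiffAt
    hg.contDiffAt).value_eq.symm

theorem derivCorrection_eq_value (h : Regular nabla P) (hX : SmoothVec X)
    (hg : Represents (read x g) β) :
    derivCorrection nabla P X g x = -(1 / 6) * value (Jet.pairing (bivGerm 𝕜 x P _)
      (Jet.lieGamma (partialGerm _) (chGerm 𝕜 nabla x _) (vecGerm 𝕜 x X _))
      (Jet.lieGamma (partialGerm _) (chGerm 𝕜 nabla x _)
        (Jet.ham (partialGerm _) (bivGerm 𝕜 x P _) β))) := by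
  have hp := mem_extChartAt_target (I := 𝓡 d) x
  rw [derivCorrection_eq_self (h.smoothAt x) (hX x _ hp) hg.contDiffAt, ← hg.germ_eq]
  congr 1
  exact (represents_pairing_ham (frame d) (h.christoffelK hp) (h.bivectorK hp)
    (hX.contDiffAtK hp) hg.contDiffAt).value_eq.symm

theorem represents_read_of_contMDiff (hf : ContMDiff (𝓡 d) 𝓘(ℝ, 𝕜) ∞ f) (x : M) :
    Represents (read x f) (germ (extChartAt (𝓡 d) x x) (read x f)) :=
  represents_germ (contDiffAt_read hf x (mem_extChartAt_target x))

theorem IsLocalFlow.eventually_smooth (h : IsLocalFlow X U ε φ) (hr : Regular nabla P)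
    (hx : x ∈ U) (hX : SmoothVec X) :
    ∀ᶠ t in 𝓝 (0 : ℝ), SmoothBivector (pushHat 𝕜 x φ P) (atTime t (extChartAt (𝓡 d) x x)) := by
  have hc : ContinuousAt (fun t : ℝ => atTime t (extChartAt (𝓡 d) x x)) 0 :=
    (Continuous.prodMk_left _).continuousAt
  filter_upwards [hc.eventually (h.eventually_goodPoint (𝕜 := 𝕜) hx hX).eventually_nhds] with t ht
  exact h.smoothBivector_pushHat (hr.bivector x) ht

theorem smoothAt_pushforward {t : ℝ} (hr : Regular nabla P)
    (h : SmoothBivector (pushHat 𝕜 x φ P) (atTime t (extChartAt (𝓡 d) x x))) :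
    SmoothAt nabla (pushforward φ (-t) P) x where
  christoffel := (hr.smoothAt x).christoffel
  bivector i j := by
    have hs := smoothBivector_slice (R := bivHatK 𝕜 x (pushforward φ (-t) P)) h (fun i j => rfl) i j
    have := (RCLike.reCLM (K := 𝕜)).contDiff.contDiffAt.comp _ hs
    simpa [Function.comp_def, bivHatK, ofRealFun_apply] using this

set_option maxHeartbeats 1000000 in
theorem IsLocalFlow.hasDerivAt_bracket (h : IsLocalFlow X U ε φ) (hr : Regular nabla P)
    (hx : x ∈ U) (hX : SmoothVec X) (hf : ContMDiff (𝓡 d) 𝓘(ℝ, 𝕜) ∞ f)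
    (hg : ContMDiff (𝓡 d) 𝓘(ℝ, 𝕜) ∞ g) :
    HasDerivAt (fun t : ℝ => bracket (pushforward φ (-t) P) f g x)
      (dirDeriv X (bracket P f g) x - bracket P (dirDeriv X f) g x
        - bracket P f (dirDeriv X g) x) 0 := by
  have hp := mem_extChartAt_target (I := 𝓡 d) x
  have rf := represents_read_of_contMDiff hf x
  have rg := represents_read_of_contMDiff hg x
  have hev := h.eventually_smooth (𝕜 := 𝕜) hr hx hX
  have hQ := hev.self_of_nhds
  have hrep := represents_bracket (spaceFrame d) hQ (rf.contDiffAt.comp (atTime 0 _) contDiffAt_snd)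
    (rg.contDiffAt.comp (atTime 0 _) contDiffAt_snd)
  have key := hasDerivAt_of_represents hrep (u := fun t => bracket (pushforward φ (-t) P) f g x) (by
    filter_upwards [hev] with t ht
    rw [bracket_eq_chart _ (mem_extChartAt_source x)]
    exact bracket_slice ht (fun i j => rfl) rf.contDiffAt rg.contDiffAt)
  -- Over the dual numbers the bivector is `P + ε L_X P`, while `f` and `g` do not depend on time
  -- and have no `ε`-part. This is the situation of `Jet.snd_bracket`.
  rw [Jet.map_bracket (D := fun i => partials (𝕜 := 𝕜) (spaceFrame d) (atTime 0 _) i)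
    (D' := fun i => Jet.dualD (partials (𝕜 := 𝕜) (frame d) _ i)) (timeDual 𝕜 _) timeDual_D,
    h.timeDual_pushHat hx hX (hr.bivector x), timeDual_germ_comp_snd rf.contDiffAt,
    timeDual_germ_comp_snd rg.contDiffAt] at key
  have hsnd := Jet.snd_bracket (D := fun i => partials (𝕜 := 𝕜) (frame d) (extChartAt (𝓡 d) x x) i)
    (P := bivGerm 𝕜 x P _) (X := vecGerm 𝕜 x X (extChartAt (𝓡 d) x x))
    (fun i j a => D_comm _ _ a) (germ _ (read x f)) (germ _ (read x g))
  refine (key.congr_deriv (congrArg value hsnd)).congr_deriv ?_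
  rw [dirDeriv_eq_value hX (represents_read_bracket hr hf hg x),
    bracket_eq_value hr (represents_read_dirDeriv hX rf) rg,
    bracket_eq_value hr rf (represents_read_dirDeriv hX rg), map_sub, map_sub]

set_option maxHeartbeats 1000000 in
theorem IsLocalFlow.hasDerivAt_C₂ (h : IsLocalFlow X U ε φ) (hr : Regular nabla P)
    (hx : x ∈ U) (hX : SmoothVec X) (hf : ContMDiff (𝓡 d) 𝓘(ℝ, 𝕜) ∞ f)
    (hg : ContMDiff (𝓡 d) 𝓘(ℝ, 𝕜) ∞ g) :
    HasDerivAt (fun t : ℝ => C₂ nabla (pushforward φ (-t) P) f g x)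
      (dirDeriv X (C₂ nabla P f g) x + derivCorrection nabla P X (f * g) x
        - (C₂ nabla P (dirDeriv X f) g x + derivCorrection nabla P X f x * g x)
        - (C₂ nabla P f (dirDeriv X g) x + f x * derivCorrection nabla P X g x)) 0 := by
  have hp := mem_extChartAt_target (I := 𝓡 d) x
  have rf := represents_read_of_contMDiff hf x
  have rg := represents_read_of_contMDiff hg x
  have hev := h.eventually_smooth (𝕜 := 𝕜) hr hx hX
  have hQ := hev.self_of_nhds
  have hΓ := hr.christoffelK (𝕜 := 𝕜) hp
  have hrep := represents_c₂ (spaceFrame d)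
    (fun i k l => (hΓ i k l).comp (atTime (0 : ℝ) _) contDiffAt_snd) hQ
    (rf.contDiffAt.comp (atTime 0 _) contDiffAt_snd)
    (rg.contDiffAt.comp (atTime 0 _) contDiffAt_snd)
  -- For small `t` the pushed-forward tensor enters only through its skewness and its smoothness
  -- near `x`; the coordinate formula holds for it without a Jacobi identity.
  have hu : ∀ᶠ t in 𝓝 (0 : ℝ), C₂ nabla (pushforward φ (-t) P) f g x
      = -(1 / 6) * Jet.c₂ (pd (spaceFrame d)) (fun i k l => chHatK 𝕜 nabla x i k l ∘ Prod.snd)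
        (pushHat 𝕜 x φ P) (read x f ∘ Prod.snd) (read x g ∘ Prod.snd)
        (t, extChartAt (𝓡 d) x x) := by
    filter_upwards [hev] with t ht
    rw [C₂_eq_self (smoothAt_pushforward hr ht) (fun y α β => hr.skew _ _ _) (fun i k l => by
      filter_upwards [extChartAt_target_mem_nhds_of_mem hp] with u hu
      exact hr.symm x u hu i k l) rf.contDiffAt rg.contDiffAt]
    congr 1
    exact c₂_slice hΓ ht (fun i j => rfl) rf.contDiffAt rg.contDiffAt
  have key := ((hasDerivAt_of_represents hrep (Eventually.of_forall fun t => rfl)).const_mul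
    (-(1 / 6 : 𝕜))).congr_of_eventuallyEq hu
  rw [Jet.map_c₂ (D := fun i => partials (𝕜 := 𝕜) (spaceFrame d) (atTime 0 _) i)
    (D' := fun i => Jet.dualD (partials (𝕜 := 𝕜) (frame d) _ i)) (timeDual 𝕜 _) timeDual_D,
    h.timeDual_pushHat hx hX (hr.bivector x), timeDual_germ_comp_snd rf.contDiffAt,
    timeDual_germ_comp_snd rg.contDiffAt] at key
  simp only [timeDual_germ_comp_snd (hΓ _ _ _)] at key
  have hsnd := Jet.snd_c₂
    (D := fun i => partials (𝕜 := 𝕜) (frame d) (extChartAt (𝓡 d) x x) i) (X := vecGerm 𝕜 x X (extChartAt (𝓡 d) x x)) (fun i j a => D_comm _ _ a)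
    (hr.skew_germ (𝕜 := 𝕜) hp) (hr.symm_germ (𝕜 := 𝕜) hp) (germ _ (read x f)) (germ _ (read x g))
  refine (key.congr_deriv (congrArg (fun a => -(1 / 6 : 𝕜) * value a) hsnd)).congr_deriv ?_
  rw [dirDeriv_eq_mul_value hX (represents_read_C₂ hr hf hg x),
    C₂_eq_value hr (represents_read_dirDeriv hX rf) rg,
    C₂_eq_value hr rf (represents_read_dirDeriv hX rg),
    derivCorrection_eq_value hr hX rf, derivCorrection_eq_value hr hX rg,
    derivCorrection_eq_value hr hX (g := f * g) (rf.mul rg), value_of_represents_read rf,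
    value_of_represents_read rg, map_sub, map_sub, map_add, map_add, map_add, map_mul, map_mul]
  ring

end Flow

/-! ### The time derivative of the third coefficient, where the Jacobi identity enters. -/

open Filter Topology

noncomputable section Flow

open SmoothGerm

variable {d : ℕ} {M : Type*} [TopologicalSpace M] [ChartedSpace (Model d) M]
  [IsManifold (𝓡 d) ∞ M] {𝕜 : Type*} [RCLike 𝕜] {nabla : Connection d M}
  {X : (y : M) → TangentSpace (𝓡 d) y} {U : Set M} {ε : ℝ} {φ : ℝ → M → M} {x : M}
  {P : TwoTensor d M} {f g : M → 𝕜} {α β : smoothGerm 𝕜 (extChartAt (𝓡 d) x x)}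

set_option maxHeartbeats 1000000 in
theorem IsLocalFlow.hasDerivAt_C₃ (h : IsLocalFlow X U ε φ) (hr : Regular nabla P)
    (hJ : ∀ i j k, ∑ l, (bivGerm 𝕜 x P (extChartAt (𝓡 d) x x) i l
        * partialGerm _ l (bivGerm 𝕜 x P _ j k)
      + bivGerm 𝕜 x P _ j l * partialGerm _ l (bivGerm 𝕜 x P _ k i)
      + bivGerm 𝕜 x P _ k l * partialGerm _ l (bivGerm 𝕜 x P _ i j)) = 0)
    (hx : x ∈ U) (hX : SmoothVec X) (hf : ContMDiff (𝓡 d) 𝓘(ℝ, 𝕜) ∞ f)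
    (hg : ContMDiff (𝓡 d) 𝓘(ℝ, 𝕜) ∞ g) :
    HasDerivAt (fun t : ℝ => C₃ nabla (pushforward φ (-t) P) f g x)
      (dirDeriv X (C₃ nabla P f g) x + derivCorrection nabla P X (bracket P f g) x
        - (C₃ nabla P (dirDeriv X f) g x + bracket P (derivCorrection nabla P X f) g x)
        - (C₃ nabla P f (dirDeriv X g) x + bracket P f (derivCorrection nabla P X g) x)) 0 := by
  have hp := mem_extChartAt_target (I := 𝓡 d) x
  have rf := represents_read_of_contMDiff hf x
  have rg := represents_read_of_contMDiff hg x
  have hev := h.eventually_smooth (𝕜 := 𝕜) hr hx hX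
  have hQ := hev.self_of_nhds
  have hΓ := hr.christoffelK (𝕜 := 𝕜) hp
  have hrep := represents_c₃ (spaceFrame d)
    (fun i k l => (hΓ i k l).comp (atTime (0 : ℝ) _) contDiffAt_snd) hQ
    (rf.contDiffAt.comp (atTime 0 _) contDiffAt_snd)
    (rg.contDiffAt.comp (atTime 0 _) contDiffAt_snd)
  have hu : ∀ᶠ t in 𝓝 (0 : ℝ), C₃ nabla (pushforward φ (-t) P) f g x
      = -(1 / 6) * Jet.c₃ (pd (spaceFrame d)) (fun i k l => chHatK 𝕜 nabla x i k l ∘ Prod.snd)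
        (pushHat 𝕜 x φ P) (read x f ∘ Prod.snd) (read x g ∘ Prod.snd)
        (t, extChartAt (𝓡 d) x x) := by
    filter_upwards [hev] with t ht
    rw [C₃_eq_self (smoothAt_pushforward hr ht) rf.contDiffAt rg.contDiffAt]
    congr 1
    exact c₃_slice hΓ ht (fun i j => rfl) rf.contDiffAt rg.contDiffAt
  have key := ((hasDerivAt_of_represents hrep (Eventually.of_forall fun t => rfl)).const_mul
    (-(1 / 6 : 𝕜))).congr_of_eventuallyEq hu
  rw [Jet.map_c₃ (D := fun i => partials (𝕜 := 𝕜) (spaceFrame d) (atTime 0 _) i)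
    (D' := fun i => Jet.dualD (partials (𝕜 := 𝕜) (frame d) _ i)) (timeDual 𝕜 _) timeDual_D,
    h.timeDual_pushHat hx hX (hr.bivector x), timeDual_germ_comp_snd rf.contDiffAt,
    timeDual_germ_comp_snd rg.contDiffAt] at key
  simp only [timeDual_germ_comp_snd (hΓ _ _ _)] at key
  have hsnd := Jet.snd_c₃
    (D := fun i => partials (𝕜 := 𝕜) (frame d) (extChartAt (𝓡 d) x x) i) (X := vecGerm 𝕜 x X (extChartAt (𝓡 d) x x))
    (Γ := chGerm 𝕜 nabla x (extChartAt (𝓡 d) x x)) (fun i j a => D_comm _ _ a)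
    (hr.skew_germ (𝕜 := 𝕜) hp) hJ (germ _ (read x f)) (germ _ (read x g))
  refine (key.congr_deriv (congrArg (fun a => -(1 / 6 : 𝕜) * value a) hsnd)).congr_deriv ?_
  rw [dirDeriv_eq_mul_value hX (represents_read_C₃ hr hf hg x),
    C₃_eq_value hr (represents_read_dirDeriv hX rf) rg,
    C₃_eq_value hr rf (represents_read_dirDeriv hX rg),
    bracket_eq_mul_value_left hr (represents_read_derivCorrection hr hX hf x) rg,
    bracket_eq_mul_value_right hr rf (represents_read_derivCorrection hr hX hg x),
    derivCorrection_eq_value hr hX (represents_read_bracket hr hf hg x),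
    map_sub, map_sub, map_add, map_add, map_add]
  ring


end Flow

/-! ### Coefficients of products of power series -/

open Filter Topology VectorField

noncomputable section Coefficients

open SmoothGerm

variable {d : ℕ} {M : Type*} [TopologicalSpace M] [ChartedSpace (Model d) M]
  {𝕜 : Type*} [RCLike 𝕜]

theorem dirDeriv_zero (X : (y : M) → TangentSpace (𝓡 d) y) : dirDeriv X (0 : M → 𝕜) = 0 := by
  funext y
  simp [dirDeriv]

theorem bracket_zero_left (P : TwoTensor d M) (g : M → 𝕜) : bracket P 0 g = 0 := by
  funext x
  simp [bracket]

theorem bracket_zero_right (P : TwoTensor d M) (f : M → 𝕜) : bracket P f 0 = 0 := by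
  funext x
  simp [bracket]

variable [IsManifold (𝓡 d) ∞ M] (nabla : Connection d M) (P : TwoTensor d M)
  (X : (y : M) → TangentSpace (𝓡 d) y)

theorem hess_zero_fun : hess nabla (0 : M → 𝕜) = 0 := by
  funext x k l
  simp [hess, dirDeriv_zero]

theorem C₂_zero_left (g : M → 𝕜) : C₂ nabla P 0 g = 0 := by
  funext x
  simp [C₂, hess_zero_fun]

theorem C₂_zero_right (f : M → 𝕜) : C₂ nabla P f 0 = 0 := by
  funext x
  simp [C₂, hess_zero_fun]

omit [IsManifold (𝓡 d) ∞ M] in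
theorem ham_zero_fun : ham P (0 : M → ℝ) = 0 := by
  funext x
  simp [ham]

theorem lieComp_zero : lieComp nabla (0 : (y : M) → TangentSpace (𝓡 d) y) = 0 := by
  funext x j k l
  have h0 : ∀ (W : (y : M) → TangentSpace (𝓡 d) y) (y : M),
      mlieBracket (𝓡 d) (0 : (y : M) → TangentSpace (𝓡 d) y) W y = 0 := fun W y => by
    rw [mlieBracket_zero_left]; rfl
  have hz : nabla (fun y => (0 : TangentSpace (𝓡 d) y)) = 0 := nabla.zero
  simp only [lieComp, lieConnection, h0, hz]
  simp

theorem lieHam_zero : lieHam nabla P (0 : M → 𝕜) = 0 := by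
  funext x j k l
  have hre : (fun y : M => RCLike.re ((0 : M → 𝕜) y)) = 0 := by funext y; simp
  have him : (fun y : M => RCLike.im ((0 : M → 𝕜) y)) = 0 := by funext y; simp
  rw [lieHam, hre, him, ham_zero_fun, lieComp_zero]
  simp

theorem C₃_zero_left (g : M → 𝕜) : C₃ nabla P 0 g = 0 := by
  funext x
  simp [C₃, lieHam_zero]

theorem C₃_zero_right (f : M → 𝕜) : C₃ nabla P f 0 = 0 := by
  funext x
  simp [C₃, lieHam_zero]

theorem derivCorrection_zero : derivCorrection nabla P X (0 : M → 𝕜) = 0 := by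
  funext x
  simp [derivCorrection, lieHam_zero]

/-- A constant series has a single coefficient that can be nonzero, so vanishing on zero is the only
part of bilinearity needed to collapse the sums in `star`. -/
theorem starCoeff_zero_left (n : ℕ) (g : M → 𝕜) : starCoeff nabla P n 0 g = 0 := by
  match n with
  | 0 => exact zero_mul g
  | 1 => exact bracket_zero_left P g
  | 2 => exact C₂_zero_left nabla P g
  | 3 => exact C₃_zero_left nabla P g
  | n + 4 => rfl

theorem starCoeff_zero_right (n : ℕ) (f : M → 𝕜) : starCoeff nabla P n f 0 = 0 := by
  match n with
  | 0 => exact mul_zero f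
  | 1 => exact bracket_zero_right P f
  | 2 => exact C₂_zero_right nabla P f
  | 3 => exact C₃_zero_right nabla P f
  | n + 4 => rfl

theorem coeff_star_C_right (n : ℕ) (F : PowerSeries (M → 𝕜)) (g : M → 𝕜) :
    PowerSeries.coeff n (star nabla P F (PowerSeries.C g))
      = ∑ p ∈ Finset.HasAntidiagonal.antidiagonal n,
          starCoeff nabla P p.1 (PowerSeries.coeff p.2 F) g := by
  rw [star, PowerSeries.coeff_mk]
  refine Finset.sum_congr rfl fun p _ => ?_
  rw [Finset.sum_eq_single (p.2, 0)]
  · simp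
  · intro q hq hne
    have : q.2 ≠ 0 := by
      rintro h
      apply hne
      have := Finset.HasAntidiagonal.mem_antidiagonal.1 hq
      rw [h, add_zero] at this
      exact Prod.ext this h
    rw [PowerSeries.coeff_C, if_neg this, starCoeff_zero_right]
  · intro h
    exact absurd (Finset.HasAntidiagonal.mem_antidiagonal.2 (add_zero _)) h

theorem coeff_star_C_left (n : ℕ) (f : M → 𝕜) (G : PowerSeries (M → 𝕜)) :
    PowerSeries.coeff n (star nabla P (PowerSeries.C f) G)
      = ∑ p ∈ Finset.HasAntidiagonal.antidiagonal n,
          starCoeff nabla P p.1 f (PowerSeries.coeff p.2 G) := by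
  rw [star, PowerSeries.coeff_mk]
  refine Finset.sum_congr rfl fun p _ => ?_
  rw [Finset.sum_eq_single (0, p.2)]
  · simp
  · intro q hq hne
    have : q.1 ≠ 0 := by
      rintro h
      apply hne
      have := Finset.HasAntidiagonal.mem_antidiagonal.1 hq
      rw [h, zero_add] at this
      exact Prod.ext h this
    rw [PowerSeries.coeff_C, if_neg this, starCoeff_zero_left]
  · intro h
    exact absurd (Finset.HasAntidiagonal.mem_antidiagonal.2 (zero_add _)) h

theorem coeff_star_C_C (n : ℕ) (f g : M → 𝕜) :
    PowerSeries.coeff n (star nabla P (PowerSeries.C f) (PowerSeries.C g))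
      = starCoeff nabla P n f g := by
  rw [coeff_star_C_right, Finset.sum_eq_single (n, 0)]
  · simp
  · intro q hq hne
    have : q.2 ≠ 0 := by
      rintro h
      apply hne
      have := Finset.HasAntidiagonal.mem_antidiagonal.1 hq
      rw [h, add_zero] at this
      exact Prod.ext this h
    rw [PowerSeries.coeff_C, if_neg this, starCoeff_zero_left]
  · intro h
    exact absurd (Finset.HasAntidiagonal.mem_antidiagonal.2 (add_zero _)) h

theorem coeff_derivOp (n : ℕ) (G : PowerSeries (M → 𝕜)) :
    PowerSeries.coeff n (derivOp nabla P X G) = dirDeriv X (PowerSeries.coeff n G)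
      + if 2 ≤ n then derivCorrection nabla P X (PowerSeries.coeff (n - 2) G) else 0 := by
  rw [derivOp, map_add, PowerSeries.coeff_mk, PowerSeries.coeff_X_pow_mul']
  simp only [PowerSeries.coeff_mk]

theorem coeff_derivOp_C_zero (f : M → 𝕜) :
    PowerSeries.coeff 0 (derivOp nabla P X (PowerSeries.C f)) = dirDeriv X f := by
  simp [coeff_derivOp]

theorem coeff_derivOp_C_two (f : M → 𝕜) :
    PowerSeries.coeff 2 (derivOp nabla P X (PowerSeries.C f)) = derivCorrection nabla P X f := by
  simp [coeff_derivOp, PowerSeries.coeff_C, dirDeriv_zero]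

theorem coeff_derivOp_C (f : M → 𝕜) {n : ℕ} (h0 : n ≠ 0) (h2 : n ≠ 2) :
    PowerSeries.coeff n (derivOp nabla P X (PowerSeries.C f)) = 0 := by
  have : 2 ≤ n → n - 2 ≠ 0 := by omega
  rw [coeff_derivOp, PowerSeries.coeff_C, if_neg h0, dirDeriv_zero, zero_add]
  split_ifs with h
  · rw [PowerSeries.coeff_C, if_neg (this h), derivCorrection_zero]
  · rfl

end Coefficients

/-! ### Symmetry of the coefficients, and the derivation property -/

open Filter Topology

namespace Jet

variable {ι R : Type*} [Fintype ι] [CommRing R]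

theorem c₂_swap (D : ι → R → R) (Γ : ι → ι → ι → R) (P : Matrix ι ι R) (f g : R) :
    c₂ D Γ P f g = c₂ D Γ P g f := by
  rw [c₂, c₂, Matrix.trace_mul_comm]
  ring

theorem c₃_swap (D : ι → R → R) (Γ : ι → ι → ι → R) {P : Matrix ι ι R}
    (hP : ∀ i j, P i j = -P j i) (f g : R) : c₃ D Γ P f g = -c₃ D Γ P g f :=
  pairing_swap hP

end Jet

noncomputable section Symmetry

open SmoothGerm

variable {d : ℕ} {M : Type*} [TopologicalSpace M] [ChartedSpace (Model d) M]
  {𝕜 : Type*} [RCLike 𝕜]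

theorem comp_skew {P : TwoTensor d M} (hP : IsPoisson P) (x : M) (i j : Fin d) :
    comp P x i j = -comp P x j i :=
  hP.skew x _ _

theorem bracket_swap {P : TwoTensor d M} (hP : IsPoisson P) (f g : M → 𝕜) (x : M) :
    bracket P f g x = -bracket P g f x := by
  rw [bracket, bracket, Finset.sum_comm, ← Finset.sum_neg_distrib]
  refine Finset.sum_congr rfl fun i _ => ?_
  rw [← Finset.sum_neg_distrib]
  refine Finset.sum_congr rfl fun j _ => ?_
  rw [comp_skew hP x j i]
  push_cast
  ring

theorem dirDeriv_ham (P : TwoTensor d M) (u : M → ℝ) (g : M → 𝕜) (x : M) :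
    dirDeriv (ham P u) g x = ∑ i, ∑ j, (comp P x i j : 𝕜)
      * ((mvfderiv (𝓡 d) u x (partialAt x i) : ℝ) : 𝕜) * mvfderiv (𝓡 d) g x (partialAt x j) := by
  have h : ∀ j, P x (mvfderiv (𝓡 d) u x) (coordAt x j)
      = ∑ i, mvfderiv (𝓡 d) u x (partialAt x i) * comp P x i j := fun j => by
    conv_lhs => rw [eq_sum_coordAt (mvfderiv (𝓡 d) u x)]
    simp only [map_sum, map_smul, LinearMap.sum_apply, LinearMap.smul_apply, smul_eq_mul, comp]
  simp only [dirDeriv, ham, map_sum, map_smul, h]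
  rw [Finset.sum_comm]
  refine Finset.sum_congr rfl fun j _ => ?_
  rw [Finset.sum_smul]
  refine Finset.sum_congr rfl fun i _ => ?_
  rw [RCLike.real_smul_eq_coe_mul]
  push_cast
  ring

theorem mvfderiv_eq_re_add_im [IsManifold (𝓡 d) ∞ M] {f : M → 𝕜}
    (hf : ContMDiff (𝓡 d) 𝓘(ℝ, 𝕜) ∞ f) (x : M) (i : Fin d) :
    mvfderiv (𝓡 d) f x (partialAt x i)
      = ((mvfderiv (𝓡 d) (fun y => RCLike.re (f y)) x (partialAt x i) : ℝ) : 𝕜)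
        + RCLike.I * ((mvfderiv (𝓡 d) (fun y => RCLike.im (f y)) x (partialAt x i) : ℝ) : 𝕜) := by
  have hd : DifferentiableAt ℝ (f ∘ (extChartAt (𝓡 d) x).symm) (extChartAt (𝓡 d) x x) :=
    (contDiffAt_read hf x (mem_extChartAt_target x)).differentiableAt (by simp)
  have hre := (RCLike.reCLM (K := 𝕜)).hasFDerivAt.comp _ hd.hasFDerivAt
  have him := (RCLike.imCLM (K := 𝕜)).hasFDerivAt.comp _ hd.hasFDerivAt
  rw [mvfderiv_partialAt, mvfderiv_partialAt, mvfderiv_partialAt]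
  have e₁ := congrArg (fun L => L (EuclideanSpace.single i (1 : ℝ) : Model d)) hre.fderiv
  have e₂ := congrArg (fun L => L (EuclideanSpace.single i (1 : ℝ) : Model d)) him.fderiv
  refine (RCLike.re_add_im _).symm.trans ?_
  rw [mul_comm]
  exact congrArg₂ (fun a b : ℝ => (a : 𝕜) + RCLike.I * (b : 𝕜)) e₁.symm e₂.symm

variable [IsManifold (𝓡 d) ∞ M] {nabla : Connection d M} {P : TwoTensor d M} {f g : M → 𝕜}

theorem bracket_eq_dirDeriv_ham (P : TwoTensor d M) (hf : ContMDiff (𝓡 d) 𝓘(ℝ, 𝕜) ∞ f)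
    (g : M → 𝕜) (x : M) :
    bracket P f g x = dirDeriv (ham P fun y => RCLike.re (f y)) g x
      + RCLike.I * dirDeriv (ham P fun y => RCLike.im (f y)) g x := by
  rw [dirDeriv_ham, dirDeriv_ham, Finset.mul_sum, ← Finset.sum_add_distrib]
  refine Finset.sum_congr rfl fun i _ => ?_
  rw [Finset.mul_sum, ← Finset.sum_add_distrib]
  refine Finset.sum_congr rfl fun j _ => ?_
  rw [mvfderiv_eq_re_add_im hf]
  ring

/-- Both sides are linear in the real and imaginary Lie derivatives by definition, so no smoothness
enters. -/
theorem C₃_eq_derivCorrection_ham (nabla : Connection d M) (P : TwoTensor d M) (f g : M → 𝕜)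
    (x : M) :
    C₃ nabla P f g x = derivCorrection nabla P (ham P fun y => RCLike.re (f y)) g x
      + RCLike.I * derivCorrection nabla P (ham P fun y => RCLike.im (f y)) g x := by
  simp only [C₃, derivCorrection, lieHam, Finset.mul_sum, ← Finset.sum_add_distrib]
  refine Finset.sum_congr rfl fun _ _ => Finset.sum_congr rfl fun _ _ =>
    Finset.sum_congr rfl fun _ _ => Finset.sum_congr rfl fun _ _ => ?_
  ring

theorem C₂_swap (hr : Regular nabla P) (hf : ContMDiff (𝓡 d) 𝓘(ℝ, 𝕜) ∞ f)
    (hg : ContMDiff (𝓡 d) 𝓘(ℝ, 𝕜) ∞ g) (x : M) : C₂ nabla P f g x = C₂ nabla P g f x := by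
  have rf := represents_read_of_contMDiff hf x
  have rg := represents_read_of_contMDiff hg x
  rw [C₂_eq_value hr rf rg, C₂_eq_value hr rg rf]
  exact congrArg (fun a => -(1 / 6 : 𝕜) * value a) (Jet.c₂_swap _ _ _ _ _)

theorem C₃_swap (hr : Regular nabla P) (hf : ContMDiff (𝓡 d) 𝓘(ℝ, 𝕜) ∞ f)
    (hg : ContMDiff (𝓡 d) 𝓘(ℝ, 𝕜) ∞ g) (x : M) : C₃ nabla P f g x = -C₃ nabla P g f x := by
  have rf := represents_read_of_contMDiff hf x
  have rg := represents_read_of_contMDiff hg x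
  rw [C₃_eq_value hr rf rg, C₃_eq_value hr rg rf, ← mul_neg, ← map_neg]
  exact congrArg (fun a => -(1 / 6 : 𝕜) * value a)
    (Jet.c₃_swap _ _ (hr.skew_germ (𝕜 := 𝕜) (mem_extChartAt_target x)) _ _)

/-- Orders zero and two are symmetric and cancel; orders one and three are skew and double.
Multiplication by the formal parameter shifts the index, so these match the coefficients of order
zero and two of `D_{X_f} g`. -/
theorem star_sub_star_swap (hP : IsPoisson P) (hr : Regular nabla P)
    (hf : ContMDiff (𝓡 d) 𝓘(ℝ, 𝕜) ∞ f) (hg : ContMDiff (𝓡 d) 𝓘(ℝ, 𝕜) ∞ g) :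
    star nabla P (PowerSeries.C f) (PowerSeries.C g)
        - star nabla P (PowerSeries.C g) (PowerSeries.C f)
      = 2 * PowerSeries.X * derivOpHam nabla P f (PowerSeries.C g) := by
  ext1 n
  have h2 : (2 : PowerSeries (M → 𝕜)) = PowerSeries.C 2 := (map_ofNat _ 2).symm
  rw [map_sub, coeff_star_C_C, coeff_star_C_C, mul_assoc, h2, PowerSeries.coeff_C_mul]
  match n with
  | 0 =>
    rw [PowerSeries.coeff_zero_X_mul, mul_zero]
    exact sub_eq_zero.2 (mul_comm f g)
  | n + 1 =>
    rw [PowerSeries.coeff_succ_X_mul, derivOpHam, map_add, PowerSeries.coeff_smul]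
    funext x
    match n with
    | 0 =>
      rw [coeff_derivOp_C_zero, coeff_derivOp_C_zero]
      change bracket P f g x - bracket P g f x = 2 * (_ + RCLike.I * _)
      rw [bracket_swap hP g f, ← bracket_eq_dirDeriv_ham P hf]
      ring
    | 1 =>
      rw [coeff_derivOp_C _ _ _ _ (by simp) (by simp), coeff_derivOp_C _ _ _ _ (by simp) (by simp)]
      change C₂ nabla P f g x - C₂ nabla P g f x = _
      rw [C₂_swap hr hf hg]
      simp
    | 2 =>
      rw [coeff_derivOp_C_two, coeff_derivOp_C_two]
      change C₃ nabla P f g x - C₃ nabla P g f x = 2 * (_ + RCLike.I * _)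
      rw [C₃_swap hr hg hf, ← C₃_eq_derivCorrection_ham]
      ring
    | n + 3 =>
      rw [coeff_derivOp_C _ _ _ _ (by simp) (by simp), coeff_derivOp_C _ _ _ _ (by simp) (by simp)]
      simp [starCoeff]

theorem dirDeriv_mul (X : (y : M) → TangentSpace (𝓡 d) y)
    (hf : ContMDiff (𝓡 d) 𝓘(ℝ, 𝕜) ∞ f) (hg : ContMDiff (𝓡 d) 𝓘(ℝ, 𝕜) ∞ g) (x : M) :
    dirDeriv X (f * g) x = dirDeriv X f x * g x + f x * dirDeriv X g x := by
  have hd : ∀ {u : M → 𝕜}, ContMDiff (𝓡 d) 𝓘(ℝ, 𝕜) ∞ u →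
      DifferentiableAt ℝ (u ∘ (extChartAt (𝓡 d) x).symm) (extChartAt (𝓡 d) x x) := fun hu =>
    (contDiffAt_read hu x (mem_extChartAt_target x)).differentiableAt (by simp)
  have hx := mem_extChartAt_source (I := 𝓡 d) x
  have hl : ∀ u : M → 𝕜, (u ∘ (extChartAt (𝓡 d) x).symm) (extChartAt (𝓡 d) x x) = u x := fun u =>
    congrArg u ((extChartAt (𝓡 d) x).left_inv hx)
  have e := congrArg (fun L => L (chartDeriv x x (X x))) (fderiv_mul (hd hf) (hd hg))
  simp only [hl, add_apply, smul_apply, smul_eq_mul] at e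
  rw [dirDeriv, dirDeriv, dirDeriv, mvfderiv_eq_fderiv_chart hx, mvfderiv_eq_fderiv_chart hx,
    mvfderiv_eq_fderiv_chart hx, add_comm, mul_comm (fderiv ℝ _ _ _) (g x)]
  exact e

/-- On a constant series `D_X` has only coefficients of order zero and two. Its correction therefore
meets the pointwise product at order two and the bracket at order three, as in the formulas for the
derivatives of `C₂` and `C₃`. -/
theorem hasDerivAt_coeff_star [T2Space M] {X : (y : M) → TangentSpace (𝓡 d) y} {U : Set M} {ε : ℝ}
    {φ : ℝ → M → M} {x : M} (hP : IsPoisson P) (hr : Regular nabla P) (hX : SmoothVec X)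
    (h : IsLocalFlow X U ε φ) (hf : ContMDiff (𝓡 d) 𝓘(ℝ, 𝕜) ∞ f)
    (hg : ContMDiff (𝓡 d) 𝓘(ℝ, 𝕜) ∞ g) (hx : x ∈ U) {n : ℕ} (hn : n < 4) :
    HasDerivAt (fun t : ℝ => PowerSeries.coeff n
        (star nabla (pushforward φ (-t) P) (PowerSeries.C f) (PowerSeries.C g)) x)
      (PowerSeries.coeff n
        (derivOp nabla P X (star nabla P (PowerSeries.C f) (PowerSeries.C g))
          - star nabla P (derivOp nabla P X (PowerSeries.C f)) (PowerSeries.C g)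
          - star nabla P (PowerSeries.C f) (derivOp nabla P X (PowerSeries.C g))) x) 0 := by
  have h1 : ∀ u : M → 𝕜, PowerSeries.coeff 1 (derivOp nabla P X (PowerSeries.C u)) = 0 := fun u =>
    coeff_derivOp_C nabla P X u (by simp) (by simp)
  have h3 : ∀ u : M → 𝕜, PowerSeries.coeff 3 (derivOp nabla P X (PowerSeries.C u)) = 0 := fun u =>
    coeff_derivOp_C nabla P X u (by simp) (by simp)
  rw [map_sub, map_sub, coeff_derivOp, coeff_star_C_C, coeff_star_C_C, coeff_star_C_right,
    coeff_star_C_left]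
  simp only [coeff_star_C_C]
  interval_cases n
  · simp only [Finset.Nat.antidiagonal_zero, Finset.sum_singleton, coeff_derivOp_C_zero]
    -- The pointwise product does not depend on the tensor, so order zero is the Leibniz rule for
    -- `X`.
    refine (hasDerivAt_const (0 : ℝ) ((f * g) x)).congr_deriv ?_
    simp [starCoeff, dirDeriv_mul X hf hg]
  · simp only [Finset.Nat.antidiagonal_succ, Finset.Nat.antidiagonal_zero, Finset.sum_cons,
      Finset.map_singleton, Finset.sum_singleton]
    refine (h.hasDerivAt_bracket hr hx hX hf hg).congr_deriv ?_
    simp [starCoeff, coeff_derivOp_C_zero, h1]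
  · simp only [Finset.Nat.antidiagonal_succ, Finset.Nat.antidiagonal_zero, Finset.sum_cons,
      Finset.map_cons, Finset.map_singleton, Finset.sum_singleton]
    refine (h.hasDerivAt_C₂ hr hx hX hf hg).congr_deriv ?_
    simp [starCoeff, coeff_derivOp_C_zero, coeff_derivOp_C_two, h1, bracket_zero_left,
      bracket_zero_right]
    ring
  · simp only [Finset.Nat.antidiagonal_succ, Finset.Nat.antidiagonal_zero, Finset.sum_cons,
      Finset.map_cons, Finset.map_singleton, Finset.sum_singleton]
    refine (h.hasDerivAt_C₃ hr (fun i j k => hP.jacobi_germ (𝕜 := 𝕜) (mem_extChartAt_target x) i j k) hx hX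
      hf hg).congr_deriv ?_
    simp [starCoeff, coeff_derivOp_C_zero, coeff_derivOp_C_two, h1, h3, C₂_zero_left, C₂_zero_right]
    ring

end Symmetry

end UniversalStar

theorem mainTheorem6 {𝕜 : Type*} [RCLike 𝕜] {d : ℕ} {M : Type*} [TopologicalSpace M] [T2Space M]
    [ChartedSpace (UniversalStar.Model d) M] [IsManifold (𝓡 d) ∞ M]
    (nabla : UniversalStar.Connection d M)
    (hsmooth : CovariantDerivative.ContMDiffCovariantDerivative nabla ∞)
    (htorsion : nabla.torsion = 0)
    (P : UniversalStar.TwoTensor d M) (hP : UniversalStar.IsPoisson P) :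
    (∀ X : (y : M) → TangentSpace (𝓡 d) y,
      ContMDiff (𝓡 d) (𝓡 d).tangent ∞ (fun y => (⟨y, X y⟩ : TangentBundle (𝓡 d) M)) →
      ∀ (U : Set M) (ε : ℝ) (φ : ℝ → M → M), UniversalStar.IsLocalFlow X U ε φ →
      ∀ f g : M → 𝕜, ContMDiff (𝓡 d) 𝓘(ℝ, 𝕜) ∞ f → ContMDiff (𝓡 d) 𝓘(ℝ, 𝕜) ∞ g →
      ∀ x ∈ U, ∀ n < 4,
        HasDerivAt
          (fun t : ℝ => PowerSeries.coeff n
            (UniversalStar.star nabla (UniversalStar.pushforward φ (-t) P)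
              (PowerSeries.C f) (PowerSeries.C g)) x)
          (PowerSeries.coeff n
            (UniversalStar.derivOp nabla P X
                (UniversalStar.star nabla P (PowerSeries.C f) (PowerSeries.C g))
              - UniversalStar.star nabla P
                  (UniversalStar.derivOp nabla P X (PowerSeries.C f)) (PowerSeries.C g)
              - UniversalStar.star nabla P
                  (PowerSeries.C f) (UniversalStar.derivOp nabla P X (PowerSeries.C g))) x)
          0) ∧
    (∀ f g : M → 𝕜, ContMDiff (𝓡 d) 𝓘(ℝ, 𝕜) ∞ f → ContMDiff (𝓡 d) 𝓘(ℝ, 𝕜) ∞ g →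
      UniversalStar.star nabla P (PowerSeries.C f) (PowerSeries.C g)
          - UniversalStar.star nabla P (PowerSeries.C g) (PowerSeries.C f)
        = 2 * PowerSeries.X * UniversalStar.derivOpHam nabla P f (PowerSeries.C g)) := by
  have hr := UniversalStar.regular hsmooth htorsion hP
  exact ⟨fun X hX U ε φ h f g hf hg x hx n hn => UniversalStar.hasDerivAt_coeff_star hP hr
      (UniversalStar.smoothVec_of_contMDiff hX) h hf hg hx hn,
    fun f g hf hg => UniversalStar.star_sub_star_swap hP hr hf hg⟩
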